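/- **Proposition 6.3 (Lower bound on the Monge–Ampère measure of a small $\tilde c$-cone).** *Assumptions on the cost.* Let $U,V\subset\mathbb R^n$ be open and bounded and $c\in C^4(\overline U\times\overline V)$ (B0). Assume: (B1) for all $\bar y\in\overline V$ and $\bar x\in\overline U$, the maps $x\in\overline U\mapsto -D_yc(x,\bar y)$ and $y\in\overline V\mapsto -D_xc(\bar x,y)$ are diffeomorphisms (of class $C^3$) onto their ranges; (B2) for all such $\bar y,\bar x$ the sets $U_{\bar y}:=-D_yc(U,\bar y)$ and $V_{\bar x}:=-D_xc(\bar x,V)$ are convex; (B3) $-\frac{\partial^4}{\partial s^2\partial t^2}\big|_{(s,t)=(0,0)}c(x(s),y(t))\ge 0$ for all curves $x:[-1,1]\to\overline U$, $y:[-1,1]\to\overline V$ such that $t\mapsto (D_yc(x(t),y(0)),D_xc(x(0),y(t)))$ is an affinely parameterized line segment. Define $\varepsilon_c\in[0,\infty]$ by $$\varepsilon_c^{-1}=2\,(\beta_c^+)^4(\beta_c^-)^6\,\|D^3_{xxy}c\|_{L^\infty(U\times V)},\qquad \beta_c^{\pm}=\|(D^2_{xy}c)^{\pm1}\|_{L^\infty(U\times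 V)}$$ (operator norms; $\varepsilon_c=\infty$ if the right-hand side is $0$). *Modified cost and cones.* Fix $\bar y\in\overline V$, let $q\in\overline{U_{\bar y}}\mapsto x(q)\in\overline U$ be the inverse of $x\mapsto -D_yc(x,\bar y)$, and put $\tilde c(q,y)=c(x(q),y)-c(x(q),\bar y)$. A function $u$ on $\overline U$ is $c$-convex if $u(x)=\sup_{y\in\overline V}(-c(x,y)-u^{c^*}(y))$ for $x\in\overline U$, where $u^{c^*}(y)=\sup_{x\in\overline U}(-c(x,y)-u(x))$; put $\tilde u(q)=u(x(q))+c(x(q),\bar y)$. If $Z=\{q\in\overline{U_{\bar y}}:\tilde u(q)\le 0\}$, $\tilde u=0$ on $\partial Z$, $\tilde q\in\operatorname{int}Z$ and $\tilde u(\tilde q)<0$ for some $c$-convex $u$, then the *$\tilde c$-cone generated by $\tilde q$ and $Z$ with height $-\tilde u(\tilde q)$* is $$h(q)=\sup_{y\in\overline V}\{-\tilde c(q,y)+\tilde c(\tilde q,y)+\tilde u(\tilde q)\;:\;-\tilde c(\cdot,y)+\tilde c(\tilde q,y)+\tilde u(\tilde q)\le 0\text{ on }\partial Z\},\qquad q\in\overline{U_{\bar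 y}}.$$ For $q\in\overline{U_{\bar y}}$ let $\partial h(q)$ be the set of $p\in\mathbb R^n$ with $h(q')\ge h(q)+\langle p,q'-q\rangle+o(|q'-q|)$ as $q'\to q$ in $\overline{U_{\bar y}}$, and let $|\partial h|(\{q\})$ be the Lebesgue measure of $\partial h(q)$. *Claim.* There is a constant $C(n)>0$ depending only on $n$ such that, whenever $c$ satisfies (B0)–(B3) on $U\times V$, one has $\varepsilon_c>0$ and the following holds for every $\bar y\in\overline V$. Let $Z\subset\overline{U_{\bar y}}$ be a closed convex set, let $h$ be a $\tilde c$-cone generated by some $\tilde q\in\operatorname{int}Z$ and $Z$ (with positive height), and let $\Pi^+,\Pi^-$ be two parallel hyperplanes that support $Z$ from two opposite sides (each meets $\partial Z$, and $Z$ lies between them). If $\operatorname{diam}Z\le\varepsilon_c/C(n)$, then $$|h(\tilde q)|^n\le C(n)\,\frac{\min\{\operatorname{dist}(\tilde q,\Pi^+),\operatorname{dist}(\tilde q,\Pi^-)\}}{\ell_{\Pi^+}}\;|\partial h|(\{\tilde q\})\;\mathrm{Leb}(Z),$$ where $\ell_{\Pi^+}$ is the maximal length among all segments obtained by intersecting $Z$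 with a line orthogonal to $\Pi^+$. -/

import Mathlib

open Set Filter Topology MeasureTheory
open scoped ENNReal

namespace CCone

/-- Euclidean space `ℝⁿ`. -/
abbrev E (n : ℕ) : Type := EuclideanSpace ℝ (Fin n)

noncomputable section

/-- `D_x c(x, y)` as a vector, for `x ∈ closure U` (one-sided at the boundary of `U`). -/
def gradX {n : ℕ} (U : Set (E n)) (c : E n → E n → ℝ) (x y : E n) : E n :=
  gradientWithin (fun x' => c x' y) (closure U) x

/-- `D_y c(x, y)` as a vector, for `y ∈ closure V` (one-sided at the boundary of `V`). -/
def gradY {n : ℕ} (V : Set (E n)) (c : E n → E n → ℝ) (x y : E n) : E n :=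
  gradientWithin (fun y' => c x y') (closure V) y

/-- `f` is a `C³` diffeomorphism from `S` onto its range `f '' S`
(`C³` is the smoothness class of the first derivatives of a `C⁴` cost). -/
def IsDiffeoOnRange {n : ℕ} (f : E n → E n) (S : Set (E n)) : Prop :=
  ContDiffOn ℝ 3 f S ∧ ∃ g : E n → E n, ContDiffOn ℝ 3 g (f '' S) ∧ LeftInvOn g f S

/-- The map `t ∈ [-1, 1] ↦ f t` is an affinely parameterized line segment. -/
def IsSegment {n : ℕ} (f : ℝ → E n) : Prop :=
  ∃ a v : E n, ∀ t ∈ Icc (-1 : ℝ) 1, f t = a + t • v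

/-- The standing assumptions on the domains and on the cost: `U, V` open and bounded and
`c ∈ C⁴`, bi-twist, bi-convexity, and non-negative cross-curvature. -/
structure IsCrossCurvedCost {n : ℕ} (U V : Set (E n)) (c : E n → E n → ℝ) : Prop where
  isOpen_left : IsOpen U
  isOpen_right : IsOpen V
  bounded_left : Bornology.IsBounded U
  bounded_right : Bornology.IsBounded V
  smooth : ContDiffOn ℝ 4 (fun p : E n × E n => c p.1 p.2) (closure U ×ˢ closure V)
  twist_left : ∀ y ∈ closure V, IsDiffeoOnRange (fun x => -gradY V c x y) (closure U)
  twist_right : ∀ x ∈ closure U, IsDiffeoOnRange (fun y => -gradX U c x y) (closure V)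
  convex_left : ∀ y ∈ closure V, Convex ℝ ((fun x => -gradY V c x y) '' U)
  convex_right : ∀ x ∈ closure U, Convex ℝ ((fun y => -gradX U c x y) '' V)
  cross : ∀ x y : ℝ → E n,
    (∀ s ∈ Icc (-1 : ℝ) 1, x s ∈ closure U) → (∀ t ∈ Icc (-1 : ℝ) 1, y t ∈ closure V) →
    IsSegment (fun s => gradY V c (x s) (y 0)) → IsSegment (fun t => gradX U c (x 0) (y t)) →
    0 ≤ -(iteratedDeriv 2 (fun s => iteratedDeriv 2 (fun t => c (x s) (y t)) 0) 0)

/-- The mixed second derivative `D²_{xy} c(x, y)`, as a linear map on `ℝⁿ`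
(the `x`-derivative of `D_y c`). -/
def mixedXY {n : ℕ} (V : Set (E n)) (c : E n → E n → ℝ) (x y : E n) : E n →L[ℝ] E n :=
  fderiv ℝ (fun x' => gradY V c x' y) x

/-- The derivative `D³_{xxy} c(x, y)`, as a bilinear map on `ℝⁿ` with values in `ℝⁿ`. -/
def mixedXXY {n : ℕ} (V : Set (E n)) (c : E n → E n → ℝ) (x y : E n) :
    E n →L[ℝ] E n →L[ℝ] E n :=
  fderiv ℝ (fun x' => mixedXY V c x' y) x

/-- `β⁺_c`, the supremum over `U × V` of the operator norm of `D²_{xy} c`. -/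
def betaPlus {n : ℕ} (U V : Set (E n)) (c : E n → E n → ℝ) : ℝ≥0∞ :=
  ⨆ x ∈ U, ⨆ y ∈ V, ‖mixedXY V c x y‖ₑ

/-- `β⁻_c`, the supremum over `U × V` of the operator norm of `(D²_{xy} c)⁻¹`. -/
def betaMinus {n : ℕ} (U V : Set (E n)) (c : E n → E n → ℝ) : ℝ≥0∞ :=
  ⨆ x ∈ U, ⨆ y ∈ V, ‖(mixedXY V c x y).inverse‖ₑ

/-- The supremum over `U × V` of the norm of `D³_{xxy} c`. -/
def normXXY {n : ℕ} (U V : Set (E n)) (c : E n → E n → ℝ) : ℝ≥0∞ :=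
  ⨆ x ∈ U, ⨆ y ∈ V, ‖mixedXXY V c x y‖ₑ

/-- `ε_c`, given by `ε_c⁻¹ = 2 (β⁺_c)⁴ (β⁻_c)⁶ ‖D³_{xxy} c‖_∞`; it is `∞` if `D³_{xxy} c = 0`. -/
def epsCost {n : ℕ} (U V : Set (E n)) (c : E n → E n → ℝ) : ℝ≥0∞ :=
  (2 * betaPlus U V c ^ 4 * betaMinus U V c ^ 6 * normXXY U V c)⁻¹

/-- The cost exponential coordinate `q(x) = -D_y c(x, y₀)`. -/
def qCoord {n : ℕ} (V : Set (E n)) (c : E n → E n → ℝ) (y₀ x : E n) : E n :=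
  -gradY V c x y₀

/-- The closed domain of the coordinate `q`: the closure of `U_{y₀} = -D_y c(U, y₀)`. -/
def qDomain {n : ℕ} (U V : Set (E n)) (c : E n → E n → ℝ) (y₀ : E n) : Set (E n) :=
  closure (qCoord V c y₀ '' U)

/-- The inverse coordinate change `x(q)`, with values in `closure U`. -/
def xCoord {n : ℕ} (U V : Set (E n)) (c : E n → E n → ℝ) (y₀ q : E n) : E n :=
  Function.invFunOn (qCoord V c y₀) (closure U) q

/-- The modified cost `c̃(q, y) = c(x(q), y) - c(x(q), y₀)`. -/
def modCost {n : ℕ} (U V : Set (E n)) (c : E n → E n → ℝ) (y₀ q y : E n) : ℝ :=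
  c (xCoord U V c y₀ q) y - c (xCoord U V c y₀ q) y₀

/-- The transform `u^{c*}(y) = sup_{x ∈ closure U} (-c(x, y) - u(x))`. -/
def cStarTransform {n : ℕ} (U : Set (E n)) (c : E n → E n → ℝ) (u : E n → ℝ) (y : E n) : ℝ :=
  sSup ((fun x => -c x y - u x) '' closure U)

/-- The transform `v^c(x) = sup_{y ∈ closure V} (-c(x, y) - v(y))`. -/
def cTransform {n : ℕ} (V : Set (E n)) (c : E n → E n → ℝ) (v : E n → ℝ) (x : E n) : ℝ :=
  sSup ((fun y => -c x y - v y) '' closure V)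

/-- `u` is `c`-convex on `closure U`: `u = u^{c*c}` there. -/
def IsCConvex {n : ℕ} (U V : Set (E n)) (c : E n → E n → ℝ) (u : E n → ℝ) : Prop :=
  ∀ x ∈ closure U, u x = cTransform V c (cStarTransform U c u) x

/-- The modified potential `ũ(q) = u(x(q)) + c(x(q), y₀)`. -/
def modPotential {n : ℕ} (U V : Set (E n)) (c : E n → E n → ℝ) (y₀ : E n) (u : E n → ℝ)
    (q : E n) : ℝ :=
  u (xCoord U V c y₀ q) + c (xCoord U V c y₀ q) y₀

/-- The function
`q ↦ sup { -c̃(q, y) + c̃(q₀, y) - H | y ∈ closure V, -c̃(·, y) + c̃(q₀, y) - H ≤ 0 on ∂Z }`. -/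
def coneFun {n : ℕ} (U V : Set (E n)) (c : E n → E n → ℝ) (y₀ : E n) (Z : Set (E n))
    (q₀ : E n) (H : ℝ) (q : E n) : ℝ :=
  sSup ((fun y => -modCost U V c y₀ q y + modCost U V c y₀ q₀ y - H) ''
    {y ∈ closure V | ∀ z ∈ frontier Z, -modCost U V c y₀ z y + modCost U V c y₀ q₀ y - H ≤ 0})

/-- `h` is the `c̃`-cone generated by the vertex `q₀ ∈ int Z` and the set `Z`. As in the
definition of a `c̃`-cone, `Z` is the section `{ũ ≤ 0}` of the modified potential `ũ` of some
`c`-convex function `u`, with `ũ = 0` on `∂Z`, and the height of the cone is `-ũ(q₀) > 0`. -/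
def IsCCone {n : ℕ} (U V : Set (E n)) (c : E n → E n → ℝ) (y₀ : E n) (Z : Set (E n))
    (q₀ : E n) (h : E n → ℝ) : Prop :=
  q₀ ∈ interior Z ∧ ∃ u : E n → ℝ, IsCConvex U V c u ∧
    Z = {q ∈ qDomain U V c y₀ | modPotential U V c y₀ u q ≤ 0} ∧
    (∀ q ∈ frontier Z, modPotential U V c y₀ u q = 0) ∧
    modPotential U V c y₀ u q₀ < 0 ∧
    ∀ q ∈ qDomain U V c y₀, h q = coneFun U V c y₀ Z q₀ (-modPotential U V c y₀ u q₀) q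

/-- The subdifferential at `x` of a function `f` on `S`: all `p` with
`f(x') ≥ f(x) + ⟨p, x' - x⟩ + o(|x' - x|)` as `x' → x` in `S`. -/
def subdiff {n : ℕ} (S : Set (E n)) (f : E n → ℝ) (x : E n) : Set (E n) :=
  {p | ∀ ε > 0, ∀ᶠ x' in 𝓝[S] x, f x + inner ℝ p (x' - x) - ε * ‖x' - x‖ ≤ f x'}

/-- The hyperplane `{q | ⟨ν, q⟩ = a}`. -/
def hyperplane {n : ℕ} (ν : E n) (a : ℝ) : Set (E n) := {q | inner ℝ ν q = a}

/-- The line through `b` in the direction `ν`. -/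
def lineThrough {n : ℕ} (b ν : E n) : Set (E n) := range (fun t : ℝ => b + t • ν)

/-- The maximal length of the intersections of `Z` with lines in the direction `ν`. -/
def maxChord {n : ℕ} (Z : Set (E n)) (ν : E n) : ℝ :=
  sSup (range (fun b : E n => Metric.diam (Z ∩ lineThrough b ν)))

end

end CCone

/-! In the coordinate q = -D_y c(x, y₀) the functions q ↦ -c̃(q, y) behave almost like affine
functions. Non-negative cross-curvature says that D²_yy c is concave along segments of x with
respect to y (`iteratedDeriv_hessY_nonpos`). The tangent line inequality for this concave function
becomes convexity of t ↦ -c(x', y(t)) + c(x, y(t)) along segments of y with respect to x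
(`convexOn_segment`). The tangent line inequality for the latter at y₀ is convexity of -c̃ in q
(`coneGrad_subgradient`). A mean value estimate along the same segments bounds the relative
oscillation of D_q c̃ by ε_c⁻¹ |q - q'| (`norm_coneGrad_sub_le`). `DoublyConvexFamily` records these
facts, and the rest is convex geometry.

Let ν be the outer unit normal of a hyperplane supporting Z, at distance d from the vertex. A
separation argument produces a function of the family that supports Z at the contact point with
gradient a multiple of ν (`exists_supportsAt_grad_eq`). It drops by at least the height h on the way
to the vertex, so the multiple is at least h/d. Sliding along the segment towards y₀ reduces it to
exactly h/d, which makes the function admissible for the cone. When diam Z is small, the Lipschitz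
bound carries the gradient to the vertex with small relative error (`exists_admissible`). Hence the
subdifferential at the vertex contains 0 and a point close to (h/d) ν.

Now take an orthonormal basis e₀ = ν, e₁, …, with d_i the distance from the vertex to the supporting
hyperplane with normal e_i. Convexity of the subdifferential bounds its volume below by a multiple
of ∏ h/d_i. If e₁, e₂, … are chosen greedily, Z contains points that are triangular in this basis
with diagonal entries at least d_i. Together with a chord of length ℓ in the direction ν they bound
the volume of Z below by a multiple of ℓ ∏_{i ≥ 1} d_i. In the product every d_i except d₀ cancels
(`exists_cone_volume_bound`), and using ν as well as -ν gives the minimum of the two distances. -/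

namespace CCone

/-! ### Partial derivatives on product sets and derivatives along curves. -/

section Calculus

variable {X Y W : Type*} [NormedAddCommGroup X] [NormedSpace ℝ X]
  [NormedAddCommGroup Y] [NormedSpace ℝ Y] [NormedAddCommGroup W] [NormedSpace ℝ W]

theorem hasFDerivWithinAt_partial_left {F : X × Y → W} {s : Set X} {t : Set Y}
    {F' : X × Y →L[ℝ] W} {x : X} {y : Y} (hy : y ∈ t)
    (h : HasFDerivWithinAt F F' (s ×ˢ t) (x, y)) :
    HasFDerivWithinAt (fun x' => F (x', y)) (F'.comp (ContinuousLinearMap.inl ℝ X Y)) s x := by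
  have h1 : HasFDerivWithinAt (fun x' : X => (x', y)) (ContinuousLinearMap.inl ℝ X Y) s x :=
    (hasFDerivAt_prodMk_left x y).hasFDerivWithinAt
  exact HasFDerivWithinAt.comp (g := F) x h h1 (fun x' hx' => ⟨hx', hy⟩)

theorem hasFDerivWithinAt_partial_right {F : X × Y → W} {s : Set X} {t : Set Y}
    {F' : X × Y →L[ℝ] W} {x : X} {y : Y} (hx : x ∈ s)
    (h : HasFDerivWithinAt F F' (s ×ˢ t) (x, y)) :
    HasFDerivWithinAt (fun y' => F (x, y')) (F'.comp (ContinuousLinearMap.inr ℝ X Y)) t y := by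
  have h1 : HasFDerivWithinAt (fun y' : Y => (x, y')) (ContinuousLinearMap.inr ℝ X Y) t y :=
    (hasFDerivAt_prodMk_right x y).hasFDerivWithinAt
  exact HasFDerivWithinAt.comp (g := F) y h h1 (fun x' hx' => ⟨hx, hx'⟩)

theorem contDiffOn_partial_left {F : X × Y → W} {s : Set X} {t : Set Y} {m k : WithTop ℕ∞}
    (hs : UniqueDiffOn ℝ s) (ht : UniqueDiffOn ℝ t) (hF : ContDiffOn ℝ k F (s ×ˢ t))
    (hmk : m + 1 ≤ k) :
    ContDiffOn ℝ m (fun p : X × Y => fderivWithin ℝ (fun x => F (x, p.2)) s p.1) (s ×ˢ t) := by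
  have h1 := hF.fderivWithin (hs.prod ht) hmk
  refine (h1.clm_comp (contDiffOn_const (c := ContinuousLinearMap.inl ℝ X Y))).congr ?_
  rintro ⟨x, y⟩ ⟨hx, hy⟩
  have h0 : (1 : WithTop ℕ∞) ≤ k := le_trans le_add_self hmk
  have hd := (hF.differentiableOn (by positivity) (x, y) ⟨hx, hy⟩).hasFDerivWithinAt
  exact (hasFDerivWithinAt_partial_left hy hd).fderivWithin (hs x hx)

theorem contDiffOn_partial_right {F : X × Y → W} {s : Set X} {t : Set Y} {m k : WithTop ℕ∞}
    (hs : UniqueDiffOn ℝ s) (ht : UniqueDiffOn ℝ t) (hF : ContDiffOn ℝ k F (s ×ˢ t))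
    (hmk : m + 1 ≤ k) :
    ContDiffOn ℝ m (fun p : X × Y => fderivWithin ℝ (fun y => F (p.1, y)) t p.2) (s ×ˢ t) := by
  have h1 := hF.fderivWithin (hs.prod ht) hmk
  refine (h1.clm_comp (contDiffOn_const (c := ContinuousLinearMap.inr ℝ X Y))).congr ?_
  rintro ⟨x, y⟩ ⟨hx, hy⟩
  have h0 : (1 : WithTop ℕ∞) ≤ k := le_trans le_add_self hmk
  have hd := (hF.differentiableOn (by positivity) (x, y) ⟨hx, hy⟩).hasFDerivWithinAt
  exact (hasFDerivWithinAt_partial_right hx hd).fderivWithin (ht y hy)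

/-- Symmetry of mixed partial derivatives. -/
theorem mixed_partial_symm {F : X × Y → W} {N : Set (X × Y)} {x : X} {y : Y}
    (hF : ContDiffAt ℝ 2 F (x, y)) (hN : N ∈ 𝓝 (x, y))
    {F₁ : X × Y → X →L[ℝ] W} {F₂ : X × Y → Y →L[ℝ] W}
    (h₁ : ∀ p ∈ N, HasFDerivAt (fun x' => F (x', p.2)) (F₁ p) p.1)
    (h₂ : ∀ p ∈ N, HasFDerivAt (fun y' => F (p.1, y')) (F₂ p) p.2)
    {F₁₂ : Y →L[ℝ] X →L[ℝ] W} {F₂₁ : X →L[ℝ] Y →L[ℝ] W}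
    (h₁₂ : HasFDerivAt (fun y' => F₁ (x, y')) F₁₂ y)
    (h₂₁ : HasFDerivAt (fun x' => F₂ (x', y)) F₂₁ x) (ξ : X) (η : Y) :
    F₁₂ η ξ = F₂₁ ξ η := by
  have hsymm := hF.isSymmSndFDerivAt (by simp)
  have hd : ∀ᶠ p in 𝓝 (x, y), DifferentiableAt ℝ F p :=
    (hF.eventually (by simp)).mono fun p hp => hp.differentiableAt (by simp)
  have hdd : DifferentiableAt ℝ (fderiv ℝ F) (x, y) :=
    (hF.fderiv_right (m := 1) (by norm_num)).differentiableAt (by simp)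
  -- Near the point the first partials are restrictions of DF, so both mixed partials become values
  -- of the symmetric form D²F on (ξ, 0) and (0, η).
  have e₁ : ∀ᶠ p in 𝓝 (x, y), F₁ p = (fderiv ℝ F p).comp (ContinuousLinearMap.inl ℝ X Y) := by
    filter_upwards [hd, hN] with p hp hpN
    exact (h₁ p hpN).unique (hp.hasFDerivAt.comp p.1 (hasFDerivAt_prodMk_left p.1 p.2))
  have e₂ : ∀ᶠ p in 𝓝 (x, y), F₂ p = (fderiv ℝ F p).comp (ContinuousLinearMap.inr ℝ X Y) := by
    filter_upwards [hd, hN] with p hp hpN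
    exact (h₂ p hpN).unique (hp.hasFDerivAt.comp p.2 (hasFDerivAt_prodMk_right p.1 p.2))
  have c₁ : Tendsto (fun y' : Y => (x, y')) (𝓝 y) (𝓝 (x, y)) :=
    (Continuous.prodMk_right x).tendsto y
  have c₂ : Tendsto (fun x' : X => (x', y)) (𝓝 x) (𝓝 (x, y)) :=
    (Continuous.prodMk_left y).tendsto x
  have d₁ : HasFDerivAt (fun y' => fderiv ℝ F (x, y') (ξ, 0))
      ((ContinuousLinearMap.apply ℝ W ((ξ, 0) : X × Y)).comp
        ((fderiv ℝ (fderiv ℝ F) (x, y)).comp (ContinuousLinearMap.inr ℝ X Y))) y :=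
    ((ContinuousLinearMap.apply ℝ W ((ξ, 0) : X × Y)).hasFDerivAt).comp y
      (hdd.hasFDerivAt.comp y (hasFDerivAt_prodMk_right x y))
  have d₂ : HasFDerivAt (fun x' => fderiv ℝ F (x', y) (0, η))
      ((ContinuousLinearMap.apply ℝ W ((0, η) : X × Y)).comp
        ((fderiv ℝ (fderiv ℝ F) (x, y)).comp (ContinuousLinearMap.inl ℝ X Y))) x :=
    ((ContinuousLinearMap.apply ℝ W ((0, η) : X × Y)).hasFDerivAt).comp x
      (hdd.hasFDerivAt.comp x (hasFDerivAt_prodMk_left x y))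
  have d₁' : HasFDerivAt (fun y' => F₁ (x, y') ξ)
      ((ContinuousLinearMap.apply ℝ W ξ).comp F₁₂) y :=
    ((ContinuousLinearMap.apply ℝ W ξ).hasFDerivAt).comp y h₁₂
  have d₂' : HasFDerivAt (fun x' => F₂ (x', y) η)
      ((ContinuousLinearMap.apply ℝ W η).comp F₂₁) x :=
    ((ContinuousLinearMap.apply ℝ W η).hasFDerivAt).comp x h₂₁
  have u₁ := d₁'.unique (d₁.congr_of_eventuallyEq ((c₁.eventually e₁).mono fun y' h => by
    simp [h]))
  have u₂ := d₂'.unique (d₂.congr_of_eventuallyEq ((c₂.eventually e₂).mono fun y' h => by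
    simp [h]))
  have v₁ := DFunLike.congr_fun u₁ η
  have v₂ := DFunLike.congr_fun u₂ ξ
  simp only [ContinuousLinearMap.comp_apply, ContinuousLinearMap.apply_apply,
    ContinuousLinearMap.inl_apply, ContinuousLinearMap.inr_apply] at v₁ v₂
  rw [v₁, v₂, hsymm.eq]

/-- A function on `[0, 1]` with non-negative second derivative is convex. -/
theorem convexOn_Icc_of_iteratedDeriv_two_nonneg {f : ℝ → ℝ}
    (hf : ∀ s ∈ Icc (0 : ℝ) 1, ContDiffAt ℝ 2 f s)
    (h2 : ∀ s ∈ Icc (0 : ℝ) 1, 0 ≤ iteratedDeriv 2 f s) : ConvexOn ℝ (Icc 0 1) f := by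
  refine convexOn_of_deriv2_nonneg (convex_Icc 0 1)
    (fun s hs => (hf s hs).continuousAt.continuousWithinAt) ?_ ?_ ?_
  · intro s hs
    exact ((hf s (interior_subset hs)).differentiableAt (by simp)).differentiableWithinAt
  · intro s hs
    have h3 : ContDiffAt ℝ 1 (deriv f) s :=
      (hf s (interior_subset hs)).derivWithin (by norm_num)
    exact (h3.differentiableAt (by simp)).differentiableWithinAt
  · intro s hs
    have := h2 s (interior_subset hs)
    rwa [iteratedDeriv_eq_iterate] at this

/-- The tangent line inequality on `[0, 1]`. -/
theorem add_deriv_le_of_convexOn {f : ℝ → ℝ} (hf : ConvexOn ℝ (Icc 0 1) f) {f' : ℝ}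
    (hd : HasDerivAt f f' 0) : f 0 + f' ≤ f 1 := by
  have := hf.le_slope_of_hasDerivAt (x := 0) (y := 1) (by simp) (by simp) (by norm_num) hd
  rw [slope_def_field] at this
  linarith [this]

/-- The first derivative of a function along a curve. -/
theorem hasDerivAt_comp_curve {n : ℕ} {f : E n → ℝ} {g : E n} {γ : ℝ → E n} {γ' : E n} {t : ℝ}
    (hf : HasGradientAt f g (γ t)) (hγ : HasDerivAt γ γ' t) :
    HasDerivAt (fun s => f (γ s)) (inner ℝ g γ') t := by
  have h := hf.hasFDerivAt.comp_hasDerivAt t hγ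
  rw [InnerProductSpace.toDual_apply_apply] at h
  exact h

/-- The second derivative of a function along a curve. -/
theorem hasDerivAt_deriv_comp_curve {n : ℕ} {f : E n → ℝ} {g : E n → E n}
    {B : E n →L[ℝ] E n} {γ : ℝ → E n} {t : ℝ}
    (hf : ∀ᶠ y in 𝓝 (γ t), HasGradientAt f (g y) y) (hg : HasFDerivAt g B (γ t))
    (hγ : ContDiffAt ℝ 2 γ t) :
    HasDerivAt (deriv fun s => f (γ s))
      (inner ℝ (B (deriv γ t)) (deriv γ t) + inner ℝ (g (γ t)) (deriv (deriv γ) t)) t := by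
  have h1 : ContDiffAt ℝ 1 (deriv γ) t := hγ.derivWithin (by norm_num)
  have h2 : HasDerivAt (deriv γ) (deriv (deriv γ) t) t :=
    (h1.differentiableAt (by simp)).hasDerivAt
  have h0 : HasDerivAt γ (deriv γ t) t := (hγ.differentiableAt (by simp)).hasDerivAt
  have h3 : HasDerivAt (fun s => inner ℝ (g (γ s)) (deriv γ s))
      (inner ℝ (g (γ t)) (deriv (deriv γ) t) + inner ℝ (B (deriv γ t)) (deriv γ t)) t :=
    (hg.comp_hasDerivAt t h0).inner ℝ h2
  rw [add_comm]
  refine h3.congr_of_eventuallyEq ?_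
  filter_upwards [h0.continuousAt.eventually hf, hγ.eventually (by simp)] with s hs hs'
  exact (hasDerivAt_comp_curve hs (hs'.differentiableAt (by simp)).hasDerivAt).deriv

theorem iteratedDeriv_two_comp_curve {n : ℕ} {f : E n → ℝ} {g : E n → E n}
    {B : E n →L[ℝ] E n} {γ : ℝ → E n} {t : ℝ}
    (hf : ∀ᶠ y in 𝓝 (γ t), HasGradientAt f (g y) y) (hg : HasFDerivAt g B (γ t))
    (hγ : ContDiffAt ℝ 2 γ t) :
    iteratedDeriv 2 (fun s => f (γ s)) t =
      inner ℝ (B (deriv γ t)) (deriv γ t) + inner ℝ (g (γ t)) (deriv (deriv γ) t) := by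
  rw [iteratedDeriv_succ, iteratedDeriv_one]
  exact (hasDerivAt_deriv_comp_curve hf hg hγ).deriv

end Calculus

/-! ### Diffeomorphisms of closures and one-sided differentiability. -/

section Diffeo

variable {n : ℕ} {f : E n → E n} {U : Set (E n)}

theorem IsDiffeoOnRange.image_closure (hf : IsDiffeoOnRange f (closure U))
    (hb : Bornology.IsBounded U) : f '' closure U = closure (f '' U) := by
  refine Subset.antisymm (hf.1.continuousOn.image_closure) ?_
  refine closure_minimal (image_mono subset_closure) ?_
  exact (hb.isCompact_closure.image_of_continuousOn hf.1.continuousOn).isClosed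

/-- In finite dimension a one-sided inverse is two-sided. -/
theorem isInvertible_of_comp_eq_id {A B : E n →L[ℝ] E n}
    (h : A.comp B = ContinuousLinearMap.id ℝ (E n)) : A.IsInvertible ∧ B.IsInvertible := by
  have h1 : (A : E n →ₗ[ℝ] E n) * (B : E n →ₗ[ℝ] E n) = 1 := by
    ext x : 1; exact DFunLike.congr_fun h x
  have h2 := mul_eq_one_comm.1 h1
  have h3 : ∀ x, A (B x) = x := fun x => DFunLike.congr_fun h x
  have h4 : ∀ x, B (A x) = x := fun x => DFunLike.congr_fun h2 x
  exact ⟨⟨ContinuousLinearEquiv.equivOfInverse A B h4 h3, rfl⟩,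
    ⟨ContinuousLinearEquiv.equivOfInverse B A h3 h4, rfl⟩⟩

/-- The chain rule for g ∘ f = id makes the derivative of f invertible at points of U, so f is open
there by the inverse function theorem. -/
theorem IsDiffeoOnRange.isOpen_image (hf : IsDiffeoOnRange f (closure U)) (hU : IsOpen U) :
    IsOpen (f '' U) := by
  obtain ⟨hf, g, hg, hgf⟩ := hf
  rw [isOpen_iff_mem_nhds]
  rintro _ ⟨x, hx, rfl⟩
  have hfx : ContDiffAt ℝ 3 f x :=
    (hf x (subset_closure hx)).contDiffAt (mem_of_superset (hU.mem_nhds hx) subset_closure)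
  have hst := hfx.hasStrictFDerivAt (by simp)
  have hgd := (hg.differentiableOn (by simp) (f x)
    (mem_image_of_mem f (subset_closure hx))).hasFDerivWithinAt
  have hc : HasFDerivWithinAt (g ∘ f) ((fderivWithin ℝ g (f '' closure U) (f x)).comp
      (fderiv ℝ f x)) U x :=
    hgd.comp x hst.hasFDerivAt.hasFDerivWithinAt
      (fun y hy => mem_image_of_mem f (subset_closure hy))
  have hid : HasFDerivWithinAt (g ∘ f) (ContinuousLinearMap.id ℝ (E n)) U x :=
    (hasFDerivWithinAt_id x U).congr (fun y hy => hgf (subset_closure hy))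
      (hgf (subset_closure hx))
  have heq := (hU.uniqueDiffWithinAt hx).eq hc hid
  obtain ⟨e, he⟩ := (isInvertible_of_comp_eq_id heq).2
  rw [← hst.map_nhds_eq_of_surj (by
    rw [LinearMap.range_eq_top, ← he]; exact e.surjective)]
  exact image_mem_map (hU.mem_nhds hx)

/-- No boundary regularity of U is assumed. The image of `closure U` is a convex set with nonempty
interior, hence has unique derivatives, and the inverse map transports this property back to
`closure U`. -/
theorem IsDiffeoOnRange.uniqueDiffOn_aux (hf : IsDiffeoOnRange f (closure U)) (hU : IsOpen U)
    (hb : Bornology.IsBounded U) (hconv : Convex ℝ (f '' U)) {x : E n} (hx : x ∈ closure U) :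
    UniqueDiffWithinAt ℝ (closure U) x ∧ (fderivWithin ℝ f (closure U) x).IsInvertible := by
  have hUne : U.Nonempty := by
    by_contra h
    rw [not_nonempty_iff_eq_empty] at h
    simp [h] at hx
  have hK : UniqueDiffOn ℝ (f '' closure U) := by
    rw [hf.image_closure hb]
    refine uniqueDiffOn_convex hconv.closure ?_
    exact (hUne.image f).mono (interior_maximal subset_closure (hf.isOpen_image hU))
  obtain ⟨hf, g, hg, hgf⟩ := hf
  have hfd := (hf.differentiableOn (by simp) x hx).hasFDerivWithinAt
  have hgd := (hg.differentiableOn (by simp) (f x) (mem_image_of_mem f hx)).hasFDerivWithinAt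
  have hgx : g (f x) = x := hgf hx
  have hc : HasFDerivWithinAt (f ∘ g) ((fderivWithin ℝ f (closure U) x).comp
      (fderivWithin ℝ g (f '' closure U) (f x))) (f '' closure U) (f x) := by
    refine HasFDerivWithinAt.comp (t := closure U) (f x) (by rw [hgx]; exact hfd) hgd ?_
    rintro _ ⟨y, hy, rfl⟩
    rw [hgf hy]; exact hy
  have hid : HasFDerivWithinAt (f ∘ g) (ContinuousLinearMap.id ℝ (E n)) (f '' closure U) (f x) := by
    refine (hasFDerivWithinAt_id (f x) _).congr ?_ (by simp [hgx])
    rintro _ ⟨y, hy, rfl⟩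
    simp [hgf hy]
  have heq := (hK (f x) (mem_image_of_mem f hx)).eq hc hid
  obtain ⟨h1, e, he⟩ := isInvertible_of_comp_eq_id heq
  refine ⟨?_, h1⟩
  have := hgd.uniqueDiffWithinAt (hK (f x) (mem_image_of_mem f hx))
    (by rw [← he]; exact e.surjective.denseRange)
  rwa [hgf.image_image, hgx] at this

end Diffeo

/-! ### Regularity of the derivatives of the cost up to the boundary. -/

section CostRegularity

/-- The derivative of `x ↦ D_y c(x, y)` on `closure U`, one-sided at the boundary. -/
noncomputable def mixedA {n : ℕ} (U V : Set (E n)) (c : E n → E n → ℝ) (x y : E n) :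
    E n →L[ℝ] E n :=
  fderivWithin ℝ (fun x' => gradY V c x' y) (closure U) x

/-- The Hessian `D²_{yy} c(x, y)`, one-sided at the boundary. -/
noncomputable def hessY {n : ℕ} (V : Set (E n)) (c : E n → E n → ℝ) (x y : E n) :
    E n →L[ℝ] E n :=
  fderivWithin ℝ (fun y' => gradY V c x y') (closure V) y

variable {n : ℕ} {U V : Set (E n)} {c : E n → E n → ℝ}

namespace IsCrossCurvedCost

theorem isCompact_left (H : IsCrossCurvedCost U V c) : IsCompact (closure U) :=
  H.bounded_left.isCompact_closure

theorem isCompact_right (H : IsCrossCurvedCost U V c) : IsCompact (closure V) :=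
  H.bounded_right.isCompact_closure

theorem uniqueDiffOn_left (H : IsCrossCurvedCost U V c) (hV : V.Nonempty) :
    UniqueDiffOn ℝ (closure U) := fun _ hx =>
  have hy := subset_closure hV.some_mem
  ((H.twist_left _ hy).uniqueDiffOn_aux H.isOpen_left H.bounded_left (H.convex_left _ hy) hx).1

theorem uniqueDiffOn_right (H : IsCrossCurvedCost U V c) (hU : U.Nonempty) :
    UniqueDiffOn ℝ (closure V) := fun _ hx =>
  have hy := subset_closure hU.some_mem
  ((H.twist_right _ hy).uniqueDiffOn_aux H.isOpen_right H.bounded_right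
    (H.convex_right _ hy) hx).1

theorem isInvertible_mixedA (H : IsCrossCurvedCost U V c) (hV : V.Nonempty) {x y : E n}
    (hx : x ∈ closure U) (hy : y ∈ closure V) : (mixedA U V c x y).IsInvertible := by
  obtain ⟨e, he⟩ := ((H.twist_left _ hy).uniqueDiffOn_aux H.isOpen_left H.bounded_left
    (H.convex_left _ hy) hx).2
  rw [fderivWithin_fun_neg (H.uniqueDiffOn_left hV x hx)] at he
  refine ⟨(ContinuousLinearEquiv.neg ℝ).trans e, ?_⟩
  ext1 v
  have := DFunLike.congr_fun he v
  simp only [ContinuousLinearEquiv.coe_coe, neg_apply] at this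
  simp [this, mixedA]

theorem contDiffOn_gradY (H : IsCrossCurvedCost U V c) (hU : U.Nonempty) (hV : V.Nonempty) :
    ContDiffOn ℝ 3 (fun p : E n × E n => gradY V c p.1 p.2) (closure U ×ˢ closure V) := by
  have h := contDiffOn_partial_right (m := 3) (H.uniqueDiffOn_left hV)
    (H.uniqueDiffOn_right hU) H.smooth (by norm_num)
  exact (InnerProductSpace.toDual ℝ (E n)).symm.contDiff.comp_contDiffOn h

theorem contDiffOn_gradX (H : IsCrossCurvedCost U V c) (hU : U.Nonempty) (hV : V.Nonempty) :
    ContDiffOn ℝ 3 (fun p : E n × E n => gradX U c p.1 p.2) (closure U ×ˢ closure V) := by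
  have h := contDiffOn_partial_left (m := 3) (H.uniqueDiffOn_left hV)
    (H.uniqueDiffOn_right hU) H.smooth (by norm_num)
  exact (InnerProductSpace.toDual ℝ (E n)).symm.contDiff.comp_contDiffOn h

theorem contDiffOn_mixedA (H : IsCrossCurvedCost U V c) (hU : U.Nonempty) (hV : V.Nonempty) :
    ContDiffOn ℝ 2 (fun p : E n × E n => mixedA U V c p.1 p.2) (closure U ×ˢ closure V) :=
  contDiffOn_partial_left (H.uniqueDiffOn_left hV)
    (H.uniqueDiffOn_right hU) (H.contDiffOn_gradY hU hV) (by norm_num)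

theorem contDiffOn_hessY (H : IsCrossCurvedCost U V c) (hU : U.Nonempty) (hV : V.Nonempty) :
    ContDiffOn ℝ 2 (fun p : E n × E n => hessY V c p.1 p.2) (closure U ×ˢ closure V) :=
  contDiffOn_partial_right (H.uniqueDiffOn_left hV)
    (H.uniqueDiffOn_right hU) (H.contDiffOn_gradY hU hV) (by norm_num)

theorem continuousOn_inverse_mixedA (H : IsCrossCurvedCost U V c) (hU : U.Nonempty)
    (hV : V.Nonempty) :
    ContinuousOn (fun p : E n × E n => (mixedA U V c p.1 p.2).inverse)
      (closure U ×ˢ closure V) := fun p hp =>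
  ContinuousAt.comp_continuousWithinAt (f := fun p : E n × E n => mixedA U V c p.1 p.2)
    ((H.isInvertible_mixedA hV hp.1 hp.2).contDiffAt_map_inverse (n := 0)).continuousAt
    ((H.contDiffOn_mixedA hU hV).continuousOn p hp)

theorem closure_left_mem_nhds (H : IsCrossCurvedCost U V c) {x : E n} (hx : x ∈ U) :
    closure U ∈ 𝓝 x := mem_of_superset (H.isOpen_left.mem_nhds hx) subset_closure

theorem closure_right_mem_nhds (H : IsCrossCurvedCost U V c) {y : E n} (hy : y ∈ V) :
    closure V ∈ 𝓝 y := mem_of_superset (H.isOpen_right.mem_nhds hy) subset_closure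

theorem prod_mem_nhds (H : IsCrossCurvedCost U V c) {x y : E n} (hx : x ∈ U) (hy : y ∈ V) :
    U ×ˢ V ∈ 𝓝 (x, y) := (H.isOpen_left.prod H.isOpen_right).mem_nhds ⟨hx, hy⟩

theorem closure_prod_mem_nhds (H : IsCrossCurvedCost U V c) {x y : E n} (hx : x ∈ U)
    (hy : y ∈ V) : closure U ×ˢ closure V ∈ 𝓝 (x, y) :=
  mem_of_superset (H.prod_mem_nhds hx hy) (prod_mono subset_closure subset_closure)

theorem hasGradientAt_right (H : IsCrossCurvedCost U V c) {x y : E n} (hx : x ∈ closure U)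
    (hy : y ∈ V) : HasGradientAt (c x) (gradY V c x y) y := by
  have h1 := (H.smooth.differentiableOn (by simp) (x, y)
    ⟨hx, subset_closure hy⟩).hasFDerivWithinAt
  have h2 := hasFDerivWithinAt_partial_right hx h1
  have h3 := h2.differentiableWithinAt.hasGradientWithinAt
  exact h3.hasFDerivWithinAt.hasFDerivAt (H.closure_right_mem_nhds hy)

theorem hasGradientAt_left (H : IsCrossCurvedCost U V c) {x y : E n} (hx : x ∈ U)
    (hy : y ∈ closure V) : HasGradientAt (fun x' => c x' y) (gradX U c x y) x := by
  have h1 := (H.smooth.differentiableOn (by simp) (x, y)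
    ⟨subset_closure hx, hy⟩).hasFDerivWithinAt
  have h2 := hasFDerivWithinAt_partial_left hy h1
  have h3 := h2.differentiableWithinAt.hasGradientWithinAt
  exact h3.hasFDerivWithinAt.hasFDerivAt (H.closure_left_mem_nhds hx)

theorem hasFDerivAt_gradY_left (H : IsCrossCurvedCost U V c) (hU : U.Nonempty)
    (hV : V.Nonempty) {x y : E n} (hx : x ∈ U) (hy : y ∈ closure V) :
    HasFDerivAt (fun x' => gradY V c x' y) (mixedA U V c x y) x := by
  have h1 := ((H.contDiffOn_gradY hU hV).differentiableOn (by simp) (x, y)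
    ⟨subset_closure hx, hy⟩).hasFDerivWithinAt
  have h2 := hasFDerivWithinAt_partial_left hy h1
  exact h2.differentiableWithinAt.hasFDerivWithinAt.hasFDerivAt (H.closure_left_mem_nhds hx)

theorem hasFDerivAt_gradY_right (H : IsCrossCurvedCost U V c) (hU : U.Nonempty)
    (hV : V.Nonempty) {x y : E n} (hx : x ∈ closure U) (hy : y ∈ V) :
    HasFDerivAt (fun y' => gradY V c x y') (hessY V c x y) y := by
  have h1 := ((H.contDiffOn_gradY hU hV).differentiableOn (by simp) (x, y)
    ⟨hx, subset_closure hy⟩).hasFDerivWithinAt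
  have h2 := hasFDerivWithinAt_partial_right hx h1
  exact h2.differentiableWithinAt.hasFDerivWithinAt.hasFDerivAt (H.closure_right_mem_nhds hy)

/-- Identifies the ambient derivative that enters `betaPlus` and `betaMinus` with the one-sided one,
which is continuous up to the boundary. -/
theorem mixedXY_eq (H : IsCrossCurvedCost U V c) (hU : U.Nonempty)
    (hV : V.Nonempty) {x y : E n} (hx : x ∈ U) (hy : y ∈ closure V) :
    mixedXY V c x y = mixedA U V c x y :=
  (H.hasFDerivAt_gradY_left hU hV hx hy).fderiv

/-- `D_y D_x c` is the adjoint of `D_x D_y c`. -/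
theorem hasFDerivAt_gradX_right (H : IsCrossCurvedCost U V c) (hU : U.Nonempty)
    (hV : V.Nonempty) {x y : E n} (hx : x ∈ U) (hy : y ∈ V) :
    HasFDerivAt (fun y' => gradX U c x y') (mixedA U V c x y).adjoint y := by
  have h1 := ((H.contDiffOn_gradX hU hV).differentiableOn (by simp) (x, y)
    ⟨subset_closure hx, subset_closure hy⟩).hasFDerivWithinAt
  have h2 := (hasFDerivWithinAt_partial_right (subset_closure hx) h1).hasFDerivAt
    (H.closure_right_mem_nhds hy)
  have hF : ContDiffAt ℝ 2 (fun p : E n × E n => c p.1 p.2) (x, y) :=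
    ((H.smooth (x, y) ⟨subset_closure hx, subset_closure hy⟩).contDiffAt
      (H.closure_prod_mem_nhds hx hy)).of_le (by norm_num)
  let L : E n ≃L[ℝ] (E n →L[ℝ] ℝ) := (InnerProductSpace.toDual ℝ (E n)).toContinuousLinearEquiv
  have key := fun ξ η => mixed_partial_symm hF (H.prod_mem_nhds hx hy)
    (F₁ := fun p => L (gradX U c p.1 p.2)) (F₂ := fun p => L (gradY V c p.1 p.2))
    (fun p hp => (H.hasGradientAt_left hp.1 (subset_closure hp.2)).hasFDerivAt)
    (fun p hp => (H.hasGradientAt_right (subset_closure hp.1) hp.2).hasFDerivAt)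
    (L.hasFDerivAt.comp y h2)
    (L.hasFDerivAt.comp x (H.hasFDerivAt_gradY_left hU hV hx (subset_closure hy))) ξ η
  refine (?_ : _ = (mixedA U V c x y).adjoint) ▸ h2
  ext1 η
  refine ext_inner_right ℝ fun ξ => ?_
  rw [ContinuousLinearMap.adjoint_inner_left, real_inner_comm (mixedA U V c x y ξ)]
  exact key ξ η

end IsCrossCurvedCost

end CostRegularity

/-! ### Finiteness of the constants and positivity of ε_c. -/

section Epsilon

/-- Each constant is a supremum over U × V of a function with a continuous extension to the compact
product of the closures. -/
theorem iSup_enorm_ne_top {n : ℕ} {W : Type*} [NormedAddCommGroup W] {U V : Set (E n)}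
    {F : E n × E n → W} (hK : IsCompact (closure U ×ˢ closure V))
    (hF : ContinuousOn F (closure U ×ˢ closure V)) {f : E n → E n → W}
    (hf : ∀ x ∈ U, ∀ y ∈ V, f x y = F (x, y)) : ⨆ x ∈ U, ⨆ y ∈ V, ‖f x y‖ₑ ≠ ⊤ := by
  obtain ⟨M, hM⟩ := hK.exists_bound_of_continuousOn hF
  refine ne_top_of_le_ne_top (ENNReal.ofReal_ne_top (r := M)) ?_
  refine iSup₂_le fun x hx => iSup₂_le fun y hy => ?_
  rw [hf x hx y hy, ← ofReal_norm]
  exact ENNReal.ofReal_le_ofReal (hM _ ⟨subset_closure hx, subset_closure hy⟩)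

theorem norm_le_toReal_iSup_enorm {n : ℕ} {W : Type*} [NormedAddCommGroup W] {U V : Set (E n)}
    {f : E n → E n → W} (hf : ⨆ x ∈ U, ⨆ y ∈ V, ‖f x y‖ₑ ≠ ⊤) {x y : E n} (hx : x ∈ U)
    (hy : y ∈ V) : ‖f x y‖ ≤ (⨆ x ∈ U, ⨆ y ∈ V, ‖f x y‖ₑ).toReal := by
  rw [← toReal_enorm]
  refine ENNReal.toReal_mono hf ?_
  exact le_trans (le_iSup₂ (f := fun y (_ : y ∈ V) => ‖f x y‖ₑ) y hy)
    (le_iSup₂ (f := fun x (_ : x ∈ U) => ⨆ y ∈ V, ‖f x y‖ₑ) x hx)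

theorem norm_bilin_le_toReal {F : Type*} [NormedAddCommGroup F] [NormedSpace ℝ F]
    (L : F →L[ℝ] F →L[ℝ] F) {r : ℝ≥0∞} (h : r ≠ ⊤) (h2 : ‖L‖ₑ ≤ r) : ‖L‖ ≤ r.toReal :=
  (toReal_enorm L).symm.le.trans (ENNReal.toReal_mono h h2)

variable {n : ℕ} {U V : Set (E n)} {c : E n → E n → ℝ}

namespace IsCrossCurvedCost

theorem betaPlus_ne_top (H : IsCrossCurvedCost U V c) (hU : U.Nonempty) (hV : V.Nonempty) :
    betaPlus U V c ≠ ⊤ :=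
  iSup_enorm_ne_top (H.isCompact_left.prod H.isCompact_right)
    (H.contDiffOn_mixedA hU hV).continuousOn
    fun _ hx _ hy => H.mixedXY_eq hU hV hx (subset_closure hy)

theorem betaMinus_ne_top (H : IsCrossCurvedCost U V c) (hU : U.Nonempty) (hV : V.Nonempty) :
    betaMinus U V c ≠ ⊤ :=
  iSup_enorm_ne_top (H.isCompact_left.prod H.isCompact_right)
    (H.continuousOn_inverse_mixedA hU hV)
    fun _ hx _ hy => by rw [H.mixedXY_eq hU hV hx (subset_closure hy)]

theorem hasFDerivAt_mixedA_left (H : IsCrossCurvedCost U V c) (hU : U.Nonempty)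
    (hV : V.Nonempty) {x y : E n} (hx : x ∈ U) (hy : y ∈ closure V) :
    HasFDerivAt (fun x' => mixedA U V c x' y) (mixedXXY V c x y) x := by
  have h1 := ((H.contDiffOn_mixedA hU hV).differentiableOn (by simp) (x, y)
    ⟨subset_closure hx, hy⟩).hasFDerivWithinAt
  have h2 := (hasFDerivWithinAt_partial_left hy h1).hasFDerivAt (H.closure_left_mem_nhds hx)
  have h3 : (fun x' => mixedXY V c x' y) =ᶠ[𝓝 x] fun x' => mixedA U V c x' y := by
    filter_upwards [H.isOpen_left.mem_nhds hx] with x' hx'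
    exact H.mixedXY_eq hU hV hx' hy
  rw [mixedXXY, h3.fderiv_eq]
  exact h2.differentiableAt.hasFDerivAt

theorem normXXY_ne_top (H : IsCrossCurvedCost U V c) (hU : U.Nonempty) (hV : V.Nonempty) :
    normXXY U V c ≠ ⊤ :=
  iSup_enorm_ne_top (H.isCompact_left.prod H.isCompact_right)
    (contDiffOn_partial_left (m := 1) (H.uniqueDiffOn_left hV)
      (H.uniqueDiffOn_right hU) (H.contDiffOn_mixedA hU hV) (by norm_num)).continuousOn
    fun x hx _ hy => by
      have := H.hasFDerivAt_mixedA_left hU hV hx (subset_closure hy)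
      exact (this.hasFDerivWithinAt.fderivWithin
        (H.uniqueDiffOn_left hV x (subset_closure hx))).symm

theorem norm_mixedA_le (H : IsCrossCurvedCost U V c) {x y : E n} (hx : x ∈ U) (hy : y ∈ V) :
    ‖mixedA U V c x y‖ ≤ (betaPlus U V c).toReal := by
  have := norm_le_toReal_iSup_enorm (H.betaPlus_ne_top ⟨x, hx⟩ ⟨y, hy⟩) hx hy
  rwa [H.mixedXY_eq ⟨x, hx⟩ ⟨y, hy⟩ hx (subset_closure hy)] at this

theorem norm_inverse_mixedA_le (H : IsCrossCurvedCost U V c) {x y : E n} (hx : x ∈ U)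
    (hy : y ∈ V) : ‖(mixedA U V c x y).inverse‖ ≤ (betaMinus U V c).toReal := by
  have := norm_le_toReal_iSup_enorm (H.betaMinus_ne_top ⟨x, hx⟩ ⟨y, hy⟩) hx hy
  rwa [H.mixedXY_eq ⟨x, hx⟩ ⟨y, hy⟩ hx (subset_closure hy)] at this

theorem norm_mixedXXY_le (H : IsCrossCurvedCost U V c) {x y : E n} (hx : x ∈ U) (hy : y ∈ V) :
    ‖mixedXXY V c x y‖ ≤ (normXXY U V c).toReal :=
  norm_bilin_le_toReal _ (H.normXXY_ne_top ⟨x, hx⟩ ⟨y, hy⟩)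
    (le_trans (le_iSup₂ (f := fun y (_ : y ∈ V) => ‖mixedXXY V c x y‖ₑ) y hy)
      (le_iSup₂ (f := fun x (_ : x ∈ U) => ⨆ y ∈ V, ‖mixedXXY V c x y‖ₑ) x hx))

theorem epsCost_inv_ne_top (H : IsCrossCurvedCost U V c) :
    2 * betaPlus U V c ^ 4 * betaMinus U V c ^ 6 * normXXY U V c ≠ ⊤ := by
  -- The regularity lemmas need both domains nonempty; for an empty one the suprema are 0.
  rcases U.eq_empty_or_nonempty with rfl | hU
  · simp [normXXY]
  rcases V.eq_empty_or_nonempty with rfl | hV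
  · simp [normXXY]
  exact ENNReal.mul_ne_top (ENNReal.mul_ne_top (ENNReal.mul_ne_top (by simp)
    (ENNReal.pow_ne_top (H.betaPlus_ne_top hU hV)))
    (ENNReal.pow_ne_top (H.betaMinus_ne_top hU hV))) (H.normXXY_ne_top hU hV)

theorem epsCost_pos (H : IsCrossCurvedCost U V c) : 0 < epsCost U V c :=
  ENNReal.inv_pos.2 H.epsCost_inv_ne_top

end IsCrossCurvedCost

end Epsilon

/-! ### Inverse charts x(q) and y(p). -/

section CrossCurvature

variable {n : ℕ} {U V : Set (E n)} {c : E n → E n → ℝ}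

namespace IsCrossCurvedCost

/-- The inverse of `x ↦ -D_y c(x, y)` is smooth along lines. -/
theorem exists_inverse_left (H : IsCrossCurvedCost U V c) {y : E n} (hy : y ∈ closure V) :
    ∃ X : E n → E n, (∀ x ∈ closure U, X (-gradY V c x y) = x) ∧
      ∀ q ∈ (fun x => -gradY V c x y) '' U, X q ∈ U ∧ gradY V c (X q) y = -q ∧
        ContDiffAt ℝ 3 X q := by
  have ho := (H.twist_left y hy).isOpen_image H.isOpen_left
  obtain ⟨-, g, hg, hgf⟩ := H.twist_left y hy
  refine ⟨g, hgf, ?_⟩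
  rintro _ ⟨x, hx, rfl⟩
  have hgx : g (-gradY V c x y) = x := hgf (subset_closure hx)
  refine ⟨by rwa [hgx], by simp [hgx], ?_⟩
  exact (hg _ ⟨x, subset_closure hx, rfl⟩).contDiffAt
    (mem_of_superset (ho.mem_nhds ⟨x, hx, rfl⟩) (image_mono subset_closure))

theorem exists_inverse_right (H : IsCrossCurvedCost U V c) {x : E n} (hx : x ∈ closure U) :
    ∃ Y : E n → E n, (∀ y ∈ closure V, Y (-gradX U c x y) = y) ∧
      ∀ p ∈ (fun y => -gradX U c x y) '' V, Y p ∈ V ∧ gradX U c x (Y p) = -p ∧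
        ContDiffAt ℝ 3 Y p := by
  have ho := (H.twist_right x hx).isOpen_image H.isOpen_right
  obtain ⟨-, g, hg, hgf⟩ := H.twist_right x hx
  refine ⟨g, hgf, ?_⟩
  rintro _ ⟨y, hy, rfl⟩
  have hgy : g (-gradX U c x y) = y := hgf (subset_closure hy)
  refine ⟨by rwa [hgy], by simp [hgy], ?_⟩
  exact (hg _ ⟨y, subset_closure hy, rfl⟩).contDiffAt
    (mem_of_superset (ho.mem_nhds ⟨y, hy, rfl⟩) (image_mono subset_closure))

end IsCrossCurvedCost

end CrossCurvature

/-- In the cross-curvature computation the affine part carries the acceleration of the y-curve,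
which thus drops out. -/
theorem iteratedDeriv_two_affine_comb {f : ℝ → ℝ} {s : ℝ} (hf : ContDiffAt ℝ 2 f s)
    (a b d : ℝ) :
    iteratedDeriv 2 (fun r => a * f r + (b + r * d)) s = a * iteratedDeriv 2 f s := by
  simp only [iteratedDeriv_succ, iteratedDeriv_zero]
  have h1 : deriv (fun r => a * f r + (b + r * d)) =ᶠ[𝓝 s] fun r => a * deriv f r + d := by
    filter_upwards [hf.eventually (by simp)] with r hr
    have h := (hr.differentiableAt (by simp)).hasDerivAt
    have h' : HasDerivAt (fun r : ℝ => b + r * d) (1 * d) r :=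
      ((hasDerivAt_id r).mul_const d).const_add b
    rw [← one_mul d]
    simpa using! ((h.const_mul a).add h').deriv
  have h2 : ContDiffAt ℝ 1 (deriv f) s := hf.derivWithin (by norm_num)
  have h3 := (h2.differentiableAt (by simp)).hasDerivAt
  rw [h1.deriv_eq]
  exact ((h3.const_mul a).add_const d).deriv

/-- Accounts for the rescaling that fits the curves into the parameter interval [-1, 1]. -/
theorem iteratedDeriv_two_comp_affine (f : ℝ → ℝ) (s δ : ℝ) :
    iteratedDeriv 2 (fun r => f (s + δ * r)) 0 = δ ^ 2 * iteratedDeriv 2 f s := by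
  have key : ∀ g : ℝ → ℝ, (deriv fun r => g (s + δ * r)) = fun r => δ * deriv g (s + δ * r) := by
    intro g
    ext r
    have := deriv_comp_mul_left δ (fun x => g (s + x)) r
    rw [smul_eq_mul, deriv_comp_const_add] at this
    exact this
  simp only [iteratedDeriv_succ, iteratedDeriv_zero]
  rw [key, deriv_const_mul_field, key]
  simp
  ring

/-- An open set contains a small segment around each of its points. -/
theorem exists_segment_subset {n : ℕ} {Q : Set (E n)} (hQ : IsOpen Q) {q : E n} (hq : q ∈ Q)
    (v : E n) : ∃ δ : ℝ, 0 < δ ∧ ∀ σ ∈ Icc (-1 : ℝ) 1, q + σ • δ • v ∈ Q := by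
  obtain ⟨r, hr, hrQ⟩ := Metric.isOpen_iff.1 hQ q hq
  refine ⟨r / (‖v‖ + 1), by positivity, fun σ hσ => hrQ ?_⟩
  have h1 : |σ| ≤ 1 := abs_le.2 hσ
  have h2 : r / (‖v‖ + 1) * ‖v‖ < r := by
    rw [div_mul_eq_mul_div, div_lt_iff₀ (by positivity)]
    nlinarith [norm_nonneg v]
  rw [Metric.mem_ball, dist_eq_norm, add_sub_cancel_left, norm_smul, norm_smul, Real.norm_eq_abs,
    Real.norm_eq_abs, abs_of_pos (by positivity : 0 < r / (‖v‖ + 1))]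
  have h3 : 0 ≤ r / (‖v‖ + 1) * ‖v‖ := by positivity
  nlinarith

/-! ### Concavity of D²_yy c along segments in x. -/

section CrossCurvature

variable {n : ℕ} {U V : Set (E n)} {c : E n → E n → ℝ}

namespace IsCrossCurvedCost

theorem contDiffAt_hessY_comp (H : IsCrossCurvedCost U V c) {y : E n} (hy : y ∈ V)
    {ξ : ℝ → E n} {s : ℝ} (hs : ξ s ∈ U) (hξ : ContDiffAt ℝ 3 ξ s) (η : E n) :
    ContDiffAt ℝ 2 (fun r => inner ℝ (hessY V c (ξ r) y η) η) s := by
  have h1 := ((H.contDiffOn_hessY ⟨_, hs⟩ ⟨y, hy⟩) (ξ s, y)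
    ⟨subset_closure hs, subset_closure hy⟩).contDiffAt (H.closure_prod_mem_nhds hs hy)
  have h2 : ContDiffAt ℝ 2 (fun r => (ξ r, y)) s :=
    (hξ.of_le (by norm_num)).prodMk contDiffAt_const
  have h3 : ContDiffAt ℝ 2 (fun r => hessY V c (ξ r) y) s :=
    ContDiffAt.comp (g := fun p : E n × E n => hessY V c p.1 p.2) s h1 h2
  exact (h3.clm_apply contDiffAt_const).inner ℝ contDiffAt_const

/-- The curve `s ↦ x(s)` with `-D_y c(x(s), y) = q + s v`. -/
theorem exists_curve_left (H : IsCrossCurvedCost U V c) {y : E n} (hy : y ∈ closure V)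
    (q v : E n) :
    ∃ ξ : ℝ → E n, (∀ s, ∀ x ∈ closure U, -gradY V c x y = q + s • v → ξ s = x) ∧
      ∀ s, q + s • v ∈ (fun x => -gradY V c x y) '' U → ξ s ∈ U ∧
        gradY V c (ξ s) y = -(q + s • v) ∧ ContDiffAt ℝ 3 ξ s ∧
        mixedA U V c (ξ s) y (deriv ξ s) = -v := by
  have ho := (H.twist_left y hy).isOpen_image H.isOpen_left
  obtain ⟨X, hX1, hX2⟩ := H.exists_inverse_left hy
  refine ⟨fun s => X (q + s • v), fun s x hx h => by simp only [← h, hX1 x hx], fun s hs => ?_⟩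
  obtain ⟨h1, h2, h3⟩ := hX2 _ hs
  have hc : ContDiffAt ℝ 3 (fun s : ℝ => X (q + s • v)) s :=
    ContDiffAt.comp (g := X) s h3
      (contDiffAt_const.add (contDiffAt_id.smul contDiffAt_const))
  refine ⟨h1, h2, hc, ?_⟩
  have hV : V.Nonempty := closure_nonempty_iff.1 ⟨y, hy⟩
  have hd := (H.hasFDerivAt_gradY_left ⟨_, h1⟩ hV h1 hy).comp_hasDerivAt s
    (hc.differentiableAt (by simp)).hasDerivAt
  have hd' : HasDerivAt ((fun x' => gradY V c x' y) ∘ fun s => X (q + s • v)) (-v) s := by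
    have : HasDerivAt (fun s : ℝ => -(q + s • v)) (-v) s := by
      have h := (((hasDerivAt_id s).smul_const v).const_add q).neg
      rw [one_smul] at h
      exact h
    refine this.congr_of_eventuallyEq ?_
    have hcont : ContinuousAt (fun s : ℝ => q + s • v) s := by fun_prop
    filter_upwards [hcont.eventually (ho.mem_nhds hs)] with r hr
    exact (hX2 _ hr).2.1
  exact hd.unique hd'

/-- The curve `t ↦ y(t)` with `-D_x c(x, y(t)) = p + t w`. -/
theorem exists_curve_right (H : IsCrossCurvedCost U V c) {x : E n} (hx : x ∈ U) (p w : E n) :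
    ∃ γ : ℝ → E n, (∀ t, ∀ y ∈ closure V, -gradX U c x y = p + t • w → γ t = y) ∧
      ∀ t, p + t • w ∈ (fun y => -gradX U c x y) '' V → γ t ∈ V ∧
        gradX U c x (γ t) = -(p + t • w) ∧ ContDiffAt ℝ 3 γ t ∧
        (mixedA U V c x (γ t)).adjoint (deriv γ t) = -w := by
  have ho := (H.twist_right x (subset_closure hx)).isOpen_image H.isOpen_right
  obtain ⟨Y, hY1, hY2⟩ := H.exists_inverse_right (subset_closure hx)
  refine ⟨fun s => Y (p + s • w), fun s x hx h => by simp only [← h, hY1 x hx], fun s hs => ?_⟩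
  obtain ⟨h1, h2, h3⟩ := hY2 _ hs
  have hc : ContDiffAt ℝ 3 (fun s : ℝ => Y (p + s • w)) s :=
    ContDiffAt.comp (g := Y) s h3
      (contDiffAt_const.add (contDiffAt_id.smul contDiffAt_const))
  refine ⟨h1, h2, hc, ?_⟩
  have hd := (H.hasFDerivAt_gradX_right ⟨_, hx⟩ ⟨_, h1⟩ hx h1).comp_hasDerivAt s
    (hc.differentiableAt (by simp)).hasDerivAt
  have hd' : HasDerivAt ((fun y' => gradX U c x y') ∘ fun s => Y (p + s • w)) (-w) s := by
    have : HasDerivAt (fun s : ℝ => -(p + s • w)) (-w) s := by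
      have h := (((hasDerivAt_id s).smul_const w).const_add p).neg
      rw [one_smul] at h
      exact h
    refine this.congr_of_eventuallyEq ?_
    have hcont : ContinuousAt (fun s : ℝ => p + s • w) s := by fun_prop
    filter_upwards [hcont.eventually (ho.mem_nhds hs)] with r hr
    exact (hY2 _ hr).2.1
  exact hd.unique hd'

theorem adjoint_mixedA_injective (H : IsCrossCurvedCost U V c) (hV : V.Nonempty) {x y : E n}
    (hx : x ∈ closure U) (hy : y ∈ closure V) :
    Function.Injective (mixedA U V c x y).adjoint := by
  obtain ⟨e, he⟩ := H.isInvertible_mixedA hV hx hy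
  intro a b hab
  refine ext_inner_right ℝ fun z => ?_
  have h1 : mixedA U V c x y (e.symm z) = z := by
    rw [← he]; exact e.apply_symm_apply z
  rw [← h1, ← ContinuousLinearMap.adjoint_inner_left, hab, ContinuousLinearMap.adjoint_inner_left]

/-- Non-negative cross-curvature: the Hessian `D²_{yy} c` is concave along the
segments `s ↦ x(s)` with respect to `y`. -/
theorem iteratedDeriv_hessY_nonpos (H : IsCrossCurvedCost U V c) {y : E n} (hy : y ∈ V)
    {q v : E n} {ξ : ℝ → E n}
    (hξ : ∀ s, q + s • v ∈ (fun x => -gradY V c x y) '' U → ξ s ∈ U ∧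
        gradY V c (ξ s) y = -(q + s • v) ∧ ContDiffAt ℝ 3 ξ s)
    {s₀ : ℝ} (hs₀ : q + s₀ • v ∈ (fun x => -gradY V c x y) '' U) (η : E n) :
    iteratedDeriv 2 (fun s => inner ℝ (hessY V c (ξ s) y η) η) s₀ ≤ 0 := by
  have hyc := subset_closure hy
  have hQ := (H.twist_left y hyc).isOpen_image H.isOpen_left
  obtain ⟨δ, hδ, hδQ⟩ := exists_segment_subset hQ hs₀ v
  obtain ⟨hx₀, hgx₀, -⟩ := hξ s₀ hs₀
  have hU : U.Nonempty := ⟨_, hx₀⟩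
  have hV : V.Nonempty := ⟨_, hy⟩
  have hxc := subset_closure hx₀
  have hP := (H.twist_right _ hxc).isOpen_image H.isOpen_right
  have hp : -gradX U c (ξ s₀) y ∈ (fun y => -gradX U c (ξ s₀) y) '' V := ⟨y, hy, rfl⟩
  -- The direction is chosen so that the curve γ leaves y with velocity κη; the factor κ keeps it
  -- inside V on [-1, 1].
  obtain ⟨κ, hκ, hκP⟩ := exists_segment_subset hP hp (-(mixedA U V c (ξ s₀) y).adjoint η)
  obtain ⟨γ, hγ1, hγ2⟩ := H.exists_curve_right hx₀ (-gradX U c (ξ s₀) y)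
    (κ • -(mixedA U V c (ξ s₀) y).adjoint η)
  have hγ0 : γ 0 = y := hγ1 0 y hyc (by simp)
  have hγd : deriv γ 0 = κ • η := by
    apply H.adjoint_mixedA_injective hV hxc hyc
    have := (hγ2 0 (by simpa using hp)).2.2.2
    rw [hγ0] at this
    rw [this]; simp
  have hγc : ContDiffAt ℝ 2 γ 0 := (hγ2 0 (by simpa using hp)).2.2.1.of_le (by norm_num)
  have hseg : ∀ σ : ℝ, q + (s₀ + δ * σ) • v = q + s₀ • v + σ • δ • v := by
    intro σ; module
  have hin : ∀ σ ∈ Icc (-1 : ℝ) 1, q + (s₀ + δ * σ) • v ∈ (fun x => -gradY V c x y) '' U :=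
    fun σ hσ => by rw [hseg]; exact hδQ σ hσ
  have hcross := H.cross (fun σ => ξ (s₀ + δ * σ)) γ
    (fun σ hσ => subset_closure (hξ _ (hin σ hσ)).1)
    (fun τ hτ => subset_closure (hγ2 τ (hκP τ hτ)).1)
    ⟨-(q + s₀ • v), -(δ • v), fun σ hσ => by
      simp only [hγ0]
      rw [(hξ _ (hin σ hσ)).2.1, hseg]; module⟩
    ⟨gradX U c (ξ s₀) y, -(κ • -(mixedA U V c (ξ s₀) y).adjoint η), fun τ hτ => by
      simp only [mul_zero, add_zero]
      rw [(hγ2 τ (hκP τ hτ)).2.1]; module⟩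
  -- The second derivative in τ is κ²⟨D²_yy c η, η⟩ + ⟨D_y c, γ''(0)⟩. By the choice of ξ, D_y c is
  -- affine in σ, so the last term does not contribute to the second derivative in σ.
  have hinner : (fun σ => iteratedDeriv 2 (fun τ => c (ξ (s₀ + δ * σ)) (γ τ)) 0) =ᶠ[𝓝 0]
      fun σ => κ ^ 2 * (fun r => inner ℝ (hessY V c (ξ (s₀ + δ * r)) y η) η) σ +
        (inner ℝ (-(q + s₀ • v)) (deriv (deriv γ) 0) +
          σ * inner ℝ (-(δ • v)) (deriv (deriv γ) 0)) := by
    filter_upwards [Icc_mem_nhds (show (-1 : ℝ) < 0 by norm_num) (zero_lt_one)] with σ hσ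
    obtain ⟨h1, h2, -⟩ := hξ _ (hin σ hσ)
    rw [iteratedDeriv_two_comp_curve (g := fun y' => gradY V c (ξ (s₀ + δ * σ)) y')
      (B := hessY V c (ξ (s₀ + δ * σ)) y) _ _ hγc, hγd, hγ0, h2, hseg]
    · simp only [map_smul, inner_smul_left, inner_smul_right, inner_neg_left, inner_add_left]
      simp
      ring
    · rw [hγ0]
      filter_upwards [H.isOpen_right.mem_nhds hy] with y' hy'
      exact H.hasGradientAt_right (subset_closure h1) hy'
    · rw [hγ0]
      exact H.hasFDerivAt_gradY_right hU hV (subset_closure h1) hy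
  have hβ : ContDiffAt ℝ 2 (fun r => inner ℝ (hessY V c (ξ (s₀ + δ * r)) y η) η) 0 := by
    refine H.contDiffAt_hessY_comp hy (ξ := fun r => ξ (s₀ + δ * r)) (by simpa using hx₀) ?_ η
    refine ContDiffAt.comp (g := ξ) (0 : ℝ) ?_ (by fun_prop)
    simpa using (hξ s₀ hs₀).2.2
  rw [Filter.EventuallyEq.iteratedDeriv_eq 2 hinner, iteratedDeriv_two_affine_comb hβ,
    iteratedDeriv_two_comp_affine (fun r => inner ℝ (hessY V c (ξ r) y η) η)] at hcross
  have hpos : 0 < κ ^ 2 * δ ^ 2 := by positivity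
  nlinarith

end IsCrossCurvedCost

end CrossCurvature

/-! ### From concavity of the Hessian to convexity along segments in y. -/

section DoubleConvexity

variable {n : ℕ} {U V : Set (E n)} {c : E n → E n → ℝ}

/-- The vector `-D_q c̃(q, y)` at `q = q(x)`. -/
noncomputable def coneGrad (U V : Set (E n)) (c : E n → E n → ℝ) (y₀ x y : E n) : E n :=
  (mixedA U V c x y₀).inverse.adjoint (gradX U c x y - gradX U c x y₀)

namespace IsCrossCurvedCost

theorem differentiableAt_mixedA_right (H : IsCrossCurvedCost U V c) {x y : E n} (hx : x ∈ U)
    (hy : y ∈ V) : DifferentiableAt ℝ (fun y' => mixedA U V c x y') y := by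
  have h := ((H.contDiffOn_mixedA ⟨x, hx⟩ ⟨y, hy⟩ (x, y)
    ⟨subset_closure hx, subset_closure hy⟩).contDiffAt
    (H.closure_prod_mem_nhds hx hy)).differentiableAt (by simp)
  exact DifferentiableAt.comp (g := fun p : E n × E n => mixedA U V c p.1 p.2) (f := fun y' => (x, y')) y h
    (hasFDerivAt_prodMk_right (𝕜 := ℝ) x y).differentiableAt

theorem differentiableAt_hessY_left (H : IsCrossCurvedCost U V c) {x y : E n} (hx : x ∈ U)
    (hy : y ∈ V) : DifferentiableAt ℝ (fun x' => hessY V c x' y) x := by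
  have h := ((H.contDiffOn_hessY ⟨x, hx⟩ ⟨y, hy⟩ (x, y)
    ⟨subset_closure hx, subset_closure hy⟩).contDiffAt
    (H.closure_prod_mem_nhds hx hy)).differentiableAt (by simp)
  exact DifferentiableAt.comp (g := fun p : E n × E n => hessY V c p.1 p.2) (f := fun x' => (x', y)) x h
    (hasFDerivAt_prodMk_left (𝕜 := ℝ) x y).differentiableAt

/-- Symmetry of the third derivatives `D³_{xyy} c`. -/
theorem fderiv_hessY_apply (H : IsCrossCurvedCost U V c) {x y : E n} (hx : x ∈ U) (hy : y ∈ V)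
    (a η : E n) :
    fderiv ℝ (fun y' => mixedA U V c x y') y η a = fderiv ℝ (fun x' => hessY V c x' y) x a η := by
  have hU : U.Nonempty := ⟨x, hx⟩
  have hV : V.Nonempty := ⟨y, hy⟩
  have hmem : (x, y) ∈ closure U ×ˢ closure V := ⟨subset_closure hx, subset_closure hy⟩
  have hn := H.closure_prod_mem_nhds hx hy
  exact mixed_partial_symm (F := fun p : E n × E n => gradY V c p.1 p.2)
    (((H.contDiffOn_gradY hU hV _ hmem).contDiffAt hn).of_le (by norm_num))
    (H.prod_mem_nhds hx hy)
    (F₁ := fun p => mixedA U V c p.1 p.2) (F₂ := fun p => hessY V c p.1 p.2)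
    (fun p hp => H.hasFDerivAt_gradY_left hU hV hp.1 (subset_closure hp.2))
    (fun p hp => H.hasFDerivAt_gradY_right hU hV (subset_closure hp.1) hp.2)
    (H.differentiableAt_mixedA_right hx hy).hasFDerivAt
    (H.differentiableAt_hessY_left hx hy).hasFDerivAt a η

theorem contDiffAt_cost_comp (H : IsCrossCurvedCost U V c) {x : E n} (hx : x ∈ U)
    {γ : ℝ → E n} {t : ℝ} (ht : γ t ∈ V) (hγ : ContDiffAt ℝ 3 γ t) :
    ContDiffAt ℝ 2 (fun r => c x (γ r)) t := by
  have h1 := (H.smooth (x, γ t) ⟨subset_closure hx, subset_closure ht⟩).contDiffAt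
    (H.closure_prod_mem_nhds hx ht)
  exact ContDiffAt.comp (g := fun p : E n × E n => c p.1 p.2) t (h1.of_le (by norm_num))
    (contDiffAt_const.prodMk (hγ.of_le (by norm_num)))

/-- Along a segment `t ↦ y(t)` with respect to `x`, the function
`t ↦ -c(x', y(t)) + c(x, y(t))` is convex. -/
theorem convexOn_segment (H : IsCrossCurvedCost U V c) {x x' : E n} (hx : x ∈ U) (hx' : x' ∈ U)
    {p w : E n} {γ : ℝ → E n}
    (hγ : ∀ t, p + t • w ∈ (fun y => -gradX U c x y) '' V → γ t ∈ V ∧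
        gradX U c x (γ t) = -(p + t • w) ∧ ContDiffAt ℝ 3 γ t ∧
        (mixedA U V c x (γ t)).adjoint (deriv γ t) = -w)
    (hp : ∀ t ∈ Icc (0 : ℝ) 1, p + t • w ∈ (fun y => -gradX U c x y) '' V) :
    ConvexOn ℝ (Icc 0 1) (fun t => -c x' (γ t) + c x (γ t)) := by
  refine convexOn_Icc_of_iteratedDeriv_two_nonneg (fun t ht => ?_) fun t ht => ?_
  · obtain ⟨h1, -, h2, -⟩ := hγ t (hp t ht)
    exact (H.contDiffAt_cost_comp hx' h1 h2).neg.add (H.contDiffAt_cost_comp hx h1 h2)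
  obtain ⟨hy, hgy, hγc, hγd⟩ := hγ t (hp t ht)
  have hU : U.Nonempty := ⟨x, hx⟩
  have hV : V.Nonempty := ⟨_, hy⟩
  have hxc := subset_closure hx
  have hxc' := subset_closure hx'
  have hyc := subset_closure hy
  set y := γ t with hydef
  set η := deriv γ t with hη
  set ζ := deriv (deriv γ) t with hζ
  have hform := iteratedDeriv_two_comp_curve (f := fun y => -c x' y + c x y)
    (g := fun y => -gradY V c x' y + gradY V c x y)
    (B := -hessY V c x' y + hessY V c x y) (γ := γ) (t := t)
    (by
      filter_upwards [H.isOpen_right.mem_nhds hy] with z hz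
      have h1 := (H.hasGradientAt_right hxc' hz).hasFDerivAt.neg.add
        (H.hasGradientAt_right hxc hz).hasFDerivAt
      rw [hasGradientAt_iff_hasFDerivAt, map_add, map_neg]
      exact h1)
    ((H.hasFDerivAt_gradY_right hU hV hxc' hy).neg.add (H.hasFDerivAt_gradY_right hU hV hxc hy))
    (hγc.of_le (by norm_num))
  rw [hform, ← hη, ← hζ, ← hydef]
  set v := -gradY V c x' y + gradY V c x y with hv
  obtain ⟨ξ, hξ1, hξ2⟩ := H.exists_curve_left hyc (-gradY V c x y) v
  have hξ0 : ξ 0 = x := hξ1 0 x hxc (by simp)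
  have hξ1 : ξ 1 = x' := hξ1 1 x' hxc' (by rw [hv]; module)
  have hin : ∀ s ∈ Icc (0 : ℝ) 1,
      -gradY V c x y + s • v ∈ (fun x => -gradY V c x y) '' U := by
    intro s hs
    have := H.convex_left y hyc ⟨x, hx, rfl⟩ ⟨x', hx', rfl⟩ (sub_nonneg.2 hs.2) hs.1 (by ring)
    convert this using 1
    rw [hv]; module
  have hβ : ∀ s ∈ Icc (0 : ℝ) 1,
      ContDiffAt ℝ 2 (fun r => inner ℝ (hessY V c (ξ r) y η) η) s := fun s hs =>
    H.contDiffAt_hessY_comp hy (hξ2 s (hin s hs)).1 (hξ2 s (hin s hs)).2.2.1 η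
  -- This function φ is convex by cross-curvature, φ(1) - φ(0) is the second derivative to be shown
  -- non-negative, and the linear term is tuned to give φ'(0) = 0.
  have hconv : ConvexOn ℝ (Icc 0 1)
      (fun s => -1 * inner ℝ (hessY V c (ξ s) y η) η + (0 + s * inner ℝ v ζ)) := by
    refine convexOn_Icc_of_iteratedDeriv_two_nonneg (fun s hs => ?_) fun s hs => ?_
    · exact (contDiffAt_const.mul (hβ s hs)).add
        (contDiffAt_const.add (contDiffAt_id.mul contDiffAt_const))
    · rw [iteratedDeriv_two_affine_comb (hβ s hs)]
      have := H.iteratedDeriv_hessY_nonpos hy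
        (fun s hs => ⟨(hξ2 s hs).1, (hξ2 s hs).2.1, (hξ2 s hs).2.2.1⟩) (hin s hs) η
      linarith
  have h0 := hin 0 (by simp)
  set a := deriv ξ 0 with ha
  have hAa : mixedA U V c x y a = -v := by
    have := (hξ2 0 h0).2.2.2
    rwa [hξ0] at this
  have dA := H.differentiableAt_mixedA_right hx hy
  have dB := H.differentiableAt_hessY_left hx hy
  -- differentiating `⟨A(x, γ) a, γ'⟩ = const`
  have hzero : inner ℝ (fderiv ℝ (fun y' => mixedA U V c x y') y η a) η = inner ℝ v ζ := by
    have e1 : HasDerivAt (fun r => mixedA U V c x (γ r) a)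
        (fderiv ℝ (fun y' => mixedA U V c x y') y η a) t :=
      ((ContinuousLinearMap.apply ℝ (E n) a).hasFDerivAt.comp y dA.hasFDerivAt).comp_hasDerivAt t
        (hγc.differentiableAt (by simp)).hasDerivAt
    have e2 : HasDerivAt (deriv γ) ζ t :=
      ((hγc.derivWithin (m := 2) (by norm_num)).differentiableAt (by simp)).hasDerivAt
    have e3 := e1.inner ℝ e2
    have e4 : HasDerivAt (fun r => inner ℝ (mixedA U V c x (γ r) a) (deriv γ r)) 0 t := by
      refine (hasDerivAt_const t (inner ℝ a (-w))).congr_of_eventuallyEq ?_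
      have ho := (H.twist_right x hxc).isOpen_image H.isOpen_right
      have hcont : ContinuousAt (fun s : ℝ => p + s • w) t := by fun_prop
      filter_upwards [hcont.eventually (ho.mem_nhds (hp t ht))] with r hr
      rw [← (hγ r hr).2.2.2, ContinuousLinearMap.adjoint_inner_right]
    have e5 := e3.unique e4
    rw [← hydef, ← hη, hAa, inner_neg_left] at e5
    linarith
  -- By symmetry of third derivatives, the derivative of the Hessian term along ξ is the quantity
  -- computed in `hzero`, so the two contributions cancel.
  have hder : HasDerivAt
      (fun s => -1 * inner ℝ (hessY V c (ξ s) y η) η + (0 + s * inner ℝ v ζ)) 0 0 := by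
    have e1 : HasDerivAt (fun r => hessY V c (ξ r) y η)
        (fderiv ℝ (fun x' => hessY V c x' y) x a η) 0 := by
      rw [← hξ0] at dB
      have := ((ContinuousLinearMap.apply ℝ (E n) η).hasFDerivAt.comp (ξ 0)
        dB.hasFDerivAt).comp_hasDerivAt 0
        ((hξ2 0 h0).2.2.1.differentiableAt (by simp)).hasDerivAt
      rw [hξ0] at this
      exact this
    have e2 := ((e1.inner ℝ (hasDerivAt_const (0 : ℝ) η)).const_mul (-1)).add
      (((hasDerivAt_id (0 : ℝ)).mul_const (inner ℝ v ζ)).const_add 0)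
    rw [← H.fderiv_hessY_apply hx hy, hzero] at e2
    refine e2.congr_deriv ?_
    rw [inner_zero_right]
    ring
  have := add_deriv_le_of_convexOn hconv hder
  rw [hξ0, hξ1] at this
  simp only [add_apply, neg_apply, inner_add_left, inner_neg_left] at this ⊢
  linarith

end IsCrossCurvedCost

end DoubleConvexity

/-! ### Convexity in q and the gradient Lipschitz bound at interior points. -/

section ConeGradient

variable {n : ℕ} {U V : Set (E n)} {c : E n → E n → ℝ}

theorem adjoint_comp_inverse_adjoint {A : E n →L[ℝ] E n} (hA : A.IsInvertible) (b : E n) :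
    A.adjoint (A.inverse.adjoint b) = b := by
  refine ext_inner_right ℝ fun z => ?_
  rw [ContinuousLinearMap.adjoint_inner_left, ContinuousLinearMap.adjoint_inner_left,
    hA.inverse_apply_self]

theorem inverse_adjoint_adjoint {A : E n →L[ℝ] E n} (hA : A.IsInvertible) (b : E n) :
    A.inverse.adjoint (A.adjoint b) = b := by
  refine ext_inner_right ℝ fun z => ?_
  rw [ContinuousLinearMap.adjoint_inner_left, ContinuousLinearMap.adjoint_inner_left,
    hA.self_apply_inverse]

theorem norm_adjoint_adjoint_sub_le (A A' I I' : E n →L[ℝ] E n) (η : E n) :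
    ‖I.adjoint (A.adjoint η) - I'.adjoint (A'.adjoint η)‖ ≤
      (‖I‖ * ‖A - A'‖ + ‖I - I'‖ * ‖A'‖) * ‖η‖ := by
  have hsplit : I.adjoint (A.adjoint η) - I'.adjoint (A'.adjoint η) =
      I.adjoint ((A - A').adjoint η) + (I - I').adjoint (A'.adjoint η) := by
    simp only [map_sub, sub_apply]
    abel
  have key : ∀ S T : E n →L[ℝ] E n, ‖S.adjoint (T.adjoint η)‖ ≤ ‖S‖ * ‖T‖ * ‖η‖ := by
    intro S T
    rw [mul_assoc, ← LinearIsometryEquiv.norm_map ContinuousLinearMap.adjoint S,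
      ← LinearIsometryEquiv.norm_map ContinuousLinearMap.adjoint T]
    exact (ContinuousLinearMap.le_opNorm _ _).trans
      (mul_le_mul_of_nonneg_left (ContinuousLinearMap.le_opNorm _ _) (norm_nonneg _))
  rw [hsplit, add_mul]
  exact (norm_add_le _ _).trans (add_le_add (key _ _) (key _ _))

namespace IsCrossCurvedCost

theorem segment_mem_right (H : IsCrossCurvedCost U V c) {x y y₀ : E n} (hx : x ∈ closure U)
    (hy : y ∈ V) (hy₀ : y₀ ∈ V) {t : ℝ} (ht : t ∈ Icc (0 : ℝ) 1) :
    -gradX U c x y₀ + t • (gradX U c x y₀ - gradX U c x y) ∈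
      (fun y => -gradX U c x y) '' V := by
  have := H.convex_right x hx ⟨y₀, hy₀, rfl⟩ ⟨y, hy, rfl⟩ (sub_nonneg.2 ht.2) ht.1 (by ring)
  convert this using 1
  module

/-- Convexity of `q ↦ -c̃(q, y)`, for interior points. -/
theorem coneGrad_subgradient_interior (H : IsCrossCurvedCost U V c) {x x' y y₀ : E n}
    (hx : x ∈ U) (hx' : x' ∈ U) (hy : y ∈ V) (hy₀ : y₀ ∈ V) :
    inner ℝ (coneGrad U V c y₀ x y) (gradY V c x y₀ - gradY V c x' y₀) ≤
      -c x' y + c x' y₀ + c x y - c x y₀ := by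
  have hV : V.Nonempty := ⟨_, hy⟩
  have hyc := subset_closure hy
  have hyc₀ := subset_closure hy₀
  have hxc := subset_closure hx
  have hxc' := subset_closure hx'
  obtain ⟨γ, hγ1, hγ2⟩ := H.exists_curve_right hx (-gradX U c x y₀)
    (gradX U c x y₀ - gradX U c x y)
  have hγ0 : γ 0 = y₀ := hγ1 0 y₀ hyc₀ (by simp)
  have hγ1 : γ 1 = y := hγ1 1 y hyc (by module)
  have hp := fun t ht => H.segment_mem_right (t := t) hxc hy hy₀ ht
  have hconv := H.convexOn_segment hx hx' hγ2 hp
  obtain ⟨-, -, hc, hd⟩ := hγ2 0 (hp 0 (by simp))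
  rw [hγ0] at hd
  -- The segment from y₀ to y leaves y₀ with velocity -D_q c̃(q, y), since the adjoint of D²_xy c(x,
  -- y₀) maps both vectors to D_x c(x, y) - D_x c(x, y₀).
  have hG : deriv γ 0 = coneGrad U V c y₀ x y := by
    apply H.adjoint_mixedA_injective hV hxc hyc₀
    rw [hd, coneGrad, adjoint_comp_inverse_adjoint (H.isInvertible_mixedA hV hxc hyc₀)]
    abel
  have hder := (hc.differentiableAt (by simp)).hasDerivAt
  have h1 := hasDerivAt_comp_curve (f := c x) (by
    rw [hγ0]; exact H.hasGradientAt_right hxc hy₀) hder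
  have h2 := hasDerivAt_comp_curve (f := c x') (by
    rw [hγ0]; exact H.hasGradientAt_right hxc' hy₀) hder
  -- Convexity in t at y₀ already is convexity in q: the vector paired with γ'(0) in the slope is
  -- D_y c(x, y₀) - D_y c(x', y₀) = q' - q.
  have h3 := add_deriv_le_of_convexOn hconv (h2.neg.add h1)
  rw [hγ0, hγ1, hG] at h3
  rw [inner_sub_right, real_inner_comm, real_inner_comm (gradY V c x' y₀)]
  linarith

/-- Mean value inequality along the segment from x' to x with respect to y₀, whose speed is at most
β⁻ times the distance in the coordinate q. -/
theorem norm_mixedA_sub_le (H : IsCrossCurvedCost U V c) {x x' y y₀ : E n}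
    (hx : x ∈ U) (hx' : x' ∈ U) (hy : y ∈ V) (hy₀ : y₀ ∈ V) :
    ‖mixedA U V c x y - mixedA U V c x' y‖ ≤ (normXXY U V c).toReal *
      ((betaMinus U V c).toReal * ‖gradY V c x y₀ - gradY V c x' y₀‖) := by
  have hU : U.Nonempty := ⟨_, hx⟩
  have hV : V.Nonempty := ⟨_, hy⟩
  have hyc₀ := subset_closure hy₀
  obtain ⟨ξ, hξ1, hξ2⟩ := H.exists_curve_left hyc₀ (-gradY V c x' y₀)
    (gradY V c x' y₀ - gradY V c x y₀)
  have hξ0 : ξ 0 = x' := hξ1 0 x' (subset_closure hx') (by simp)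
  have hξ1 : ξ 1 = x := hξ1 1 x (subset_closure hx) (by module)
  have hin : ∀ s ∈ Icc (0 : ℝ) 1, -gradY V c x' y₀ + s • (gradY V c x' y₀ - gradY V c x y₀) ∈
      (fun x => -gradY V c x y₀) '' U := by
    intro s hs
    have := H.convex_left y₀ hyc₀ ⟨x', hx', rfl⟩ ⟨x, hx, rfl⟩ (sub_nonneg.2 hs.2) hs.1 (by ring)
    convert this using 1
    module
  rw [← hξ0, ← hξ1]
  refine norm_image_sub_le_of_norm_deriv_le_segment_01'
    (f := fun s => mixedA U V c (ξ s) y)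
    (f' := fun s => mixedXXY V c (ξ s) y (deriv ξ s)) (fun s hs => ?_) fun s hs => ?_
  · obtain ⟨h1, -, h2, -⟩ := hξ2 s (hin s hs)
    exact ((H.hasFDerivAt_mixedA_left hU hV h1 (subset_closure hy)).comp_hasDerivAt s
      (h2.differentiableAt (by simp)).hasDerivAt).hasDerivWithinAt
  · obtain ⟨h1, -, -, h3⟩ := hξ2 s (hin s (Ico_subset_Icc_self hs))
    have h4 : deriv ξ s = (mixedA U V c (ξ s) y₀).inverse (gradY V c x y₀ - gradY V c x' y₀) := by
      rw [← neg_sub (gradY V c x' y₀), ← h3,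
        (H.isInvertible_mixedA hV (subset_closure h1) hyc₀).inverse_apply_self]
    refine (ContinuousLinearMap.le_opNorm _ _).trans ?_
    refine mul_le_mul (H.norm_mixedXXY_le h1 hy) ?_ (norm_nonneg _) ENNReal.toReal_nonneg
    rw [h4, hξ0, hξ1]
    refine (ContinuousLinearMap.le_opNorm _ _).trans ?_
    gcongr
    exact H.norm_inverse_mixedA_le h1 hy₀

theorem one_le_betaPlus_mul_betaMinus [Nontrivial (E n)] (H : IsCrossCurvedCost U V c)
    (hU : U.Nonempty) (hV : V.Nonempty) :
    1 ≤ (betaPlus U V c).toReal * (betaMinus U V c).toReal := by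
  obtain ⟨x, hx⟩ := hU
  obtain ⟨y, hy⟩ := hV
  have hA := H.isInvertible_mixedA ⟨y, hy⟩ (subset_closure hx) (subset_closure hy)
  have h1 : (mixedA U V c x y).comp (mixedA U V c x y).inverse =
      ContinuousLinearMap.id ℝ (E n) := by
    ext1 z; exact hA.self_apply_inverse z
  have h2 := ContinuousLinearMap.opNorm_comp_le (mixedA U V c x y) (mixedA U V c x y).inverse
  rw [h1, ContinuousLinearMap.norm_id] at h2
  exact h2.trans (mul_le_mul (H.norm_mixedA_le hx hy) (H.norm_inverse_mixedA_le hx hy)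
    (norm_nonneg _) ENNReal.toReal_nonneg)

/-- Uses A⁻¹ - A'⁻¹ = -A⁻¹ (A - A') A'⁻¹. -/
theorem norm_inverse_mixedA_sub_le (H : IsCrossCurvedCost U V c) {x x' y₀ : E n}
    (hx : x ∈ U) (hx' : x' ∈ U) (hy₀ : y₀ ∈ V) :
    ‖(mixedA U V c x y₀).inverse - (mixedA U V c x' y₀).inverse‖ ≤
      (betaMinus U V c).toReal * ((normXXY U V c).toReal *
      ((betaMinus U V c).toReal * ‖gradY V c x y₀ - gradY V c x' y₀‖)) *
      (betaMinus U V c).toReal := by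
  have hV : V.Nonempty := ⟨_, hy₀⟩
  have hyc₀ := subset_closure hy₀
  have hA := H.isInvertible_mixedA hV (subset_closure hx) hyc₀
  have hA' := H.isInvertible_mixedA hV (subset_closure hx') hyc₀
  have h1 : (mixedA U V c x y₀).inverse - (mixedA U V c x' y₀).inverse =
      -((mixedA U V c x y₀).inverse.comp
        (mixedA U V c x y₀ - mixedA U V c x' y₀)).comp (mixedA U V c x' y₀).inverse := by
    ext1 z
    simp [hA.inverse_apply_self, hA'.self_apply_inverse]
  rw [h1, norm_neg]
  refine (ContinuousLinearMap.opNorm_comp_le _ _).trans ?_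
  refine mul_le_mul ((ContinuousLinearMap.opNorm_comp_le _ _).trans ?_)
    (H.norm_inverse_mixedA_le hx' hy₀) (norm_nonneg _) (by positivity)
  exact mul_le_mul (H.norm_inverse_mixedA_le hx hy₀) (H.norm_mixedA_sub_le hx hx' hy₀ hy₀)
    (norm_nonneg _) ENNReal.toReal_nonneg

theorem norm_le_of_adjoint_eq (H : IsCrossCurvedCost U V c) {x y y₀ η G : E n}
    (hx : x ∈ U) (hy : y ∈ V) (hy₀ : y₀ ∈ V)
    (h : (mixedA U V c x y).adjoint η = (mixedA U V c x y₀).adjoint G) :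
    ‖η‖ ≤ (betaMinus U V c).toReal * ((betaPlus U V c).toReal * ‖G‖) := by
  have hAt := H.isInvertible_mixedA ⟨y, hy⟩ (subset_closure hx) (subset_closure hy)
  rw [← inverse_adjoint_adjoint hAt η, h]
  refine (ContinuousLinearMap.le_opNorm _ _).trans ?_
  refine mul_le_mul ?_ ((ContinuousLinearMap.le_opNorm _ _).trans ?_) (norm_nonneg _)
    ENNReal.toReal_nonneg
  · rw [LinearIsometryEquiv.norm_map]; exact H.norm_inverse_mixedA_le hx hy
  · rw [LinearIsometryEquiv.norm_map]
    exact mul_le_mul_of_nonneg_right (H.norm_mixedA_le hx hy₀) (norm_nonneg _)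

/-- Here P, M, N stand for β⁺, β⁻ and the norm of D³_xxy c. The estimates yield 2 P² M⁴ N; the
further factor (PM)² ≥ 1 only brings the constant to the form of ε_c⁻¹. -/
theorem lipschitz_constant_le {P M N d g : ℝ} (hP : 0 ≤ P) (hM : 0 ≤ M) (hN : 0 ≤ N)
    (hd : 0 ≤ d) (hg : 0 ≤ g) (h1 : 1 ≤ P * M) :
    (M * (N * (M * d)) + M * (N * (M * d)) * M * P) * (M * (P * g)) ≤
      2 * P ^ 4 * M ^ 6 * N * d * g := by
  calc (M * (N * (M * d)) + M * (N * (M * d)) * M * P) * (M * (P * g))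
      = M ^ 2 * N * d * (1 + P * M) * (M * (P * g)) := by ring
    _ ≤ M ^ 2 * N * d * (P * M + P * M) * (M * (P * g)) := by gcongr
    _ = 2 * P ^ 2 * M ^ 4 * N * d * g * (1 * 1) := by ring
    _ ≤ 2 * P ^ 2 * M ^ 4 * N * d * g * ((P * M) * (P * M)) := by gcongr
    _ = 2 * P ^ 4 * M ^ 6 * N * d * g := by ring

/-- Bounds the derivative in the mean value argument for the cone gradient: η is the velocity at y
of a segment with respect to x', and G its velocity at y₀. -/
theorem norm_adjoint_mixedA_sub_le (H : IsCrossCurvedCost U V c) [Nontrivial (E n)]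
    {x x' y y₀ η G : E n} (hx : x ∈ U) (hx' : x' ∈ U) (hy : y ∈ V) (hy₀ : y₀ ∈ V)
    (h : (mixedA U V c x' y).adjoint η = (mixedA U V c x' y₀).adjoint G) :
    ‖(mixedA U V c x y₀).inverse.adjoint ((mixedA U V c x y).adjoint η) -
      (mixedA U V c x' y₀).inverse.adjoint ((mixedA U V c x' y).adjoint η)‖ ≤
      (2 * betaPlus U V c ^ 4 * betaMinus U V c ^ 6 * normXXY U V c).toReal *
        ‖gradY V c x y₀ - gradY V c x' y₀‖ * ‖G‖ := by
  simp only [ENNReal.toReal_mul, ENNReal.toReal_pow, ENNReal.toReal_ofNat]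
  have hM0 : 0 ≤ (betaMinus U V c).toReal := ENNReal.toReal_nonneg
  have hN0 : 0 ≤ (normXXY U V c).toReal := ENNReal.toReal_nonneg
  have hP0 : 0 ≤ (betaPlus U V c).toReal := ENNReal.toReal_nonneg
  refine (norm_adjoint_adjoint_sub_le _ _ _ _ _).trans (le_trans ?_
    (lipschitz_constant_le hP0 hM0 hN0 (norm_nonneg _) (norm_nonneg _)
      (H.one_le_betaPlus_mul_betaMinus ⟨_, hx⟩ ⟨_, hy⟩)))
  exact mul_le_mul (add_le_add
    (mul_le_mul (H.norm_inverse_mixedA_le hx hy₀) (H.norm_mixedA_sub_le hx hx' hy hy₀)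
      (norm_nonneg _) hM0)
    (mul_le_mul (H.norm_inverse_mixedA_sub_le hx hx' hy₀) (H.norm_mixedA_le hx' hy)
      (norm_nonneg _) (by positivity)))
    (H.norm_le_of_adjoint_eq hx' hy hy₀ h) (norm_nonneg _) (by positivity)

/-- The Lipschitz estimate for the gradient of `c̃`, for interior points. -/
theorem norm_coneGrad_sub_le_interior (H : IsCrossCurvedCost U V c) {x x' y y₀ : E n}
    (hx : x ∈ U) (hx' : x' ∈ U) (hy : y ∈ V) (hy₀ : y₀ ∈ V) :
    ‖coneGrad U V c y₀ x y - coneGrad U V c y₀ x' y‖ ≤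
      (2 * betaPlus U V c ^ 4 * betaMinus U V c ^ 6 * normXXY U V c).toReal *
        ‖gradY V c x y₀ - gradY V c x' y₀‖ * ‖coneGrad U V c y₀ x' y‖ := by
  have hU : U.Nonempty := ⟨_, hx⟩
  have hV : V.Nonempty := ⟨_, hy⟩
  -- In dimension 0 the inequality β⁺β⁻ ≥ 1 fails, so this case is separate.
  rcases subsingleton_or_nontrivial (E n) with hs | hs
  · rw [Subsingleton.elim (coneGrad U V c y₀ x y - coneGrad U V c y₀ x' y) 0, norm_zero]
    positivity
  have hyc₀ := subset_closure hy₀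
  have hxc' := subset_closure hx'
  obtain ⟨γ, hγ1, hγ2⟩ := H.exists_curve_right hx' (-gradX U c x' y₀)
    (gradX U c x' y₀ - gradX U c x' y)
  have hγ0 : γ 0 = y₀ := hγ1 0 y₀ hyc₀ (by simp)
  have hγ1 : γ 1 = y := hγ1 1 y (subset_closure hy) (by module)
  have hp := fun t ht => H.segment_mem_right (t := t) hxc' hy hy₀ ht
  -- The difference of the two gradients vanishes at y₀, so a bound on its derivative along the
  -- segment from y₀ to y with respect to x' suffices.
  have key := norm_image_sub_le_of_norm_deriv_le_segment_01'
    (f := fun t => coneGrad U V c y₀ x (γ t) - coneGrad U V c y₀ x' (γ t))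
    (f' := fun t => (mixedA U V c x y₀).inverse.adjoint
        ((mixedA U V c x (γ t)).adjoint (deriv γ t)) -
      (mixedA U V c x' y₀).inverse.adjoint ((mixedA U V c x' (γ t)).adjoint (deriv γ t)))
    (C := (2 * betaPlus U V c ^ 4 * betaMinus U V c ^ 6 * normXXY U V c).toReal *
        ‖gradY V c x y₀ - gradY V c x' y₀‖ * ‖coneGrad U V c y₀ x' y‖) ?_ ?_
  · simp only [hγ0, hγ1] at key
    simpa [coneGrad] using key
  · intro t ht
    obtain ⟨h1, -, h2, -⟩ := hγ2 t (hp t ht)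
    have hγd := (h2.differentiableAt (by simp)).hasDerivAt
    refine HasDerivAt.hasDerivWithinAt (HasDerivAt.sub ?_ ?_)
    · exact (mixedA U V c x y₀).inverse.adjoint.hasFDerivAt.comp_hasDerivAt t
        (((H.hasFDerivAt_gradX_right hU hV hx h1).comp_hasDerivAt t hγd).sub_const _)
    · exact (mixedA U V c x' y₀).inverse.adjoint.hasFDerivAt.comp_hasDerivAt t
        (((H.hasFDerivAt_gradX_right hU hV hx' h1).comp_hasDerivAt t hγd).sub_const _)
  · intro t ht
    obtain ⟨h1, -, -, h3⟩ := hγ2 t (hp t (Ico_subset_Icc_self ht))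
    refine H.norm_adjoint_mixedA_sub_le hx hx' h1 hy₀ ?_
    rw [coneGrad, adjoint_comp_inverse_adjoint (H.isInvertible_mixedA hV hxc' hyc₀), h3]
    abel

end IsCrossCurvedCost

end ConeGradient

/-! ### Extension of the estimates to the closures of U and V. -/

section Closure

variable {n : ℕ} {U V : Set (E n)} {c : E n → E n → ℝ}

namespace IsCrossCurvedCost

variable {T : Type*} [TopologicalSpace T] {s : Set T} {f g h : T → E n}

theorem continuousOn_cost_comp (H : IsCrossCurvedCost U V c) (hf : ContinuousOn f s)
    (hg : ContinuousOn g s) (hfU : MapsTo f s (closure U)) (hgV : MapsTo g s (closure V)) :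
    ContinuousOn (fun p => c (f p) (g p)) s :=
  H.smooth.continuousOn.comp (hf.prodMk hg) fun _ hp => ⟨hfU hp, hgV hp⟩

theorem continuousOn_gradX_comp (H : IsCrossCurvedCost U V c) (hU : U.Nonempty)
    (hV : V.Nonempty) (hf : ContinuousOn f s) (hg : ContinuousOn g s)
    (hfU : MapsTo f s (closure U)) (hgV : MapsTo g s (closure V)) :
    ContinuousOn (fun p => gradX U c (f p) (g p)) s :=
  (H.contDiffOn_gradX hU hV).continuousOn.comp (hf.prodMk hg) fun _ hp => ⟨hfU hp, hgV hp⟩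

theorem continuousOn_gradY_comp (H : IsCrossCurvedCost U V c) (hU : U.Nonempty)
    (hV : V.Nonempty) (hf : ContinuousOn f s) (hg : ContinuousOn g s)
    (hfU : MapsTo f s (closure U)) (hgV : MapsTo g s (closure V)) :
    ContinuousOn (fun p => gradY V c (f p) (g p)) s :=
  (H.contDiffOn_gradY hU hV).continuousOn.comp (hf.prodMk hg) fun _ hp => ⟨hfU hp, hgV hp⟩

theorem continuousOn_coneGrad_comp (H : IsCrossCurvedCost U V c) (hU : U.Nonempty)
    (hV : V.Nonempty) (hh : ContinuousOn h s) (hf : ContinuousOn f s) (hg : ContinuousOn g s)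
    (hhV : MapsTo h s (closure V)) (hfU : MapsTo f s (closure U))
    (hgV : MapsTo g s (closure V)) :
    ContinuousOn (fun p => coneGrad U V c (h p) (f p) (g p)) s := by
  have h1 : ContinuousOn (fun p => (mixedA U V c (f p) (h p)).inverse) s :=
    (H.continuousOn_inverse_mixedA hU hV).comp (hf.prodMk hh) fun _ hp => ⟨hfU hp, hhV hp⟩
  have h2 : ContinuousOn (fun p => (mixedA U V c (f p) (h p)).inverse.adjoint) s :=
    ContinuousLinearMap.adjoint.continuous.comp_continuousOn h1
  exact h2.clm_apply ((H.continuousOn_gradX_comp hU hV hf hg hfU hgV).sub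
    (H.continuousOn_gradX_comp hU hV hf hh hfU hhV))

/-- This and the three lemmas that follow write the relations to be extended as continuous
functions, so that they pass to limits. -/
theorem continuousOn_subgradient_gap (H : IsCrossCurvedCost U V c) (hU : U.Nonempty)
    (hV : V.Nonempty) {f' : T → E n} (hf : ContinuousOn f s) (hf' : ContinuousOn f' s)
    (hg : ContinuousOn g s) (hh : ContinuousOn h s) (hfU : MapsTo f s (closure U))
    (hfU' : MapsTo f' s (closure U)) (hgV : MapsTo g s (closure V))
    (hhV : MapsTo h s (closure V)) :
    ContinuousOn (fun p => -c (f' p) (g p) + c (f' p) (h p) + c (f p) (g p) - c (f p) (h p) -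
      inner ℝ (coneGrad U V c (h p) (f p) (g p))
        (gradY V c (f p) (h p) - gradY V c (f' p) (h p))) s := by
  have h1 := H.continuousOn_coneGrad_comp hU hV hh hf hg hhV hfU hgV
  have h2 := H.continuousOn_gradY_comp hU hV hf hh hfU hhV
  have h3 := H.continuousOn_gradY_comp hU hV hf' hh hfU' hhV
  have c1 := H.continuousOn_cost_comp hf' hg hfU' hgV
  have c2 := H.continuousOn_cost_comp hf' hh hfU' hhV
  have c3 := H.continuousOn_cost_comp hf hg hfU hgV
  have c4 := H.continuousOn_cost_comp hf hh hfU hhV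
  exact (((c1.neg.add c2).add c3).sub c4).sub (h1.inner (h2.sub h3))

theorem continuousOn_lipschitz_gap (H : IsCrossCurvedCost U V c) (hU : U.Nonempty)
    (hV : V.Nonempty) {f' : T → E n} (hf : ContinuousOn f s) (hf' : ContinuousOn f' s)
    (hg : ContinuousOn g s) (hh : ContinuousOn h s) (hfU : MapsTo f s (closure U))
    (hfU' : MapsTo f' s (closure U)) (hgV : MapsTo g s (closure V))
    (hhV : MapsTo h s (closure V)) (K : ℝ) :
    ContinuousOn (fun p => K * ‖gradY V c (f p) (h p) - gradY V c (f' p) (h p)‖ *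
      ‖coneGrad U V c (h p) (f' p) (g p)‖ -
      ‖coneGrad U V c (h p) (f p) (g p) - coneGrad U V c (h p) (f' p) (g p)‖) s := by
  have h1 := H.continuousOn_coneGrad_comp hU hV hh hf hg hhV hfU hgV
  have h1' := H.continuousOn_coneGrad_comp hU hV hh hf' hg hhV hfU' hgV
  have h2 := H.continuousOn_gradY_comp hU hV hf hh hfU hhV
  have h3 := H.continuousOn_gradY_comp hU hV hf' hh hfU' hhV
  fun_prop

theorem continuousOn_segment_gap (H : IsCrossCurvedCost U V c) {k : T → E n}
    (hf : ContinuousOn f s) (hg : ContinuousOn g s) (hh : ContinuousOn h s)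
    (hk : ContinuousOn k s) (hfU : MapsTo f s (closure U)) (hgV : MapsTo g s (closure V))
    (hhV : MapsTo h s (closure V)) (hkV : MapsTo k s (closure V)) (t : ℝ) {x' : E n}
    (hx' : x' ∈ closure U) :
    ContinuousOn (fun p => (1 - t) * (-c x' (h p) + c (f p) (h p)) +
      t * (-c x' (k p) + c (f p) (k p)) - (-c x' (g p) + c (f p) (g p))) s := by
  have m0 : MapsTo (fun _ : T => x') s (closure U) := fun _ _ => hx'
  have c1 := H.continuousOn_cost_comp hf hg hfU hgV
  have c2 := H.continuousOn_cost_comp hf hh hfU hhV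
  have c3 := H.continuousOn_cost_comp hf hk hfU hkV
  have c4 := H.continuousOn_cost_comp continuousOn_const hg m0 hgV
  have c5 := H.continuousOn_cost_comp continuousOn_const hh m0 hhV
  have c6 := H.continuousOn_cost_comp continuousOn_const hk m0 hkV
  exact (((c5.neg.add c2).const_mul (1 - t)).add ((c6.neg.add c3).const_mul t)).sub
    (c4.neg.add c1)

theorem continuousOn_gradX_gap (H : IsCrossCurvedCost U V c) (hU : U.Nonempty)
    (hV : V.Nonempty) {k : T → E n}
    (hf : ContinuousOn f s) (hg : ContinuousOn g s) (hh : ContinuousOn h s)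
    (hk : ContinuousOn k s) (hfU : MapsTo f s (closure U)) (hgV : MapsTo g s (closure V))
    (hhV : MapsTo h s (closure V)) (hkV : MapsTo k s (closure V)) (t : ℝ) :
    ContinuousOn (fun p => ‖gradX U c (f p) (g p) - ((1 - t) • gradX U c (f p) (h p) +
      t • gradX U c (f p) (k p))‖) s := by
  have c1 := H.continuousOn_gradX_comp hU hV hf hg hfU hgV
  have c2 := H.continuousOn_gradX_comp hU hV hf hh hfU hhV
  have c3 := H.continuousOn_gradX_comp hU hV hf hk hfU hkV
  fun_prop

end IsCrossCurvedCost

/-- Quadruples of points with two coordinates in each of two given sets. -/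
def quadruples (A B : Set (E n)) : Set ((E n × E n) × (E n × E n)) := (A ×ˢ A) ×ˢ (B ×ˢ B)

theorem closure_quadruples (A B : Set (E n)) :
    closure (quadruples A B) = quadruples (closure A) (closure B) := by
  simp only [quadruples, closure_prod_eq]

theorem nonneg_on_closure_quadruples {F : (E n × E n) × (E n × E n) → ℝ}
    (hF : ContinuousOn F (quadruples (closure U) (closure V)))
    (hpos : ∀ p ∈ quadruples U V, 0 ≤ F p) {p : (E n × E n) × (E n × E n)}
    (hp : p ∈ quadruples (closure U) (closure V)) : 0 ≤ F p := by
  rw [← closure_quadruples] at hF hp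
  exact le_on_closure hpos continuousOn_const hF hp

namespace IsCrossCurvedCost

/-- Convexity of `q ↦ -c̃(q, y)`, as a subgradient inequality. -/
theorem coneGrad_subgradient (H : IsCrossCurvedCost U V c) {x x' y y₀ : E n}
    (hx : x ∈ closure U) (hx' : x' ∈ closure U) (hy : y ∈ closure V) (hy₀ : y₀ ∈ closure V) :
    inner ℝ (coneGrad U V c y₀ x y) (gradY V c x y₀ - gradY V c x' y₀) ≤
      -c x' y + c x' y₀ + c x y - c x y₀ := by
  have hU : U.Nonempty := closure_nonempty_iff.1 ⟨x, hx⟩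
  have hV : V.Nonempty := closure_nonempty_iff.1 ⟨y, hy⟩
  have := nonneg_on_closure_quadruples
    (H.continuousOn_subgradient_gap hU hV continuousOn_fst.fst continuousOn_fst.snd
      continuousOn_snd.fst continuousOn_snd.snd (fun p hp => hp.1.1) (fun p hp => hp.1.2)
      (fun p hp => hp.2.1) (fun p hp => hp.2.2))
    (fun p hp => sub_nonneg.2 (H.coneGrad_subgradient_interior hp.1.1 hp.1.2 hp.2.1 hp.2.2))
    (p := ((x, x'), (y, y₀))) ⟨⟨hx, hx'⟩, hy, hy₀⟩
  exact sub_nonneg.1 this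

/-- The Lipschitz estimate for the gradient of `c̃`. -/
theorem norm_coneGrad_sub_le (H : IsCrossCurvedCost U V c) {x x' y y₀ : E n}
    (hx : x ∈ closure U) (hx' : x' ∈ closure U) (hy : y ∈ closure V) (hy₀ : y₀ ∈ closure V) :
    ‖coneGrad U V c y₀ x y - coneGrad U V c y₀ x' y‖ ≤
      (2 * betaPlus U V c ^ 4 * betaMinus U V c ^ 6 * normXXY U V c).toReal *
        ‖gradY V c x y₀ - gradY V c x' y₀‖ * ‖coneGrad U V c y₀ x' y‖ := by
  have hU : U.Nonempty := closure_nonempty_iff.1 ⟨x, hx⟩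
  have hV : V.Nonempty := closure_nonempty_iff.1 ⟨y, hy⟩
  have := nonneg_on_closure_quadruples
    (H.continuousOn_lipschitz_gap hU hV continuousOn_fst.fst continuousOn_fst.snd
      continuousOn_snd.fst continuousOn_snd.snd (fun p hp => hp.1.1) (fun p hp => hp.1.2)
      (fun p hp => hp.2.1) (fun p hp => hp.2.2) _)
    (fun p hp => sub_nonneg.2 (H.norm_coneGrad_sub_le_interior hp.1.1 hp.1.2 hp.2.1 hp.2.2))
    (p := ((x, x'), (y, y₀))) ⟨⟨hx, hx'⟩, hy, hy₀⟩
  exact sub_nonneg.1 this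

/-- Convexity along segments with respect to `x`. -/
theorem exists_segment_point_interior (H : IsCrossCurvedCost U V c) {x y₁ y₂ : E n}
    (hx : x ∈ U) (hy₁ : y₁ ∈ V) (hy₂ : y₂ ∈ V) {t : ℝ} (ht : t ∈ Icc (0 : ℝ) 1) :
    ∃ y ∈ closure V, gradX U c x y = (1 - t) • gradX U c x y₁ + t • gradX U c x y₂ ∧
      ∀ x' ∈ closure U, -c x' y + c x y ≤
        (1 - t) * (-c x' y₁ + c x y₁) + t * (-c x' y₂ + c x y₂) := by
  have hxc := subset_closure hx
  obtain ⟨γ, hγ1, hγ2⟩ := H.exists_curve_right hx (-gradX U c x y₁)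
    (gradX U c x y₁ - gradX U c x y₂)
  have hγ0 : γ 0 = y₁ := hγ1 0 y₁ (subset_closure hy₁) (by simp)
  have hγ1 : γ 1 = y₂ := hγ1 1 y₂ (subset_closure hy₂) (by module)
  have hp := fun t ht => H.segment_mem_right (t := t) hxc hy₂ hy₁ ht
  obtain ⟨h1, h2, -⟩ := hγ2 t (hp t ht)
  refine ⟨γ t, subset_closure h1, by rw [h2]; module, fun x' hx' => ?_⟩
  have hcont : ∀ z ∈ closure V, ContinuousOn (fun x' => c x' z) (closure U) := fun z hz =>
    H.continuousOn_cost_comp continuousOn_id continuousOn_const (fun _ h => h) (fun _ _ => hz)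
  refine le_on_closure (s := U) (f := fun x' => -c x' (γ t) + c x (γ t))
    (g := fun x' => (1 - t) * (-c x' y₁ + c x y₁) + t * (-c x' y₂ + c x y₂))
    (fun x' hx' => ?_) ?_ ?_ hx'
  · have hconv := (H.convexOn_segment hx hx' hγ2 hp).2 (x := 0) (y := 1) (by simp) (by simp)
      (sub_nonneg.2 ht.2) ht.1 (by ring)
    simpa [hγ0, hγ1] using hconv
  · exact (hcont _ (subset_closure h1)).neg.add continuousOn_const
  · exact (continuousOn_const.mul ((hcont _ (subset_closure hy₁)).neg.add continuousOn_const)).add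
      (continuousOn_const.mul ((hcont _ (subset_closure hy₂)).neg.add continuousOn_const))

/-- An existence statement passes to the closure by compactness: the set of all (x, y, y₁, y₂) with
the required property is compact, so its projection to (x, y₁, y₂) is closed, and it contains U × V
× V. -/
theorem exists_segment_point (H : IsCrossCurvedCost U V c) {x y₁ y₂ : E n}
    (hx : x ∈ closure U) (hy₁ : y₁ ∈ closure V) (hy₂ : y₂ ∈ closure V) {t : ℝ}
    (ht : t ∈ Icc (0 : ℝ) 1) :
    ∃ y ∈ closure V, gradX U c x y = (1 - t) • gradX U c x y₁ + t • gradX U c x y₂ ∧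
      ∀ x' ∈ closure U, -c x' y + c x y ≤
        (1 - t) * (-c x' y₁ + c x y₁) + t * (-c x' y₂ + c x y₂) := by
  have hU : U.Nonempty := closure_nonempty_iff.1 ⟨x, hx⟩
  have hV : V.Nonempty := closure_nonempty_iff.1 ⟨y₁, hy₁⟩
  set K : Set ((E n × E n) × (E n × E n)) :=
    (closure U ×ˢ closure V) ×ˢ (closure V ×ˢ closure V) with hK
  have hKc : IsCompact K :=
    (H.isCompact_left.prod H.isCompact_right).prod (H.isCompact_right.prod H.isCompact_right)
  have hc1 : IsClosed {p ∈ K | ‖gradX U c p.1.1 p.1.2 - ((1 - t) • gradX U c p.1.1 p.2.1 +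
      t • gradX U c p.1.1 p.2.2)‖ ≤ 0} :=
    hKc.isClosed.isClosed_le (H.continuousOn_gradX_gap hU hV continuousOn_fst.fst
      continuousOn_fst.snd continuousOn_snd.fst continuousOn_snd.snd (fun p hp => hp.1.1)
      (fun p hp => hp.1.2) (fun p hp => hp.2.1) (fun p hp => hp.2.2) t) continuousOn_const
  have hc2 : ∀ x' ∈ closure U, IsClosed {p ∈ K | 0 ≤
      (1 - t) * (-c x' p.2.1 + c p.1.1 p.2.1) + t * (-c x' p.2.2 + c p.1.1 p.2.2) -
        (-c x' p.1.2 + c p.1.1 p.1.2)} := fun x' hx' =>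
    hKc.isClosed.isClosed_le continuousOn_const (H.continuousOn_segment_gap continuousOn_fst.fst
      continuousOn_fst.snd continuousOn_snd.fst continuousOn_snd.snd (fun p hp => hp.1.1)
      (fun p hp => hp.1.2) (fun p hp => hp.2.1) (fun p hp => hp.2.2) t hx')
  set S := {p ∈ K | ‖gradX U c p.1.1 p.1.2 - ((1 - t) • gradX U c p.1.1 p.2.1 +
      t • gradX U c p.1.1 p.2.2)‖ ≤ 0} ∩ ⋂ x' ∈ closure U,
      {p ∈ K | 0 ≤
      (1 - t) * (-c x' p.2.1 + c p.1.1 p.2.1) + t * (-c x' p.2.2 + c p.1.1 p.2.2) -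
        (-c x' p.1.2 + c p.1.1 p.1.2)} with hS
  have hSc : IsCompact S :=
    hKc.of_isClosed_subset (hc1.inter (isClosed_biInter hc2)) fun p hp => hp.1.1
  have hcl : IsClosed ((fun p : (E n × E n) × (E n × E n) => (p.1.1, p.2)) '' S) :=
    (hSc.image (by fun_prop)).isClosed
  have hsub : U ×ˢ (V ×ˢ V) ⊆ (fun p : (E n × E n) × (E n × E n) => (p.1.1, p.2)) '' S := by
    rintro ⟨x, y₁, y₂⟩ ⟨hx, hy₁, hy₂⟩
    obtain ⟨y, hy, h1, h2⟩ := H.exists_segment_point_interior hx hy₁ hy₂ ht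
    have hmem : ((x, y), (y₁, y₂)) ∈ K :=
      ⟨⟨subset_closure hx, hy⟩, subset_closure hy₁, subset_closure hy₂⟩
    refine ⟨((x, y), (y₁, y₂)), ⟨⟨hmem, ?_⟩, ?_⟩, rfl⟩
    · simp [h1]
    · simp only [mem_iInter]
      exact fun x' hx' => ⟨hmem, sub_nonneg.2 (h2 x' hx')⟩
  have hx3 : (x, y₁, y₂) ∈ closure (U ×ˢ (V ×ˢ V)) := by
    simp only [closure_prod_eq]
    exact ⟨hx, hy₁, hy₂⟩
  obtain ⟨⟨⟨x, y⟩, z₁, z₂⟩, ⟨⟨hmem, h1⟩, h2⟩, heq⟩ := closure_minimal hsub hcl hx3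
  simp only [Prod.mk.injEq] at heq
  obtain ⟨rfl, rfl, rfl⟩ := heq
  refine ⟨y, hmem.1.2, sub_eq_zero.1 (norm_le_zero_iff.1 h1), fun x' hx' => ?_⟩
  exact sub_nonneg.1 (mem_iInter₂.1 h2 x' hx').2

end IsCrossCurvedCost

end Closure

/-! ### Supporting functions of a convex set in a doubly convex family. -/

section Geometry

variable {n : ℕ}

/-- A family of functions `m · y`, `y ∈ Y`, on `S`, normalized by `m · y₀ = 0`, convex, convex
along the segments in the gradient `G`, with relatively `κ`-Lipschitz gradients. -/
structure DoublyConvexFamily (S Y : Set (E n)) (m : E n → E n → ℝ) (G : E n → E n → E n)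
    (y₀ : E n) (κ : ℝ) : Prop where
  isCompact : IsCompact Y
  base_mem : y₀ ∈ Y
  base_zero : ∀ q ∈ S, m q y₀ = 0
  base_grad_zero : ∀ q ∈ S, G q y₀ = 0
  continuousOn : ContinuousOn (fun p : E n × E n => m p.1 p.2) (S ×ˢ Y)
  continuousOn_grad : ContinuousOn (fun p : E n × E n => G p.1 p.2) (S ×ˢ Y)
  subgradient : ∀ q ∈ S, ∀ q' ∈ S, ∀ y ∈ Y, m q y + inner ℝ (G q y) (q' - q) ≤ m q' y
  segment : ∀ q ∈ S, ∀ y₁ ∈ Y, ∀ y₂ ∈ Y, ∀ t ∈ Icc (0 : ℝ) 1, ∃ y ∈ Y,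
    G q y = (1 - t) • G q y₁ + t • G q y₂ ∧ ∀ q' ∈ S,
      m q' y - m q y ≤ (1 - t) * (m q' y₁ - m q y₁) + t * (m q' y₂ - m q y₂)
  lipschitz : ∀ q ∈ S, ∀ q' ∈ S, ∀ y ∈ Y, ‖G q y - G q' y‖ ≤ κ * ‖q - q'‖ * ‖G q' y‖

/-- `m · y` supports the section `Z` at `z`, with height at least `h` over `q₀`. -/
def SupportsAt (m : E n → E n → ℝ) (Z : Set (E n)) (q₀ : E n) (h : ℝ) (z y : E n) : Prop :=
  (∀ q ∈ Z, m q y ≤ m z y) ∧ m q₀ y + h ≤ m z y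

/-- Moving off a convex set in an outward direction and slightly towards an interior point,
one meets the frontier. -/
theorem exists_frontier_near {Z : Set (E n)} (hZ : Convex ℝ Z) {q₀ z w : E n}
    (hq₀ : q₀ ∈ interior Z) (hz : z ∈ Z) (hw : ∀ s > (0 : ℝ), z + s • w ∉ Z) {ε : ℝ}
    (hε : 0 < ε) : ∃ α r : ℝ, 0 < α ∧ α ≤ ε ∧ 0 ≤ r ∧ r ≤ ε ∧
      z + α • w + r • (q₀ - z) ∈ frontier Z := by
  obtain ⟨ρ, hρ, hball⟩ := Metric.isOpen_iff.1 isOpen_interior q₀ hq₀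
  set r₀ := min ε 1 with hr₀
  have hr₀pos : 0 < r₀ := lt_min hε one_pos
  set σ := min ρ 1 / (2 * (‖w‖ + 1)) with hσ
  have hρ1 : 0 < min ρ 1 := lt_min hρ one_pos
  have hσpos : 0 < σ := by positivity
  have hσ1 : σ ≤ 1 := by
    rw [hσ, div_le_one (by positivity)]
    have := min_le_right ρ 1
    nlinarith [norm_nonneg w]
  have hmem : q₀ + σ • w ∈ Z := by
    refine interior_subset (hball ?_)
    rw [Metric.mem_ball, dist_eq_norm, add_sub_cancel_left, norm_smul, Real.norm_eq_abs,
      abs_of_pos hσpos, hσ, div_mul_eq_mul_div, div_lt_iff₀ (by positivity)]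
    have := min_le_left ρ 1
    nlinarith [norm_nonneg w]
  -- This point is (1 - r₀) z + r₀ (q₀ + σ w). The path in r on [0, r₀] thus starts outside Z and
  -- ends in Z, and connectedness yields a frontier point.
  have hB : z + (r₀ * σ) • w + r₀ • (q₀ - z) ∈ Z := by
    have := hZ hz hmem (sub_nonneg.2 (min_le_right ε 1)) hr₀pos.le (by ring)
    convert this using 1
    module
  have hA : z + (r₀ * σ) • w + (0 : ℝ) • (q₀ - z) ∉ Z := by
    rw [zero_smul, add_zero]
    exact hw _ (by positivity)
  set φ : ℝ → E n := fun r => z + (r₀ * σ) • w + r • (q₀ - z) with hφ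
  have hφc : Continuous φ := by fun_prop
  have hpre : IsPreconnected (φ '' Icc 0 r₀) := isPreconnected_Icc.image _ hφc.continuousOn
  have hmeet : (φ '' Icc 0 r₀ ∩ frontier Z).Nonempty := by
    by_contra hemp
    rw [not_nonempty_iff_eq_empty, ← disjoint_iff_inter_eq_empty, disjoint_left] at hemp
    have hmB : φ r₀ ∈ φ '' Icc 0 r₀ := ⟨r₀, ⟨hr₀pos.le, le_rfl⟩, rfl⟩
    have hmA : φ 0 ∈ φ '' Icc 0 r₀ := ⟨0, ⟨le_rfl, hr₀pos.le⟩, rfl⟩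
    have hcov : ∀ p ∈ φ '' Icc 0 r₀, p ∈ interior Z ∨ p ∈ (closure Z)ᶜ := fun p hp =>
      or_iff_not_imp_left.2 fun hi hc => hemp hp ⟨hc, hi⟩
    obtain ⟨p, -, hp1, hp2⟩ := hpre (interior Z) (closure Z)ᶜ isOpen_interior
      isClosed_closure.isOpen_compl hcov
      ⟨φ r₀, hmB, (hcov _ hmB).resolve_right fun hc => hc (subset_closure hB)⟩
      ⟨φ 0, hmA, (hcov _ hmA).resolve_left fun hi => hA (interior_subset hi)⟩
    exact hp2 (interior_subset_closure hp1)
  obtain ⟨_, ⟨r, hr, rfl⟩, hfr⟩ := hmeet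
  refine ⟨r₀ * σ, r, by positivity, ?_, hr.1, hr.2.trans (min_le_left _ _), hfr⟩
  exact (mul_le_of_le_one_right hr₀pos.le hσ1).trans (min_le_left _ _)

namespace DoublyConvexFamily

variable {S Y : Set (E n)} {m : E n → E n → ℝ} {G : E n → E n → E n} {y₀ : E n} {κ : ℝ}
  {Z : Set (E n)} {q₀ : E n} {h : ℝ}

theorem tendsto_value (D : DoublyConvexFamily S Y m G y₀ κ) {z y : E n} {zs ys : ℕ → E n}
    (hz : z ∈ S) (hy : y ∈ Y) (hzs : ∀ k, zs k ∈ S) (hys : ∀ k, ys k ∈ Y)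
    (hzl : Tendsto zs atTop (𝓝 z)) (hyl : Tendsto ys atTop (𝓝 y)) :
    Tendsto (fun k => m (zs k) (ys k)) atTop (𝓝 (m z y)) := by
  have h1 := D.continuousOn (z, y) ⟨hz, hy⟩
  exact h1.tendsto.comp (tendsto_nhdsWithin_iff.2 ⟨hzl.prodMk_nhds hyl,
    Eventually.of_forall fun k => ⟨hzs k, hys k⟩⟩)

theorem tendsto_grad (D : DoublyConvexFamily S Y m G y₀ κ) {z y : E n} {zs ys : ℕ → E n}
    (hz : z ∈ S) (hy : y ∈ Y) (hzs : ∀ k, zs k ∈ S) (hys : ∀ k, ys k ∈ Y)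
    (hzl : Tendsto zs atTop (𝓝 z)) (hyl : Tendsto ys atTop (𝓝 y)) :
    Tendsto (fun k => G (zs k) (ys k)) atTop (𝓝 (G z y)) := by
  have h1 := D.continuousOn_grad (z, y) ⟨hz, hy⟩
  exact h1.tendsto.comp (tendsto_nhdsWithin_iff.2 ⟨hzl.prodMk_nhds hyl,
    Eventually.of_forall fun k => ⟨hzs k, hys k⟩⟩)

/-- Limits of supporting functions are supporting functions. -/
theorem supportsAt_of_tendsto (D : DoublyConvexFamily S Y m G y₀ κ) (hZS : Z ⊆ S)
    (hq₀ : q₀ ∈ Z) {z y : E n} {zs ys : ℕ → E n}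
    (hz : z ∈ S) (hy : y ∈ Y) (hzs : ∀ k, zs k ∈ S) (hys : ∀ k, ys k ∈ Y)
    (hzl : Tendsto zs atTop (𝓝 z)) (hyl : Tendsto ys atTop (𝓝 y))
    (hs : ∀ k, SupportsAt m Z q₀ h (zs k) (ys k)) : SupportsAt m Z q₀ h z y := by
  have hl := D.tendsto_value hz hy hzs hys hzl hyl
  have hc : ∀ q ∈ Z, Tendsto (fun k => m q (ys k)) atTop (𝓝 (m q y)) := fun q hq =>
    D.tendsto_value (hZS hq) hy (fun _ => hZS hq) hys tendsto_const_nhds hyl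
  exact ⟨fun q hq => le_of_tendsto_of_tendsto' (hc q hq) hl fun k => (hs k).1 q hq,
    le_of_tendsto_of_tendsto' ((hc q₀ hq₀).add_const h) hl fun k => (hs k).2⟩

/-- The height condition read through the subgradient inequality; it is what bounds the slope of a
supporting function from below. -/
theorem inner_grad_le (D : DoublyConvexFamily S Y m G y₀ κ) (hZS : Z ⊆ S)
    (hq₀ : q₀ ∈ Z) {z y : E n} (hz : z ∈ S) (hy : y ∈ Y) (hs : SupportsAt m Z q₀ h z y) :
    inner ℝ (G z y) (q₀ - z) ≤ -h := by
  have := D.subgradient z hz q₀ (hZS hq₀) y hy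
  linarith [hs.2]

/-- The gradients at `z` of the functions that support `Z` at `z` exhaust the directions
normal to `Z`. -/
theorem exists_supportsAt_grad_eq (D : DoublyConvexFamily S Y m G y₀ κ) (hZS : Z ⊆ S)
    (hZc : IsClosed Z) (hZ : Convex ℝ Z) (hq₀ : q₀ ∈ interior Z) (hh : 0 < h)
    (hbd : ∀ z ∈ frontier Z, ∃ y ∈ Y, SupportsAt m Z q₀ h z y) {z ν : E n}
    (hz : z ∈ frontier Z) (hν : ν ≠ 0) (hnormal : ∀ q ∈ Z, inner ℝ ν (q - z) ≤ 0) :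
    ∃ y ∈ Y, SupportsAt m Z q₀ h z y ∧ ∃ t : ℝ, 0 ≤ t ∧ G z y = t • ν := by
  by_contra hcon
  push Not at hcon
  have hfZ : frontier Z ⊆ Z := hZc.frontier_subset
  have hzZ := hfZ hz
  have hzS := hZS hzZ
  have hq₀Z := interior_subset hq₀
  set A := {y ∈ Y | SupportsAt m Z q₀ h z y} with hA
  have hAc : IsCompact A := by
    refine IsSeqCompact.isCompact fun ys hys => ?_
    obtain ⟨y, hy, φ, hφ, hl⟩ := D.isCompact.tendsto_subseq fun k => (hys k).1
    exact ⟨y, ⟨hy, D.supportsAt_of_tendsto hZS hq₀Z hzS hy (fun _ => hzS)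
      (fun k => (hys (φ k)).1) tendsto_const_nhds hl fun k => (hys (φ k)).2⟩, φ, hφ, hl⟩
  have hGz : ContinuousOn (G z) A := by
    have : ContinuousOn (fun y => (z, y)) A := by fun_prop
    exact D.continuousOn_grad.comp this fun y hy => ⟨hzS, hy.1⟩
  have hKc : IsCompact (G z '' A) := hAc.image_of_continuousOn hGz
  -- Segments with respect to z preserve the property of supporting Z at z, and the gradient at z is
  -- affine along them.
  have hKconv : Convex ℝ (G z '' A) := by
    rw [convex_iff_forall_pos]
    rintro _ ⟨y₁, hy₁, rfl⟩ _ ⟨y₂, hy₂, rfl⟩ a b ha hb hab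
    obtain ⟨y, hy, hG, hm⟩ := D.segment z hzS y₁ hy₁.1 y₂ hy₂.1 b ⟨hb.le, by linarith⟩
    obtain rfl : a = 1 - b := by linarith
    refine ⟨y, ⟨hy, fun q hq => ?_, ?_⟩, hG⟩
    · nlinarith [hm q (hZS hq), hy₁.2.1 q hq, hy₂.2.1 q hq]
    · nlinarith [hm q₀ (hZS hq₀Z), hy₁.2.2, hy₂.2.2]
  have hRc : IsClosed ((fun t : ℝ => t • ν) '' Ici 0) :=
    (isClosedEmbedding_smul_left hν).isClosedMap _ isClosed_Ici
  have hRconv : Convex ℝ ((fun t : ℝ => t • ν) '' Ici 0) :=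
    (convex_Ici 0).is_linear_image (IsLinearMap.mk (fun a b => add_smul a b ν)
      fun a b => by simp [mul_smul])
  have hdisj : Disjoint (G z '' A) ((fun t : ℝ => t • ν) '' Ici 0) := by
    rw [disjoint_left]
    rintro _ ⟨y, hy, rfl⟩ ⟨t, ht, hyt⟩
    exact hcon y hy.1 hy.2 t ht hyt.symm
  obtain ⟨f, a, b, hfa, hab, hfb⟩ :=
    geometric_hahn_banach_compact_closed hKconv hKc hRconv hRc hdisj
  have hb0 : b < 0 := by simpa using hfb 0 ⟨0, by simp⟩
  have hfν : 0 ≤ f ν := by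
    by_contra hneg
    push Not at hneg
    have := hfb ((b / f ν) • ν) ⟨b / f ν, (div_pos_of_neg_of_neg hb0 hneg).le, rfl⟩
    rw [map_smul, smul_eq_mul, div_mul_cancel₀ _ hneg.ne] at this
    exact lt_irrefl _ this
  obtain ⟨M, hM⟩ := hKc.isBounded.exists_norm_le
  set w₀ := (InnerProductSpace.toDual ℝ (E n)).symm f with hw₀
  have hw₀f : ∀ p, inner ℝ w₀ p = f p := fun p => InnerProductSpace.toDual_symm_apply
  -- Tilting w₀ by τν gives ⟨ν, w⟩ > 0, so that w points out of Z, while τ is small enough that ⟨p,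
  -- w⟩ < a/2 remains true for all supporting gradients p.
  set τ := -a / (2 * (|M| * ‖ν‖ + 1)) with hτ
  have ha0 : a < 0 := hab.trans hb0
  have hτpos : 0 < τ := div_pos (by linarith) (by positivity)
  set w := w₀ + τ • ν with hw
  have hwK : ∀ p ∈ G z '' A, inner ℝ p w < 0 := by
    intro p hp
    have h1 : inner ℝ p w₀ < a := by rw [real_inner_comm, hw₀f]; exact hfa p hp
    have h2 : inner ℝ p ν ≤ |M| * ‖ν‖ := (real_inner_le_norm p ν).trans
      (mul_le_mul_of_nonneg_right ((hM p hp).trans (le_abs_self M)) (norm_nonneg _))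
    have h3 : τ * (|M| * ‖ν‖) ≤ -a / 2 := by
      rw [hτ, div_mul_eq_mul_div, div_le_div_iff₀ (by positivity) two_pos]
      nlinarith [mul_nonneg (abs_nonneg M) (norm_nonneg ν)]
    rw [hw, inner_add_right, inner_smul_right]
    nlinarith
  have hwν : 0 < inner ℝ ν w := by
    rw [hw, inner_add_right, inner_smul_right, real_inner_self_eq_norm_sq, real_inner_comm, hw₀f]
    have : 0 < ‖ν‖ := norm_pos_iff.2 hν
    positivity
  have hout : ∀ s > (0 : ℝ), z + s • w ∉ Z := by
    intro s hs hmem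
    have := hnormal _ hmem
    rw [add_sub_cancel_left, inner_smul_right] at this
    nlinarith
  -- Functions supporting Z at frontier points z_k → z, reached essentially in the direction w,
  -- subconverge to one supporting Z at z; so eventually their gradients are negative on both w and
  -- q₀ - z.
  choose α r hα hαε hr hrε hfr using fun k : ℕ =>
    exists_frontier_near hZ hq₀ hzZ hout (ε := 1 / ((k : ℝ) + 1)) (by positivity)
  set zs : ℕ → E n := fun k => z + α k • w + r k • (q₀ - z) with hzs
  have hlim0 : Tendsto (fun k : ℕ => 1 / ((k : ℝ) + 1)) atTop (𝓝 0) :=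
    tendsto_one_div_add_atTop_nhds_zero_nat
  have hαl : Tendsto α atTop (𝓝 0) := squeeze_zero (fun k => (hα k).le) hαε hlim0
  have hrl : Tendsto r atTop (𝓝 0) := squeeze_zero hr hrε hlim0
  have hzl : Tendsto zs atTop (𝓝 z) := by
    simpa using ((tendsto_const_nhds (x := z)).add (hαl.smul_const w)).add
      (hrl.smul_const (q₀ - z))
  choose ys hysY hys using fun k => hbd (zs k) (hfr k)
  obtain ⟨y, hy, φ, hφ, hyl⟩ := D.isCompact.tendsto_subseq hysY
  have hzsS : ∀ k, zs k ∈ S := fun k => hZS (hfZ (hfr k))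
  have hzl' := hzl.comp hφ.tendsto_atTop
  have hyA : SupportsAt m Z q₀ h z y := D.supportsAt_of_tendsto hZS hq₀Z hzS hy
    (fun k => hzsS (φ k)) (fun k => hysY (φ k)) hzl' hyl fun k => hys (φ k)
  have hGl := D.tendsto_grad hzS hy (fun k => hzsS (φ k)) (fun k => hysY (φ k)) hzl' hyl
  have e1 : ∀ᶠ k in atTop, inner ℝ (G (zs (φ k)) (ys (φ k))) w < 0 :=
    (hGl.inner tendsto_const_nhds).eventually_lt_const (hwK _ ⟨y, ⟨hy, hyA⟩, rfl⟩)
  have e2 : ∀ᶠ k in atTop, inner ℝ (G (zs (φ k)) (ys (φ k))) (q₀ - z) < 0 :=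
    (hGl.inner tendsto_const_nhds).eventually_lt_const
      (by linarith [D.inner_grad_le hZS hq₀Z hzS hy hyA])
  obtain ⟨k, h1, h2⟩ := (e1.and e2).exists
  -- Support at z_k together with convexity forces ⟨G, z_k - z⟩ ≥ 0. But z_k - z is a combination of
  -- w and q₀ - z with coefficients α > 0 and r ≥ 0, a contradiction.
  have h3 := D.subgradient _ (hzsS (φ k)) z hzS _ (hysY (φ k))
  have h4 := (hys (φ k)).1 z hzZ
  have h5 : z - zs (φ k) = -(α (φ k) • w + r (φ k) • (q₀ - z)) := by rw [hzs]; module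
  rw [h5, inner_neg_right, inner_add_right, inner_smul_right, inner_smul_right] at h3
  nlinarith [hα (φ k), hr (φ k), mul_pos (hα (φ k)) (neg_pos.2 h1),
    mul_nonneg (hr (φ k)) (neg_pos.2 h2).le]

/-- For each direction `ν` normal to `Z` at `z` there is an admissible function whose gradient
at the vertex almost points in the direction `ν`, with length `h / ⟨ν, z - q₀⟩`. -/
theorem exists_admissible (D : DoublyConvexFamily S Y m G y₀ κ) (hZS : Z ⊆ S)
    (hZc : IsClosed Z) (hZ : Convex ℝ Z) (hq₀ : q₀ ∈ interior Z) (hh : 0 < h)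
    (hbd : ∀ z ∈ frontier Z, ∃ y ∈ Y, SupportsAt m Z q₀ h z y) {δ : ℝ}
    (hδ : ∀ z ∈ Z, κ * ‖q₀ - z‖ ≤ δ) {z ν : E n}
    (hz : z ∈ frontier Z) (hν : ‖ν‖ = 1) (hnormal : ∀ q ∈ Z, inner ℝ ν (q - z) ≤ 0) :
    0 < inner ℝ ν (z - q₀) ∧ ∃ y ∈ Y, (∀ q ∈ Z, m q y - m q₀ y - h ≤ 0) ∧
      ‖G q₀ y - (h / inner ℝ ν (z - q₀)) • ν‖ ≤ δ * (h / inner ℝ ν (z - q₀)) := by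
  have hν0 : ν ≠ 0 := by rintro rfl; simp at hν
  have hzZ := hZc.frontier_subset hz
  have hzS := hZS hzZ
  have hq₀Z := interior_subset hq₀
  obtain ⟨y, hy, hs, l, hl, hG⟩ :=
    D.exists_supportsAt_grad_eq hZS hZc hZ hq₀ hh hbd hz hν0 hnormal
  set d := inner ℝ ν (z - q₀) with hd
  have h1 : h ≤ l * d := by
    have := D.inner_grad_le hZS hq₀Z hzS hy hs
    rw [hG, inner_smul_left, ← neg_sub z q₀, inner_neg_right, ← hd] at this
    simp only [conj_trivial] at this
    linarith
  have hd0 : 0 < d := by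
    by_contra hneg
    push Not at hneg
    nlinarith
  have hl0 : 0 < l := by
    by_contra hneg
    push Not at hneg
    nlinarith
  have ht : h / (l * d) ∈ Icc (0 : ℝ) 1 :=
    ⟨by positivity, (div_le_one (by positivity)).2 h1⟩
  -- Starting at y₀, where the gradient is 0, the fraction h/(ld) ≤ 1 of the way to y turns the
  -- gradient lν at z into exactly (h/d)ν. The drop from z to q₀ is then at most h, which is
  -- admissibility.
  obtain ⟨y', hy', hG', hm'⟩ := D.segment z hzS y₀ D.base_mem y hy _ ht
  rw [D.base_grad_zero z hzS, hG, smul_zero, zero_add, smul_smul,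
    show h / (l * d) * l = h / d by field_simp] at hG'
  refine ⟨hd0, y', hy', fun q hq => ?_, ?_⟩
  · have h2 := hm' q (hZS hq)
    rw [D.base_zero q (hZS hq), D.base_zero z hzS, sub_zero, mul_zero, zero_add] at h2
    have h3 : m q y' ≤ m z y' := by nlinarith [hs.1 q hq, ht.1]
    have h4 := D.subgradient z hzS q₀ (hZS hq₀Z) y' hy'
    rw [hG', inner_smul_left, ← neg_sub z q₀, inner_neg_right, ← hd] at h4
    simp only [conj_trivial] at h4
    have h5 : h / d * d = h := div_mul_cancel₀ _ hd0.ne'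
    linarith
  · rw [← hG']
    refine (D.lipschitz q₀ (hZS hq₀Z) z hzS y' hy').trans ?_
    have h6 : ‖G z y'‖ = h / d := by
      rw [hG', norm_smul, hν, mul_one, Real.norm_eq_abs, abs_of_pos (by positivity)]
    rw [h6]
    exact mul_le_mul_of_nonneg_right (hδ z hzZ) (by positivity)

end DoublyConvexFamily

end Geometry

/-! ### A greedy orthonormal frame. -/

section Frames

/-- A greedy orthonormal frame for a compact set: the points `w i` of the set
are triangular with respect to the frame and realize the widths of the set in the directions of
the frame. -/
theorem exists_greedy_frame {F : Type*} [NormedAddCommGroup F] [InnerProductSpace ℝ F]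
    [FiniteDimensional ℝ F] {K : Set F} (hK : IsCompact K) (hne : K.Nonempty) (k : ℕ) :
    ∀ W : Submodule ℝ F, Module.finrank ℝ W = k → ∃ e w : Fin k → F, Orthonormal ℝ e ∧
      (∀ i, e i ∈ W) ∧ (∀ i, w i ∈ K) ∧ (∀ i, ∀ z ∈ K, |inner ℝ (e i) z| ≤ inner ℝ (e i) (w i)) ∧
      ∀ i j, i < j → inner ℝ (e j) (w i) = 0 := by
  induction k with
  | zero =>
    intro W _
    exact ⟨Fin.elim0, Fin.elim0, ⟨fun i => i.elim0, fun i => i.elim0⟩, fun i => i.elim0,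
      fun i => i.elim0, fun i => i.elim0, fun i => i.elim0⟩
  | succ k ih =>
    intro W hW
    -- The next frame vector points along the longest projection to W of a point of K; its inner
    -- products on K are then maximal at that point.
    obtain ⟨w₀, hw₀, hmax⟩ := hK.exists_isMaxOn hne
      (f := fun z => ‖W.starProjection z‖) (by fun_prop)
    set u := W.starProjection w₀ with hu
    have huW : u ∈ W := W.starProjection_apply_mem w₀
    obtain ⟨e₀, he₀W, he₀, hue⟩ : ∃ e₀ ∈ W, ‖e₀‖ = 1 ∧ u = ‖u‖ • e₀ := by
      by_cases h0 : u = 0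
      · have : Nontrivial W := Module.nontrivial_of_finrank_pos (R := ℝ) (by omega)
        obtain ⟨v, hv⟩ := exists_ne (0 : W)
        have hv' : (v : F) ≠ 0 := by simpa using hv
        exact ⟨(‖(v : F)‖⁻¹ : ℝ) • (v : F), W.smul_mem _ v.2, norm_smul_inv_norm hv', by simp [h0]⟩
      · exact ⟨(‖u‖⁻¹ : ℝ) • u, W.smul_mem _ huW, norm_smul_inv_norm h0, by
          rw [smul_smul, mul_inv_cancel₀ (norm_ne_zero_iff.2 h0), one_smul]⟩
    have hproj : ∀ v ∈ W, ∀ z, inner ℝ v z = inner ℝ v (W.starProjection z) := by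
      intro v hv z
      rw [← Submodule.inner_starProjection_left_eq_right,
        Submodule.starProjection_eq_self_iff.2 hv]
    have he₀u : inner ℝ e₀ u = ‖u‖ := by
      rw [hue, inner_smul_right, real_inner_self_eq_norm_sq, he₀, norm_smul, he₀]
      simp
    set L : Submodule ℝ F := Submodule.span ℝ {e₀} with hL
    have hLW : L ≤ W := by
      rw [hL, Submodule.span_singleton_le_iff_mem]; exact he₀W
    have hLf : Module.finrank ℝ L = 1 := finrank_span_singleton (by
      rintro rfl; simp at he₀)
    have hfin : Module.finrank ℝ (Lᗮ ⊓ W : Submodule ℝ F) = k := by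
      have := Submodule.finrank_add_inf_finrank_orthogonal hLW
      omega
    -- Later frame vectors lie in W and are orthogonal to e₀, hence to the projection of w₀ to W and
    -- so to w₀ itself: this is the triangularity.
    obtain ⟨e, w, he, heW, hw, hmx, htri⟩ := ih _ hfin
    have horth : ∀ i, inner ℝ e₀ (e i) = 0 := fun i =>
      Submodule.mem_orthogonal_singleton_iff_inner_right.1 (heW i).1
    refine ⟨Fin.cons e₀ e, Fin.cons w₀ w, ?_, ?_, ?_, ?_, ?_⟩
    · rw [orthonormal_iff_ite] at he ⊢
      intro i j
      refine Fin.cases ?_ (fun i => ?_) i <;> refine Fin.cases ?_ (fun j => ?_) j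
      · simp [he₀]
      · simp [horth, (Fin.succ_ne_zero j).symm]
      · simp [real_inner_comm e₀, horth]
      · simpa using he i j
    · exact Fin.cases he₀W fun i => (heW i).2
    · exact Fin.cases hw₀ hw
    · refine Fin.cases (fun z hz => ?_) fun i => by simpa using hmx i
      simp only [Fin.cons_zero]
      rw [hproj e₀ he₀W z, hproj e₀ he₀W w₀, ← hu, he₀u]
      refine (abs_real_inner_le_norm _ _).trans ?_
      rw [he₀, one_mul]
      exact hmax hz
    · intro i j hij
      refine Fin.cases (fun hij => ?_) (fun i hij => ?_) i hij
      all_goals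
        revert hij
        refine Fin.cases (fun hij => ?_) (fun j hij => ?_) j
      · exact absurd hij (lt_irrefl _)
      · simp only [Fin.cons_zero, Fin.cons_succ]
        rw [hproj _ (heW j).2 w₀, ← hu, hue, inner_smul_right, real_inner_comm, horth, mul_zero]
      · exact absurd hij (by simp)
      · simpa using htri i j (by simpa using hij)

end Frames

/-! ### Lower bounds for the two volumes and their product. -/

section Volume

variable {n : ℕ}

/-- A convex set contains a cube in the coordinates given by some of its points. -/
theorem volume_ge_of_frame (e : OrthonormalBasis (Fin n) ℝ (E n)) (L : E n →ₗ[ℝ] E n)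
    {P : Set (E n)} (a : E n)
    (hP : ∀ t : Fin n → ℝ, (∀ i, 0 ≤ t i) → ∑ i, t i ≤ 1 → a + ∑ i, t i • L (e i) ∈ P) :
    ENNReal.ofReal (|LinearMap.det L| * ((n : ℝ)⁻¹) ^ n) ≤ volume P := by
  -- The cube with side 1/n fits inside the simplex ∑ t i ≤ 1.
  set Q : Set (Fin n → ℝ) := Set.pi univ fun _ => Icc (0 : ℝ) (n : ℝ)⁻¹ with hQ
  have hvQ : volume Q = ENNReal.ofReal (((n : ℝ)⁻¹) ^ n) := by
    rw [hQ, volume_pi_pi, ENNReal.ofReal_pow (by positivity)]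
    simp
  have hpres := (PiLp.volume_preserving_ofLp (Fin n)).comp e.measurePreserving_repr
  set QE : Set (E n) := (WithLp.ofLp ∘ e.repr) ⁻¹' Q with hQE
  have hvol : volume QE = volume Q :=
    hpres.measure_preimage (MeasurableSet.univ_pi fun _ => measurableSet_Icc).nullMeasurableSet
  have hsub : (fun x => a + x) '' (L '' QE) ⊆ P := by
    rintro _ ⟨_, ⟨x, hx, rfl⟩, rfl⟩
    have hx' : ∀ i, e.repr x i ∈ Icc (0 : ℝ) (n : ℝ)⁻¹ := fun i => hx i (mem_univ i)
    have hsum : L x = ∑ i, e.repr x i • L (e i) := by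
      conv_lhs => rw [← e.sum_repr x]
      simp
    simp only [hsum]
    refine hP _ (fun i => (hx' i).1) ?_
    refine (Finset.sum_le_sum fun i _ => (hx' i).2).trans ?_
    rw [Finset.sum_const, Finset.card_univ, Fintype.card_fin, nsmul_eq_mul]
    exact mul_inv_le_one
  refine le_trans ?_ (measure_mono hsub)
  rw [image_add_left, measure_preimage_add, Measure.addHaar_image_linearMap, hvol, hvQ,
    ← ENNReal.ofReal_mul (abs_nonneg _)]

theorem det_constr_of_triangular (e : OrthonormalBasis (Fin n) ℝ (E n)) (v : Fin n → E n)
    (hv : ∀ i j, i < j → inner ℝ (e j) (v i) = 0) :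
    LinearMap.det (e.toBasis.constr ℝ v) = ∏ i, inner ℝ (e i) (v i) := by
  have hentry : ∀ i j, LinearMap.toMatrix e.toBasis e.toBasis (e.toBasis.constr ℝ v) i j =
      inner ℝ (e i) (v j) := by
    intro i j
    rw [LinearMap.toMatrix_apply, Module.Basis.constr_basis, OrthonormalBasis.coe_toBasis_repr_apply,
      OrthonormalBasis.repr_apply_apply]
  rw [← LinearMap.det_toMatrix e.toBasis, Matrix.det_of_isUpperTriangular]
  · exact Finset.prod_congr rfl fun i _ => hentry i i
  · intro i j hij
    rw [hentry]
    exact hv j i hij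

/-- Continuity of the determinant at the identity; the resulting δ depends on n only, and so does
the final constant. -/
theorem exists_det_ge_half (n : ℕ) : ∃ δ : ℝ, 0 < δ ∧ ∀ M : E n →L[ℝ] E n,
    ‖M - ContinuousLinearMap.id ℝ (E n)‖ ≤ δ → 1 / 2 ≤ |M.det| := by
  have hc : Continuous fun M : E n →L[ℝ] E n => |M.det| :=
    (ContinuousLinearMap.continuous_det).abs
  have hid : |(ContinuousLinearMap.id ℝ (E n)).det| = 1 := by
    simp [ContinuousLinearMap.det]
  have h1 : ∀ᶠ M in 𝓝 (ContinuousLinearMap.id ℝ (E n)), 1 / 2 < |M.det| :=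
    hc.continuousAt.eventually_const_lt (by simp only [hid]; norm_num)
  obtain ⟨δ, hδ, hball⟩ := Metric.eventually_nhds_iff.1 h1
  refine ⟨δ / 2, by positivity, fun M hM => (hball ?_).le⟩
  rw [dist_eq_norm]
  linarith

theorem sum_smul_mem_of_zero_mem {P : Set (E n)} (hP : Convex ℝ P) (h0 : (0 : E n) ∈ P)
    {p : Fin n → E n} (hp : ∀ i, p i ∈ P) {t : Fin n → ℝ} (ht : ∀ i, 0 ≤ t i)
    (hs : ∑ i, t i ≤ 1) : ∑ i, t i • p i ∈ P := by
  -- The missing weight 1 - ∑ t i goes to the origin, indexed by `none`.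
  have h := hP.sum_mem (t := Finset.univ) (w := fun o : Option (Fin n) => o.elim (1 - ∑ i, t i) t)
    (z := fun o => o.elim 0 p) ?_ ?_ ?_
  · simpa [Fintype.sum_option] using h
  · rintro (_ | i) _
    · simpa using hs
    · exact ht i
  · simp [Fintype.sum_option]
  · rintro (_ | i) _
    · exact h0
    · exact hp i

/-- A convex set that contains the origin and points close to multiples of the vectors of
an orthonormal basis is large. -/
theorem volume_ge_of_near_frame {δ δ' : ℝ} (hδ : ∀ M : E n →L[ℝ] E n,
    ‖M - ContinuousLinearMap.id ℝ (E n)‖ ≤ δ → 1 / 2 ≤ |M.det|) (hδ' : 0 ≤ δ')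
    (hnδ : n * δ' ≤ δ) (e : OrthonormalBasis (Fin n) ℝ (E n)) {P : Set (E n)}
    (hP : Convex ℝ P) (h0 : (0 : E n) ∈ P) {p : Fin n → E n} (hp : ∀ i, p i ∈ P)
    {r : Fin n → ℝ} (hr : ∀ i, 0 < r i) (hpr : ∀ i, ‖p i - r i • e i‖ ≤ δ' * r i) :
    ENNReal.ofReal (1 / 2 * (∏ i, r i) * ((n : ℝ)⁻¹) ^ n) ≤ volume P := by
  -- The map sending e i to p i factors as M ∘ D, with D diagonal of determinant ∏ r i and M a
  -- perturbation of the identity of size at most n δ'.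
  set D := e.toBasis.constr ℝ fun i => r i • e i with hD
  set M := e.toBasis.constr ℝ fun i => (r i)⁻¹ • p i with hM
  have hDe : ∀ i, D (e i) = r i • e i := fun i => by
    rw [hD, ← OrthonormalBasis.coe_toBasis, Module.Basis.constr_basis]
  have hMe : ∀ i, M (e i) = (r i)⁻¹ • p i := fun i => by
    rw [hM, ← OrthonormalBasis.coe_toBasis, Module.Basis.constr_basis]
  have hdetD : LinearMap.det D = ∏ i, r i := by
    rw [hD, det_constr_of_triangular]
    · simp [inner_smul_right]
    · intro i j hij
      rw [inner_smul_right, e.inner_eq_ite, if_neg hij.ne', mul_zero]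
  have hdetM : 1 / 2 ≤ |LinearMap.det M| := by
    have := hδ M.toContinuousLinearMap ?_
    · simpa [ContinuousLinearMap.det] using this
    refine le_trans (ContinuousLinearMap.opNorm_le_bound _ (by positivity) fun x => ?_) hnδ
    have hx : M x - x = ∑ i, e.repr x i • ((r i)⁻¹ • (p i - r i • e i)) := by
      have h1 : M x = ∑ i, e.repr x i • ((r i)⁻¹ • p i) := by
        conv_lhs => rw [← e.sum_repr x]
        simp [hMe]
      have h2 : x = ∑ i, e.repr x i • ((r i)⁻¹ • r i • e i) := by
        conv_lhs => rw [← e.sum_repr x]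
        refine Finset.sum_congr rfl fun i _ => ?_
        rw [smul_smul (r i)⁻¹, inv_mul_cancel₀ (hr i).ne', one_smul]
      nth_rewrite 2 [h2]
      rw [h1, ← Finset.sum_sub_distrib]
      refine Finset.sum_congr rfl fun i _ => ?_
      rw [smul_sub (r i)⁻¹, smul_sub]
    have hxn : ∀ i, |e.repr x i| ≤ ‖x‖ := fun i => by
      have := PiLp.norm_apply_le (e.repr x) i
      rwa [LinearIsometryEquiv.norm_map] at this
    have hx' : (M.toContinuousLinearMap - ContinuousLinearMap.id ℝ (E n)) x = M x - x := rfl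
    rw [hx', hx]
    refine (norm_sum_le _ _).trans ((Finset.sum_le_sum (g := fun _ => δ' * ‖x‖) fun i _ => ?_).trans
      (by simp [mul_assoc]))
    rw [norm_smul, norm_smul, Real.norm_eq_abs, Real.norm_eq_abs, abs_inv, abs_of_pos (hr i),
      mul_comm]
    refine mul_le_mul ?_ (hxn i) (abs_nonneg _) hδ'
    rw [inv_mul_le_iff₀ (hr i), mul_comm (r i)]
    exact hpr i
  refine le_trans (ENNReal.ofReal_le_ofReal ?_) (volume_ge_of_frame e (M ∘ₗ D) 0 fun t ht hs => ?_)
  · rw [LinearMap.det_comp, abs_mul, hdetD, abs_of_pos (Finset.prod_pos fun i _ => hr i)]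
    have : 0 ≤ ∏ i, r i := (Finset.prod_pos fun i _ => hr i).le
    gcongr
  · have : ∀ i, (M ∘ₗ D) (e i) = p i := fun i => by
      rw [LinearMap.comp_apply, hDe, map_smul, hMe, smul_smul, mul_inv_cancel₀ (hr i).ne', one_smul]
    simp only [this, zero_add]
    exact sum_smul_mem_of_zero_mem hP h0 hp ht hs

/-- A convex set that contains a segment and triangular points with respect to an orthonormal
basis is large. -/
theorem volume_ge_of_chord {k : ℕ} (e : OrthonormalBasis (Fin (k + 1)) ℝ (E (k + 1)))
    {Z : Set (E (k + 1))} (hZ : Convex ℝ Z) {q₀ u v : E (k + 1)} (hq₀ : q₀ ∈ Z) (hu : u ∈ Z)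
    (hv : v ∈ Z) {l : ℝ} (hl : 0 ≤ l) (huv : v = u + l • e 0) {w : Fin k → E (k + 1)}
    (hw : ∀ i, q₀ + w i ∈ Z) (htri : ∀ i j, i < j → inner ℝ (e j.succ) (w i) = 0)
    (hpos : ∀ i, 0 ≤ inner ℝ (e i.succ) (w i)) :
    ENNReal.ofReal (l / 2 * (∏ i, inner ℝ (e i.succ) (w i) / 2) *
      (((k + 1 : ℕ) : ℝ)⁻¹) ^ (k + 1)) ≤ volume Z := by
  -- Midpoints between the chord and the simplex with vertices q₀ and q₀ + w i stay in Z, hence the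
  -- halves. The components of w i along e 0 are arbitrary but harmless to the triangular
  -- determinant.
  set b : Fin (k + 1) → E (k + 1) :=
    Fin.cons ((l / 2) • e 0) fun i => (1 / 2 : ℝ) • w i with hb
  have hdet : LinearMap.det (e.toBasis.constr ℝ b) =
      l / 2 * ∏ i, inner ℝ (e i.succ) (w i) / 2 := by
    rw [det_constr_of_triangular]
    · rw [Fin.prod_univ_succ]
      simp only [hb, Fin.cons_zero, Fin.cons_succ, inner_smul_right]
      congr 1
      · simp
      · exact Finset.prod_congr rfl fun i _ => by ring
    · intro i j hij
      obtain ⟨j, rfl⟩ := Fin.exists_succ_eq.2 (ne_of_gt (lt_of_le_of_lt (Fin.zero_le i) hij))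
      revert hij
      refine Fin.cases (fun hij => ?_) (fun i hij => ?_) i
      · simp [hb, inner_smul_right, e.inner_eq_ite, Fin.succ_ne_zero]
      · simp [hb, inner_smul_right, htri i j (by simpa using hij)]
  refine le_trans (ENNReal.ofReal_le_ofReal ?_)
    (volume_ge_of_frame e (e.toBasis.constr ℝ b) ((1 / 2 : ℝ) • u + (1 / 2 : ℝ) • q₀)
      fun t ht hs => ?_)
  · rw [hdet, abs_of_nonneg (mul_nonneg (by positivity)
      (Finset.prod_nonneg fun i _ => div_nonneg (hpos i) two_pos.le))]
  · have he : ∀ i, e.toBasis.constr ℝ b (e i) = b i := fun i => by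
      rw [← OrthonormalBasis.coe_toBasis, Module.Basis.constr_basis]
    simp only [he]
    rw [Fin.sum_univ_succ] at hs ⊢
    have ht0 := ht 0
    have hs' : 0 ≤ ∑ i : Fin k, t i.succ := Finset.sum_nonneg fun i _ => ht _
    have h1 : u + t 0 • (l • e 0) ∈ Z := by
      have := hZ hu hv (a := 1 - t 0) (b := t 0) (by linarith) ht0 (by ring)
      convert this using 1
      rw [huv]; module
    have h2 : q₀ + ∑ i : Fin k, t i.succ • w i ∈ Z := by
      have h := hZ.sum_mem (t := Finset.univ)
        (w := fun o : Option (Fin k) => o.elim (1 - ∑ i : Fin k, t i.succ) fun i => t i.succ)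
        (z := fun o => o.elim q₀ fun i => q₀ + w i) ?_ ?_ ?_
      · convert h using 1
        simp only [Fintype.sum_option, Option.elim_none, Option.elim_some, smul_add,
          Finset.sum_add_distrib, ← Finset.sum_smul]
        module
      · rintro (_ | i) _
        · simp only [Option.elim_none]; linarith
        · exact ht _
      · simp [Fintype.sum_option]
      · rintro (_ | i) _
        · exact hq₀
        · exact hw i
    have h3 := hZ h1 h2 (a := 1 / 2) (b := 1 / 2) (by norm_num) (by norm_num) (by norm_num)
    convert h3 using 1
    simp only [hb, Fin.cons_zero, Fin.cons_succ, smul_add, Finset.smul_sum]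
    simp only [smul_comm (1 / 2 : ℝ)]
    module

/-- A compact set has a supporting hyperplane in every direction. -/
theorem exists_support_point {Z : Set (E n)} (hZ : IsCompact Z) (hne : Z.Nonempty) {ν : E n}
    (hν : ν ≠ 0) : ∃ z ∈ frontier Z, ∀ q ∈ Z, inner ℝ ν (q - z) ≤ 0 := by
  obtain ⟨z, hz, hmax⟩ := hZ.exists_isMaxOn hne (f := fun q => inner ℝ ν q) (by fun_prop)
  have hle : ∀ q ∈ Z, inner ℝ ν (q - z) ≤ 0 := fun q hq => by
    rw [inner_sub_right]; exact sub_nonpos.2 (hmax hq)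
  refine ⟨z, ⟨subset_closure hz, fun hint => ?_⟩, hle⟩
  obtain ⟨δ, hδ, hmem⟩ := exists_segment_subset isOpen_interior hint ν
  have := hle _ (interior_subset (hmem 1 (by norm_num)))
  rw [one_smul, add_sub_cancel_left, inner_smul_right, real_inner_self_eq_norm_sq] at this
  have h2 : 0 < ‖ν‖ := norm_pos_iff.2 hν
  have : 0 < δ * ‖ν‖ ^ 2 := by positivity
  linarith

/-- An orthonormal basis starting with a given unit vector, greedy for a compact set. -/
theorem exists_adapted_basis {k : ℕ} {K : Set (E (k + 1))} (hK : IsCompact K) (hne : K.Nonempty)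
    {ν : E (k + 1)} (hν : ‖ν‖ = 1) :
    ∃ (e : OrthonormalBasis (Fin (k + 1)) ℝ (E (k + 1))) (w : Fin k → E (k + 1)), e 0 = ν ∧
      (∀ i, w i ∈ K) ∧ (∀ i, ∀ z ∈ K, inner ℝ (e i.succ) z ≤ inner ℝ (e i.succ) (w i)) ∧
      ∀ i j, i < j → inner ℝ (e j.succ) (w i) = 0 := by
  have hν0 : ν ≠ 0 := by rintro rfl; simp at hν
  have hfin : Module.finrank ℝ ((Submodule.span ℝ {ν})ᗮ : Submodule ℝ (E (k + 1))) = k := by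
    have h1 := Submodule.finrank_add_finrank_orthogonal (Submodule.span ℝ {ν})
    rw [finrank_span_singleton hν0, finrank_euclideanSpace_fin] at h1
    omega
  obtain ⟨e, w, he, heW, hw, hmx, htri⟩ := exists_greedy_frame hK hne k _ hfin
  have horth : ∀ i, inner ℝ ν (e i) = 0 := fun i =>
    Submodule.mem_orthogonal_singleton_iff_inner_right.1 (heW i)
  have hcons : Orthonormal ℝ (Fin.cons ν e : Fin (k + 1) → E (k + 1)) := by
    rw [orthonormal_iff_ite] at he ⊢
    intro i j
    refine Fin.cases ?_ (fun i => ?_) i <;> refine Fin.cases ?_ (fun j => ?_) j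
    · simp [hν]
    · simp [horth, (Fin.succ_ne_zero j).symm]
    · simp [real_inner_comm ν, horth]
    · simpa using he i j
  obtain ⟨b, hb⟩ := Orthonormal.exists_orthonormalBasis_extension_of_card_eq (𝕜 := ℝ)
    (E := E (k + 1)) (ι := Fin (k + 1)) (by simp) (v := Fin.cons ν e) (s := univ)
    (hcons.comp _ Subtype.val_injective)
  have hb0 : b 0 = ν := hb 0 (mem_univ _)
  have hbs : ∀ i : Fin k, b i.succ = e i := fun i => hb i.succ (mem_univ _)
  refine ⟨b, w, hb0, hw, fun i z hz => ?_, fun i j hij => ?_⟩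
  · rw [hbs]; exact (le_abs_self _).trans (hmx i z hz)
  · rw [hbs]; exact htri i j hij

theorem ofReal_le_mul_mul {X C a b : ℝ} {v w : ℝ≥0∞} (hC : 0 ≤ C) (ha : 0 ≤ a)
    (hX : X ≤ C * a * b) (hv : ENNReal.ofReal a ≤ v) (hw : ENNReal.ofReal b ≤ w) :
    ENNReal.ofReal X ≤ ENNReal.ofReal C * v * w := by
  refine (ENNReal.ofReal_le_ofReal hX).trans ?_
  rw [ENNReal.ofReal_mul (mul_nonneg hC ha), ENNReal.ofReal_mul hC]
  gcongr

/-- The cancellation: each factor (h / d (i+1)) · (a i / 2) is at least h/2, so that only d 0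
survives. -/
theorem pow_div_le_prod_mul_prod {k : ℕ} {h : ℝ} (hh : 0 < h) {d : Fin (k + 1) → ℝ}
    (hd : ∀ i, 0 < d i) {a : Fin k → ℝ} (had : ∀ i, d i.succ ≤ a i) :
    h ^ (k + 1) / d 0 * (1 / 2) ^ k ≤ (∏ i, h / d i) * ∏ i, a i / 2 := by
  rw [Fin.prod_univ_succ, mul_assoc, ← Finset.prod_mul_distrib, pow_succ', mul_div_right_comm,
    mul_assoc, ← mul_pow]
  refine mul_le_mul_of_nonneg_left ?_ (div_pos hh (hd 0)).le
  rw [← Fin.prod_const]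
  refine Finset.prod_le_prod (fun i _ => by positivity) fun i _ => ?_
  have h1 := hd i.succ
  rw [div_mul_div_comm, mul_one_div, div_le_div_iff₀ two_pos (mul_pos h1 two_pos)]
  nlinarith [mul_le_mul_of_nonneg_left (had i) hh.le]

theorem half_prod_mul_nonneg {k : ℕ} {h N : ℝ} (hh : 0 < h) (hN : 0 ≤ N) {d : Fin k → ℝ}
    (hd : ∀ i, 0 < d i) : 0 ≤ 1 / 2 * (∏ i, h / d i) * N :=
  mul_nonneg (mul_nonneg (by norm_num) (Finset.prod_nonneg fun i _ => (div_pos hh (hd i)).le)) hN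

theorem volume_product_arith {k : ℕ} {h l N C : ℝ} (hh : 0 < h) (hl : 0 ≤ l) (hC : 0 ≤ C)
    (hCN : 1 ≤ C * (1 / 4 * N ^ 2 * (1 / 2) ^ k)) {d : Fin (k + 1) → ℝ}
    (hd : ∀ i, 0 < d i) {a : Fin k → ℝ} (had : ∀ i, d i.succ ≤ a i) :
    h ^ (k + 1) * l / d 0 ≤ C * (1 / 2 * (∏ i, h / d i) * N) * (l / 2 * (∏ i, a i / 2) * N) := by
  have hX : 0 ≤ h ^ (k + 1) * l / d 0 := div_nonneg (by positivity) (hd 0).le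
  calc h ^ (k + 1) * l / d 0 ≤ (C * (1 / 4 * N ^ 2 * (1 / 2) ^ k)) * (h ^ (k + 1) * l / d 0) :=
        le_mul_of_one_le_left hX hCN
    _ = C * (1 / 4) * N ^ 2 * l * (h ^ (k + 1) / d 0 * (1 / 2) ^ k) := by ring
    _ ≤ C * (1 / 4) * N ^ 2 * l * ((∏ i, h / d i) * ∏ i, a i / 2) :=
        mul_le_mul_of_nonneg_left (pow_div_le_prod_mul_prod hh hd had) (by positivity)
    _ = _ := by ring

set_option maxHeartbeats 1000000 in
/-- The volume estimate for the cone with vertex `q₀` and height `h` over `Z`. -/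
theorem exists_cone_volume_bound (k : ℕ) : ∃ C : ℝ, 0 < C ∧
    ∀ (S Y : Set (E (k + 1))) (m : E (k + 1) → E (k + 1) → ℝ)
      (G : E (k + 1) → E (k + 1) → E (k + 1)) (y₀ : E (k + 1)) (κ : ℝ),
    DoublyConvexFamily S Y m G y₀ κ → ∀ Z ⊆ S, IsCompact Z → Convex ℝ Z → ∀ q₀ ∈ interior Z,
    ∀ h : ℝ, 0 < h → (∀ z ∈ frontier Z, ∃ y ∈ Y, SupportsAt m Z q₀ h z y) →
    (∀ z ∈ Z, κ * ‖q₀ - z‖ ≤ 1 / C) →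
    ∀ P : Set (E (k + 1)), Convex ℝ P →
    (∀ y ∈ Y, (∀ q ∈ Z, m q y - m q₀ y - h ≤ 0) → G q₀ y ∈ P) →
    ∀ (ν z u v : E (k + 1)) (l : ℝ), ‖ν‖ = 1 → z ∈ frontier Z →
    (∀ q ∈ Z, inner ℝ ν (q - z) ≤ 0) → u ∈ Z → v ∈ Z → 0 ≤ l → v = u + l • ν →
    0 < inner ℝ ν (z - q₀) ∧
    ENNReal.ofReal (h ^ (k + 1) * l / inner ℝ ν (z - q₀)) ≤
      ENNReal.ofReal C * volume P * volume Z := by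
  obtain ⟨δ, hδ, hdet⟩ := exists_det_ge_half (k + 1)
  set N : ℝ := (((k + 1 : ℕ) : ℝ)⁻¹) ^ (k + 1) with hN
  have hN0 : 0 < N := by positivity
  set c : ℝ := 1 / 4 * N ^ 2 * (1 / 2) ^ k with hc
  have hc0 : 0 < c := by positivity
  have hk0 : (0 : ℝ) < ((k + 1 : ℕ) : ℝ) := by positivity
  -- The first summand absorbs the constants of the two volume bounds; the second ensures (k + 1)/C
  -- ≤ δ, as the perturbed frame requires.
  refine ⟨1 / c + ((k + 1 : ℕ) : ℝ) / δ, by positivity, ?_⟩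
  set C := 1 / c + ((k + 1 : ℕ) : ℝ) / δ with hC
  have hC0 : 0 < C := by positivity
  intro S Y m G y₀ κ D Z hZS hZc hZ q₀ hq₀ h hh hbd hsmall P hP hPG ν z u v l hν hz hnormal
    hu hv hl huv
  have hq₀Z := interior_subset hq₀
  obtain ⟨e, w, he0, hw, hmx, htri⟩ := exists_adapted_basis
    (hZc.image (f := fun q => q - q₀) (by fun_prop)) ⟨_, q₀, hq₀Z, rfl⟩ hν
  have hsup : ∀ i : Fin k, ∃ z ∈ frontier Z, ∀ q ∈ Z, inner ℝ (e i.succ) (q - z) ≤ 0 := fun i =>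
    exists_support_point hZc ⟨q₀, hq₀Z⟩ (e.orthonormal.ne_zero i.succ)
  choose zs hzs hzn using hsup
  set zz : Fin (k + 1) → E (k + 1) := Fin.cons z zs with hzz
  have hadm : ∀ i, 0 < inner ℝ (e i) (zz i - q₀) ∧ ∃ y ∈ Y, (∀ q ∈ Z, m q y - m q₀ y - h ≤ 0) ∧
      ‖G q₀ y - (h / inner ℝ (e i) (zz i - q₀)) • e i‖ ≤
        1 / C * (h / inner ℝ (e i) (zz i - q₀)) := by
    intro i
    refine D.exists_admissible hZS hZc.isClosed hZ hq₀ hh hbd hsmall ?_ (e.norm_eq_one i) ?_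
    · exact Fin.cases hz hzs i
    · refine Fin.cases ?_ (fun i => ?_) i
      · simpa [hzz, he0] using hnormal
      · simpa [hzz] using hzn i
  choose hd ys hys hysadm hysG using hadm
  have h0P : (0 : E (k + 1)) ∈ P := by
    rw [← D.base_grad_zero q₀ (hZS hq₀Z)]
    refine hPG y₀ D.base_mem fun q hq => ?_
    rw [D.base_zero q (hZS hq), D.base_zero q₀ (hZS hq₀Z)]
    linarith
  set d : Fin (k + 1) → ℝ := fun i => inner ℝ (e i) (zz i - q₀) with hdef
  have hnδ : ((k + 1 : ℕ) : ℝ) * (1 / C) ≤ δ := by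
    rw [mul_one_div, div_le_iff₀ hC0, hC, mul_add, mul_div_cancel₀ _ hδ.ne']
    have : 0 < δ * (1 / c) := by positivity
    linarith
  have hvP := volume_ge_of_near_frame hdet (by positivity) hnδ e hP h0P
    (fun i => hPG _ (hys i) (hysadm i)) (r := fun i => h / d i) (fun i => div_pos hh (hd i)) hysG
  -- The contact point zs i belongs to Z, and w i maximizes the component along e (i+1) over Z - q₀.
  have had : ∀ i : Fin k, d i.succ ≤ inner ℝ (e i.succ) (w i) := fun i =>
    hmx i _ ⟨zs i, hZc.isClosed.frontier_subset (hzs i), by simp [hzz]⟩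
  have hwZ : ∀ i, q₀ + w i ∈ Z := fun i => by
    obtain ⟨q, hq, hqw⟩ := hw i
    rw [← hqw]; simpa using hq
  have hvZ := volume_ge_of_chord e hZ hq₀Z hu hv hl (by rw [he0]; exact huv) hwZ htri
    fun i => (hd i.succ).le.trans (had i)
  have hd0 : d 0 = inner ℝ ν (z - q₀) := by simp [hdef, hzz, he0]
  rw [← hd0]
  refine ⟨hd 0, ?_⟩
  have hCc : 1 ≤ C * c := by
    rw [hC, add_mul, one_div_mul_cancel hc0.ne']
    have : 0 ≤ ((k + 1 : ℕ) : ℝ) / δ * c := by positivity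
    linarith
  exact ofReal_le_mul_mul hC0.le (half_prod_mul_nonneg hh hN0.le hd) (volume_product_arith hh hl hC0.le hCc hd had) hvP hvZ

end Volume

/-! ### The cost in the coordinate q and supports of c-convex functions. -/

section CoordinateChange

variable {n : ℕ} {U V : Set (E n)} {c : E n → E n → ℝ} {y₀ : E n}

namespace IsCrossCurvedCost

theorem qDomain_eq (H : IsCrossCurvedCost U V c) (hy₀ : y₀ ∈ closure V) :
    qDomain U V c y₀ = qCoord V c y₀ '' closure U :=
  ((H.twist_left y₀ hy₀).image_closure H.bounded_left).symm

theorem isCompact_qDomain (H : IsCrossCurvedCost U V c) (hy₀ : y₀ ∈ closure V) :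
    IsCompact (qDomain U V c y₀) := by
  rw [H.qDomain_eq hy₀]
  exact H.isCompact_left.image_of_continuousOn (H.twist_left y₀ hy₀).1.continuousOn

theorem xCoord_mem (H : IsCrossCurvedCost U V c) (hy₀ : y₀ ∈ closure V) {q : E n}
    (hq : q ∈ qDomain U V c y₀) : xCoord U V c y₀ q ∈ closure U := by
  rw [H.qDomain_eq hy₀] at hq
  exact Function.invFunOn_mem hq

theorem gradY_xCoord (H : IsCrossCurvedCost U V c) (hy₀ : y₀ ∈ closure V) {q : E n}
    (hq : q ∈ qDomain U V c y₀) : gradY V c (xCoord U V c y₀ q) y₀ = -q := by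
  rw [H.qDomain_eq hy₀] at hq
  exact neg_eq_iff_eq_neg.1 (Function.invFunOn_eq hq)

theorem continuousOn_xCoord (H : IsCrossCurvedCost U V c) (hy₀ : y₀ ∈ closure V) :
    ContinuousOn (xCoord U V c y₀) (qDomain U V c y₀) := by
  rw [H.qDomain_eq hy₀]
  obtain ⟨-, g, hg, hgf⟩ := H.twist_left y₀ hy₀
  refine hg.continuousOn.congr ?_
  rintro _ ⟨x, hx, rfl⟩
  exact ((hgf.injOn.leftInvOn_invFunOn hx).trans (hgf hx).symm)

/-- Passage from the cost to convex geometry: D_y c(x, y₀) - D_y c(x', y₀) becomes q' - q, and the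
Lipschitz constant is ε_c⁻¹. -/
theorem doublyConvexFamily (H : IsCrossCurvedCost U V c) (hU : U.Nonempty)
    (hy₀ : y₀ ∈ closure V) :
    DoublyConvexFamily (qDomain U V c y₀) (closure V) (fun q y => -modCost U V c y₀ q y)
      (fun q y => coneGrad U V c y₀ (xCoord U V c y₀ q) y) y₀
      (2 * betaPlus U V c ^ 4 * betaMinus U V c ^ 6 * normXXY U V c).toReal := by
  have hV : V.Nonempty := closure_nonempty_iff.1 ⟨_, hy₀⟩
  have hX : ContinuousOn (fun p : E n × E n => xCoord U V c y₀ p.1)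
      (qDomain U V c y₀ ×ˢ closure V) :=
    (H.continuousOn_xCoord hy₀).comp continuousOn_fst fun _ hp => hp.1
  have hXm : MapsTo (fun p : E n × E n => xCoord U V c y₀ p.1)
      (qDomain U V c y₀ ×ˢ closure V) (closure U) := fun _ hp => H.xCoord_mem hy₀ hp.1
  refine ⟨H.isCompact_right, hy₀, fun q _ => ?_, fun q _ => ?_, ?_, ?_, ?_, ?_, ?_⟩
  · simp [modCost]
  · simp [coneGrad]
  · exact ((H.continuousOn_cost_comp hX continuousOn_snd hXm fun _ hp => hp.2).sub
      (H.continuousOn_cost_comp hX continuousOn_const hXm fun _ _ => hy₀)).neg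
  · exact H.continuousOn_coneGrad_comp hU hV continuousOn_const hX continuousOn_snd
      (fun _ _ => hy₀) hXm fun _ hp => hp.2
  · intro q hq q' hq' y hy
    have := H.coneGrad_subgradient (H.xCoord_mem hy₀ hq) (H.xCoord_mem hy₀ hq') hy hy₀
    rw [H.gradY_xCoord hy₀ hq, H.gradY_xCoord hy₀ hq', neg_sub_neg] at this
    simp only [modCost]
    linarith
  · intro q hq y₁ hy₁ y₂ hy₂ t ht
    obtain ⟨y, hy, h1, h2⟩ := H.exists_segment_point (H.xCoord_mem hy₀ hq) hy₁ hy₂ ht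
    refine ⟨y, hy, ?_, fun q' hq' => ?_⟩
    · simp only [coneGrad]
      rw [h1, ← map_smul, ← map_smul, ← map_add]
      congr 1
      module
    · have := h2 _ (H.xCoord_mem hy₀ hq')
      simp only [modCost]
      linarith
  · intro q hq q' hq' y hy
    have := H.norm_coneGrad_sub_le (H.xCoord_mem hy₀ hq) (H.xCoord_mem hy₀ hq') hy hy₀
    rwa [H.gradY_xCoord hy₀ hq, H.gradY_xCoord hy₀ hq', neg_sub_neg, norm_sub_rev q' q] at this

/-- A `c`-convex function has a supporting `c`-function at each point. -/
theorem exists_supporting_of_isCConvex (H : IsCrossCurvedCost U V c) (hV : V.Nonempty)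
    {u : E n → ℝ} (hu : IsCConvex U V c u) {x : E n} (hx : x ∈ closure U) :
    ∃ y ∈ closure V, ∀ x' ∈ closure U, -c x' y + c x y ≤ u x' - u x := by
  have hVc : (closure V).Nonempty := hV.closure
  obtain ⟨M, hM⟩ := (H.isCompact_left.prod H.isCompact_right).exists_bound_of_continuousOn
    H.smooth.continuousOn
  have hM' : ∀ x ∈ closure U, ∀ y ∈ closure V, |c x y| ≤ M := fun x hx y hy => hM (x, y) ⟨hx, hy⟩
  -- If u were unbounded below, the suprema defining u^{c*} would run over unbounded sets, where
  -- `sSup` returns 0. Then c-convexity would give u ≥ -M, a contradiction.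
  obtain ⟨B, hB⟩ : ∃ B, ∀ x ∈ closure U, B ≤ u x := by
    by_contra! hcon
    have hzero : ∀ y ∈ closure V, cStarTransform U c u y = 0 := by
      intro y hy
      refine Real.sSup_of_not_bddAbove ?_
      rintro ⟨b, hb⟩
      obtain ⟨x', hx', hlt⟩ := hcon (-b - M)
      have h1 := hb ⟨x', hx', rfl⟩
      have h2 := (abs_le.1 (hM' x' hx' y hy)).2
      simp only at h1
      linarith
    obtain ⟨x', hx', hlt⟩ := hcon (-M)
    obtain ⟨y, hy⟩ := hVc
    have h1 : -c x' y - cStarTransform U c u y ≤ cTransform V c (cStarTransform U c u) x' := by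
      refine le_csSup ⟨M, ?_⟩ ⟨y, hy, rfl⟩
      rintro _ ⟨z, hz, rfl⟩
      have := (abs_le.1 (hM' x' hx' z hz)).1
      simp only [hzero z hz]
      linarith
    rw [hzero y hy, ← hu x' hx'] at h1
    have := (abs_le.1 (hM' x' hx' y hy)).2
    linarith
  have hstar : ∀ x ∈ closure U, ∀ y ∈ closure V, -c x y - cStarTransform U c u y ≤ u x := by
    intro x hx y hy
    have : -c x y - u x ≤ cStarTransform U c u y := by
      refine le_csSup ⟨M - B, ?_⟩ ⟨x, hx, rfl⟩
      rintro _ ⟨z, hz, rfl⟩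
      have h1 := (abs_le.1 (hM' z hz y hy)).1
      have h2 := hB z hz
      simp only
      linarith
    linarith
  -- A maximizing sequence in y. The value u^{c*}(y_k) cancels between the two inequalities, so no
  -- continuity of u^{c*} is needed.
  have happrox : ∀ k : ℕ, ∃ y ∈ closure V, u x - 1 / ((k : ℝ) + 1) <
      -c x y - cStarTransform U c u y := by
    intro k
    have hlt : u x - 1 / ((k : ℝ) + 1) < cTransform V c (cStarTransform U c u) x := by
      rw [← hu x hx]
      have : (0 : ℝ) < 1 / ((k : ℝ) + 1) := by positivity
      linarith
    obtain ⟨_, ⟨y, hy, rfl⟩, hlt⟩ := exists_lt_of_lt_csSup (hVc.image _) hlt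
    exact ⟨y, hy, hlt⟩
  choose ys hys hlt using happrox
  obtain ⟨y, hy, φ, hφ, hl⟩ := H.isCompact_right.tendsto_subseq hys
  refine ⟨y, hy, fun x' hx' => ?_⟩
  have hc : ∀ z ∈ closure U, Tendsto (fun k => c z (ys (φ k))) atTop (𝓝 (c z y)) := by
    intro z hz
    have h1 : ContinuousOn (fun y => c z y) (closure V) :=
      H.continuousOn_cost_comp continuousOn_const continuousOn_id (fun _ _ => hz) fun _ h => h
    exact (h1 y hy).tendsto.comp (tendsto_nhdsWithin_iff.2
      ⟨hl, Eventually.of_forall fun k => hys (φ k)⟩)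
  have hlim : Tendsto (fun k => -c x' (ys (φ k)) + c x (ys (φ k)) - 1 / ((φ k : ℝ) + 1)) atTop
      (𝓝 (-c x' y + c x y - 0)) :=
    ((hc x' hx').neg.add (hc x hx)).sub
      (tendsto_one_div_add_atTop_nhds_zero_nat.comp hφ.tendsto_atTop)
  rw [sub_zero] at hlim
  refine le_of_tendsto' hlim fun k => ?_
  have h1 := hlt (φ k)
  have h2 := hstar x' hx' _ (hys (φ k))
  linarith

/-- Each frontier point of a section of a `c`-convex function has a supporting function. -/
theorem exists_supportsAt (H : IsCrossCurvedCost U V c) (hy₀ : y₀ ∈ closure V) {u : E n → ℝ}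
    (hu : IsCConvex U V c u) {Z : Set (E n)}
    (hZ : Z = {q ∈ qDomain U V c y₀ | modPotential U V c y₀ u q ≤ 0}) {q₀ z : E n}
    (hq₀ : q₀ ∈ Z) (hz : z ∈ Z) (hz0 : modPotential U V c y₀ u z = 0) :
    ∃ y ∈ closure V, SupportsAt (fun q y => -modCost U V c y₀ q y) Z q₀
      (-modPotential U V c y₀ u q₀) z y := by
  have hmem : ∀ q ∈ Z, q ∈ qDomain U V c y₀ ∧ modPotential U V c y₀ u q ≤ 0 := fun q hq => by
    rwa [hZ] at hq
  obtain ⟨y, hy, hsup⟩ := H.exists_supporting_of_isCConvex (closure_nonempty_iff.1 ⟨_, hy₀⟩) hu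
    (H.xCoord_mem hy₀ (hmem z hz).1)
  refine ⟨y, hy, fun q hq => ?_, ?_⟩
  · have h1 := hsup _ (H.xCoord_mem hy₀ (hmem q hq).1)
    have h2 := (hmem q hq).2
    simp only [modPotential, modCost] at *
    linarith
  · have h1 := hsup _ (H.xCoord_mem hy₀ (hmem q₀ hq₀).1)
    simp only [modPotential, modCost] at *
    linarith

end IsCrossCurvedCost

end CoordinateChange

/-! ### The cone at its vertex, long chords and passage to the final form. -/

section Cone

variable {n : ℕ} {U V : Set (E n)} {c : E n → E n → ℝ} {y₀ : E n}

theorem convex_subdiff (S : Set (E n)) (f : E n → ℝ) (x : E n) : Convex ℝ (subdiff S f x) := by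
  intro p hp p' hp' a b ha hb hab ε hε
  filter_upwards [hp ε hε, hp' ε hε] with x' h1 h2
  obtain rfl : a = 1 - b := by linarith
  rw [inner_add_left, inner_smul_left, inner_smul_left]
  simp only [conj_trivial]
  nlinarith [mul_le_mul_of_nonneg_left h1 ha, mul_le_mul_of_nonneg_left h2 hb]

/-- All competitors take the value -h at the vertex, and y₀ is one of them because c̃(·, y₀) = 0; so
the supremum is not over the empty set. -/
theorem coneFun_vertex (hy₀ : y₀ ∈ closure V) {Z : Set (E n)} {q₀ : E n} {h : ℝ} (hh : 0 ≤ h) :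
    coneFun U V c y₀ Z q₀ h q₀ = -h := by
  have hset : (fun y => -modCost U V c y₀ q₀ y + modCost U V c y₀ q₀ y - h) ''
      {y ∈ closure V | ∀ z ∈ frontier Z,
        -modCost U V c y₀ z y + modCost U V c y₀ q₀ y - h ≤ 0} = {-h} := by
    refine Subset.antisymm ?_ ?_
    · rintro _ ⟨y, -, rfl⟩
      simp
    · rintro _ rfl
      refine ⟨y₀, ⟨hy₀, fun z _ => ?_⟩, by simp⟩
      simp [modCost, hh]
  rw [coneFun, hset, csSup_singleton]

/-- Compactness of `closure V` bounds the competitors, so the real supremum is a true upper bound.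
-/
theorem le_coneFun (H : IsCrossCurvedCost U V c) (hU : U.Nonempty) (hy₀ : y₀ ∈ closure V)
    {Z : Set (E n)} {q₀ q y : E n} {h : ℝ} (hq₀ : q₀ ∈ qDomain U V c y₀)
    (hq : q ∈ qDomain U V c y₀) (hy : y ∈ closure V)
    (hadm : ∀ z ∈ frontier Z, -modCost U V c y₀ z y + modCost U V c y₀ q₀ y - h ≤ 0) :
    -modCost U V c y₀ q y + modCost U V c y₀ q₀ y - h ≤ coneFun U V c y₀ Z q₀ h q := by
  have D := H.doublyConvexFamily hU hy₀
  have hc : ∀ q ∈ qDomain U V c y₀, ContinuousOn (fun y => -modCost U V c y₀ q y) (closure V) :=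
    fun q hq => D.continuousOn.comp (f := fun y => (q, y)) (by fun_prop) fun y hy => ⟨hq, hy⟩
  have hcont : ContinuousOn (fun y => -modCost U V c y₀ q y + modCost U V c y₀ q₀ y - h)
      (closure V) := by
    have := ((hc q hq).sub (hc q₀ hq₀)).sub (continuousOn_const (c := h))
    refine this.congr fun y _ => ?_
    simp only [Pi.sub_apply]
    ring
  refine le_csSup ?_ ⟨y, ⟨hy, hadm⟩, rfl⟩
  exact (H.isCompact_right.image_of_continuousOn hcont).bddAbove.mono
    (image_mono fun y hy => hy.1)

/-- Gradients of admissible functions belong to the subdifferential of the cone at its vertex. -/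
theorem coneGrad_mem_subdiff (H : IsCrossCurvedCost U V c) (hU : U.Nonempty)
    (hy₀ : y₀ ∈ closure V) {Z : Set (E n)} {q₀ y : E n} {h : ℝ} (hh : 0 ≤ h)
    (hq₀ : q₀ ∈ qDomain U V c y₀) (hy : y ∈ closure V)
    (hadm : ∀ z ∈ frontier Z, -modCost U V c y₀ z y + modCost U V c y₀ q₀ y - h ≤ 0)
    {f : E n → ℝ} (hf : ∀ q ∈ qDomain U V c y₀, f q = coneFun U V c y₀ Z q₀ h q) :
    coneGrad U V c y₀ (xCoord U V c y₀ q₀) y ∈ subdiff (qDomain U V c y₀) f q₀ := by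
  intro ε hε
  filter_upwards [self_mem_nhdsWithin] with q hq
  have h1 := le_coneFun H hU hy₀ hq₀ hq hy hadm
  have h2 := (H.doublyConvexFamily hU hy₀).subgradient q₀ hq₀ q hq y hy
  rw [hf q hq, hf q₀ hq₀, coneFun_vertex hy₀ hh]
  have h3 : 0 ≤ ε * ‖q - q₀‖ := by positivity
  linarith

/-- A nearly longest chord of a convex body in a given direction. -/
theorem exists_long_chord {Z : Set (E n)} (hZ : IsCompact Z) (hint : (interior Z).Nonempty)
    {ν : E n} (hν : ‖ν‖ = 1) : 0 < maxChord Z ν ∧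
      ∃ u ∈ Z, ∃ v ∈ Z, ∃ l : ℝ, maxChord Z ν / 2 ≤ l ∧ v = u + l • ν := by
  have hbdd : BddAbove (range fun b : E n => Metric.diam (Z ∩ lineThrough b ν)) := by
    refine ⟨Metric.diam Z, ?_⟩
    rintro _ ⟨b, rfl⟩
    exact Metric.diam_mono inter_subset_left hZ.isBounded
  have hpos : 0 < maxChord Z ν := by
    obtain ⟨q, hq⟩ := hint
    obtain ⟨δ, hδ, hmem⟩ := exists_segment_subset isOpen_interior hq ν
    refine lt_of_lt_of_le hδ (le_trans ?_ (le_csSup hbdd ⟨q, rfl⟩))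
    have h1 := interior_subset (hmem 1 (by norm_num))
    have h2 := Metric.dist_le_diam_of_mem
      (hZ.isBounded.subset (inter_subset_left (t := lineThrough q ν)))
      (x := q + (1 : ℝ) • δ • ν) (y := q) ⟨h1, ⟨δ, by simp⟩⟩
      ⟨interior_subset hq, ⟨0, by simp⟩⟩
    rwa [dist_eq_norm, add_sub_cancel_left, one_smul, norm_smul, hν, mul_one, Real.norm_eq_abs,
      abs_of_pos hδ] at h2
  refine ⟨hpos, ?_⟩
  obtain ⟨_, ⟨b, rfl⟩, hb⟩ := exists_lt_of_lt_csSup (range_nonempty _)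
    (show maxChord Z ν / 2 < sSup (range fun b : E n => Metric.diam (Z ∩ lineThrough b ν)) from
      half_lt_self hpos)
  obtain ⟨u, hu, v, hv, huv⟩ : ∃ u ∈ Z ∩ lineThrough b ν, ∃ v ∈ Z ∩ lineThrough b ν,
      maxChord Z ν / 2 < dist u v := by
    by_contra! hcon
    exact absurd (Metric.diam_le_of_forall_dist_le (by positivity) hcon) (not_le.2 hb)
  obtain ⟨huZ, s, rfl⟩ := hu
  obtain ⟨hvZ, t, rfl⟩ := hv
  simp only at huZ hvZ huv
  have hd : dist (b + s • ν) (b + t • ν) = |s - t| := by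
    rw [dist_eq_norm, add_sub_add_left_eq_sub, ← sub_smul, norm_smul, hν, mul_one,
      Real.norm_eq_abs]
  rw [hd] at huv
  rcases le_total s t with hst | hst
  · refine ⟨_, huZ, _, hvZ, t - s, ?_, by module⟩
    rw [abs_of_nonpos (by linarith)] at huv
    linarith
  · refine ⟨_, hvZ, _, huZ, s - t, ?_, by module⟩
    rw [abs_of_nonneg (by linarith)] at huv
    linarith

/-- Nonemptiness matters: `Metric.infDist` to the empty set is 0. -/
theorem le_infDist_hyperplane {ν q : E n} {a : ℝ} (hν : ‖ν‖ = 1)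
    (hne : (hyperplane ν a).Nonempty) : |a - inner ℝ ν q| ≤ Metric.infDist q (hyperplane ν a) := by
  refine (Metric.le_infDist hne).2 fun z hz => ?_
  have hz' : inner ℝ ν z = a := hz
  rw [← hz', ← inner_sub_right, dist_comm, dist_eq_norm]
  simpa [hν] using abs_real_inner_le_norm ν (z - q)

theorem mul_norm_le_of_ediam_le {K : ℝ≥0∞} {C : ℝ} (hC : 0 < C) {Z : Set (E n)}
    (hZ : Metric.ediam Z ≤ K⁻¹ / ENNReal.ofReal C) {p q : E n} (hp : p ∈ Z) (hq : q ∈ Z) :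
    K.toReal * ‖p - q‖ ≤ 1 / C := by
  have h1 : K * edist p q ≤ (ENNReal.ofReal C)⁻¹ :=
    calc K * edist p q ≤ K * (K⁻¹ / ENNReal.ofReal C) := by
          gcongr; exact (Metric.edist_le_ediam_of_mem hp hq).trans hZ
      _ = K * K⁻¹ * (ENNReal.ofReal C)⁻¹ := by rw [div_eq_mul_inv, mul_assoc]
      -- Only an inequality holds in general: for K = 0, that is ε_c = ∞, the product K * K⁻¹ is 0.
      _ ≤ 1 * (ENNReal.ofReal C)⁻¹ := by gcongr; exact ENNReal.mul_inv_le_one K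
      _ = _ := one_mul _
  have h2 := ENNReal.toReal_mono (by simp [hC]) h1
  rwa [ENNReal.toReal_mul, ENNReal.toReal_inv, ENNReal.toReal_ofReal hC.le, edist_dist,
    ENNReal.toReal_ofReal dist_nonneg, dist_eq_norm, ← one_div] at h2

/-- Multiplication by d/l ≤ 2d'/L. The factor 2 pays for a chord that has at least half the maximal
length instead of attaining it. -/
theorem ofReal_le_of_chord {X C d d' l L : ℝ} {v w : ℝ≥0∞} (hd : 0 < d)
    (hdd : d ≤ d') (hL : 0 < L) (hl : L / 2 ≤ l)
    (h : ENNReal.ofReal (X * l / d) ≤ ENNReal.ofReal C * v * w) :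
    ENNReal.ofReal X ≤ ENNReal.ofReal (2 * C * (d' / L)) * v * w := by
  have hl0 : 0 < l := by linarith
  have h1 : X = d / l * (X * l / d) := by field_simp
  have h2 : d / l ≤ 2 * (d' / L) := by
    rw [mul_div_assoc', div_le_div_iff₀ hl0 hL]
    nlinarith
  have h0 : 0 ≤ 2 * (d' / L) := (div_pos hd hl0).le.trans h2
  calc ENNReal.ofReal X = ENNReal.ofReal (d / l) * ENNReal.ofReal (X * l / d) := by
        rw [← ENNReal.ofReal_mul (by positivity), ← h1]
    _ ≤ ENNReal.ofReal (2 * (d' / L)) * (ENNReal.ofReal C * v * w) := by gcongr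
    _ = ENNReal.ofReal (2 * (d' / L)) * ENNReal.ofReal C * v * w := by simp only [mul_assoc]
    _ = _ := by rw [← ENNReal.ofReal_mul h0, show 2 * (d' / L) * C = 2 * C * (d' / L) by ring]

end Cone

end CCone

/-! ### The main estimate. -/

theorem proposition6p3 (n : ℕ) :
    ∃ C : ℝ, 0 < C ∧ ∀ (U V : Set (CCone.E n)) (c : CCone.E n → CCone.E n → ℝ),
      CCone.IsCrossCurvedCost U V c →
      0 < CCone.epsCost U V c ∧
      ∀ y₀ ∈ closure V, ∀ Z ⊆ CCone.qDomain U V c y₀, IsClosed Z → Convex ℝ Z →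
      ∀ (q₀ : CCone.E n) (h : CCone.E n → ℝ), CCone.IsCCone U V c y₀ Z q₀ h →
      ∀ (ν : CCone.E n) (a b : ℝ), ‖ν‖ = 1 →
        -- the hyperplanes `Π⁺ = {⟨ν, q⟩ = a}` and `Π⁻ = {⟨ν, q⟩ = b}` support `Z` on opposite sides
        (∀ q ∈ Z, b ≤ inner ℝ ν q ∧ inner ℝ ν q ≤ a) →
        (CCone.hyperplane ν a ∩ frontier Z).Nonempty →
        (CCone.hyperplane ν b ∩ frontier Z).Nonempty →
        Metric.ediam Z ≤ CCone.epsCost U V c / ENNReal.ofReal C →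
        ENNReal.ofReal (|h q₀| ^ n) ≤
          ENNReal.ofReal (C * (min (Metric.infDist q₀ (CCone.hyperplane ν a))
            (Metric.infDist q₀ (CCone.hyperplane ν b)) / CCone.maxChord Z ν)) *
          volume (CCone.subdiff (CCone.qDomain U V c y₀) h q₀) * volume Z := by
  open CCone in
  rcases n with _ | k
  -- In dimension 0 there is no unit normal.
  · refine ⟨1, one_pos, fun U V c H => ⟨H.epsCost_pos, ?_⟩⟩
    intro y₀ _ Z _ _ _ q₀ h _ ν a b hν
    rw [Subsingleton.elim ν 0, norm_zero] at hν
    exact absurd hν zero_ne_one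
  obtain ⟨C, hC, hmain⟩ := exists_cone_volume_bound k
  refine ⟨2 * C, by positivity, fun U V c H => ⟨H.epsCost_pos, ?_⟩⟩
  intro y₀ hy₀ Z hZS hZcl hZ q₀ f hcone ν a b hν hab hsa hsb hdiam
  obtain ⟨hq₀, u, hu, hZu, hu0, hneg, hf⟩ := hcone
  have hq₀Z := interior_subset hq₀
  have hq₀S := hZS hq₀Z
  have hU : U.Nonempty := closure_nonempty_iff.1 ⟨_, H.xCoord_mem hy₀ hq₀S⟩
  have D := H.doublyConvexFamily hU hy₀
  have hZc : IsCompact Z := (H.isCompact_qDomain hy₀).of_isClosed_subset hZcl hZS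
  have hfZ : frontier Z ⊆ Z := hZcl.frontier_subset
  set t := -modPotential U V c y₀ u q₀ with ht
  have ht0 : 0 < t := by linarith
  have hfq : |f q₀| = t := by
    rw [hf q₀ hq₀S, coneFun_vertex hy₀ ht0.le, abs_neg, abs_of_pos ht0]
  have hsmall : ∀ z ∈ Z, (2 * betaPlus U V c ^ 4 * betaMinus U V c ^ 6 * normXXY U V c).toReal *
      ‖q₀ - z‖ ≤ 1 / C := fun z hz =>
    (mul_norm_le_of_ediam_le (by positivity) hdiam hq₀Z hz).trans
      (one_div_le_one_div_of_le hC (by linarith))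
  have key := hmain _ _ _ _ _ _ D Z hZS hZc hZ q₀ hq₀ t ht0
    (fun z hz => H.exists_supportsAt hy₀ hu hZu hq₀Z (hfZ hz) (hu0 z hz)) hsmall
    (subdiff (qDomain U V c y₀) f q₀) (convex_subdiff _ _ _)
    (fun y hy hadm => coneGrad_mem_subdiff H hU hy₀ ht0.le hq₀S hy
      (fun z hz => by have := hadm z (hfZ hz); linarith) hf)
  obtain ⟨hL, p, hp, p', hp', l, hl, hpp⟩ := exists_long_chord hZc ⟨q₀, hq₀⟩ hν
  obtain ⟨za, hza, hzaf⟩ := hsa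
  obtain ⟨zb, hzb, hzbf⟩ := hsb
  have hza' : inner ℝ ν za = a := hza
  have hzb' : inner ℝ ν zb = b := hzb
  have hl0 : 0 ≤ l := le_trans (by positivity) hl
  obtain ⟨ha0, hva⟩ := key ν za p p' l hν hzaf
    (fun q hq => by rw [inner_sub_right, hza']; linarith [(hab q hq).2]) hp hp' hl0 hpp
  -- For the opposite hyperplane the outer normal is -ν, and the same chord is traversed backwards.
  obtain ⟨hb0, hvb⟩ := key (-ν) zb p' p l (by rwa [norm_neg]) hzbf
    (fun q hq => by
      rw [inner_neg_left, inner_sub_right, hzb']; linarith [(hab q hq).1]) hp' hp hl0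
    (by rw [hpp]; module)
  have hda : inner ℝ ν (za - q₀) ≤ Metric.infDist q₀ (hyperplane ν a) := by
    rw [inner_sub_right, hza']
    exact (le_abs_self _).trans (le_infDist_hyperplane hν ⟨za, hza⟩)
  have hdb : inner ℝ (-ν) (zb - q₀) ≤ Metric.infDist q₀ (hyperplane ν b) := by
    rw [inner_neg_left, inner_sub_right, hzb']
    exact (neg_le_abs _).trans (le_infDist_hyperplane hν ⟨zb, hzb⟩)
  rw [hfq]
  -- Both estimates hold; the one for the nearer hyperplane gives the minimum.
  rcases le_total (inner ℝ ν (za - q₀)) (inner ℝ (-ν) (zb - q₀)) with hle | hle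
  · exact ofReal_le_of_chord ha0 (le_min hda (hle.trans hdb)) hL hl hva
  · exact ofReal_le_of_chord hb0 (le_min (hle.trans hda) hdb) hL hl hvb
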